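/- **Setting.** For real $\epsilon$ near $0$ put $a = 1 + \frac{2\epsilon}{\pi}$. All function spaces are over $\mathbb{R}$, and $F$, $v$ are real-valued. With $\hat f(\xi) = \frac{1}{\sqrt{2\pi}}\int_{\mathbb{R}} e^{-ix\xi} f(x)\,dx$, let $\mathbb{H}f(x) = \frac{1}{i\pi}\,\mathrm{p.v.}\!\int_{\mathbb{R}} \frac{f(y)}{x-y}\,dy$ be the Hilbert transform, that is, on $L^2(\mathbb{R})$, the Fourier multiplier with symbol $-\mathrm{sgn}(\xi)$. Let $G_x$ be the function with $\widehat{G_x}(\xi) = \frac{\sqrt 2}{\sqrt \pi} e^{-a|\xi|^3}$, and let $i\mathbb{H}G$ be the primitive of $i\mathbb{H}G_x$ whose additive constant is fixed by $$ i\mathbb{H}G(x) = \frac1\pi \log(a^2+x^2) + \frac1\epsilon \log\Big(1+\frac{2\epsilon}{\pi}\Big) + V(x), \qquad V(x) = -\int_x^\infty \Big( i\mathbb{H}G_x(y) - \frac{2}{\pi}\frac{y}{a^2+y^2}\Big)\,dy . $$ Define the weight $w = e^{3\epsilon\, i\mathbb{H}G}$ (so $w = 1$ if $\epsilon = 0$),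 $\|v\|_{L^2_w} = \|w^{1/2} v\|_{L^2}$ and, with distributional derivatives and $\|v\|_{\dot H^k} = \|\partial_x^k v\|_{L^2}$, $$ \|v\|_X = \|v\|_{L^2_w} + \|x v_x\|_{L^2_w} + \|v\|_{\dot H^1} + \|v\|_{\dot H^3}. $$ **Theorem.** There exist universal constants $\epsilon_0 > 0$ and $C > 0$ such that the following holds for all $\epsilon$ with $|\epsilon| \le \epsilon_0$ and all $F$ with $F \in L^2(\mathbb{R})$ and $w^{-1/2}F \in L^2(\mathbb{R})$. There is a unique solution $v \in L^2_w(\mathbb{R}) \cap \dot H^1(\mathbb{R}) \cap \dot H^3(\mathbb{R})$ with $x v_x \in L^2_w(\mathbb{R})$ of the equation $$ i\mathbb{H} v_{xxx} + w\,\frac{x}{3a}\, v_x = F \quad \text{(a.e. on } \mathbb{R}).$$ Moreover, $$ \|v\|_X \le C\big( \|F\|_{L^2} + \|w^{-1/2}F\|_{L^2} \big), $$ and $$ \big\|(1+x^2)^{1/8} v_{xx}\big\|_{L^2} + \big\|(1+x^2)^{1/8} v\big\|_{L^\infty} \le C \|v\|_X \le C^2\big( \|F\|_{L^2} + \|w^{-1/2}F\|_{L^2}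 \big). $$ -/

import Mathlib

open MeasureTheory
open scoped FourierTransform ENNReal NNReal ContDiff

noncomputable section

namespace SelfSimilar

/-! ### Hilbert transform on `L²(ℝ)` -/

/-- The Fourier symbol `-sgn ξ` of the Hilbert transform
`ℍ f(x) = (1 / (iπ)) p.v. ∫ f(y) / (x - y) dy`. -/
def hilbertSymbol (ξ : ℝ) : ℂ := -((Real.sign ξ : ℝ) : ℂ)

theorem measurable_hilbertSymbol : Measurable hilbertSymbol := by
  unfold hilbertSymbol
  refine (Complex.measurable_ofReal.comp ?_).neg
  unfold Real.sign
  exact Measurable.ite measurableSet_Iio measurable_const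
    (Measurable.ite measurableSet_Ioi measurable_const measurable_const)

theorem norm_hilbertSymbol_le (ξ : ℝ) : ‖hilbertSymbol ξ‖ ≤ 1 := by
  rcases Real.sign_apply_eq ξ with h | h | h <;> simp [hilbertSymbol, h]

theorem memLp_hilbertSymbol_mul {f : ℝ → ℂ} (hf : MemLp f 2 volume) :
    MemLp (fun ξ => hilbertSymbol ξ * f ξ) 2 volume := by
  refine hf.of_le (measurable_hilbertSymbol.aestronglyMeasurable.mul hf.1) ?_
  filter_upwards with ξ
  rw [norm_mul]
  exact mul_le_of_le_one_left (norm_nonneg _) (norm_hilbertSymbol_le ξ)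

/-- The Hilbert transform on `L²(ℝ)`, as the Fourier multiplier with symbol `-sgn ξ`
(a symbol which does not depend on the normalization of the Fourier transform). -/
def hilbertL2 (f : Lp ℂ 2 (volume : Measure ℝ)) : Lp ℂ 2 (volume : Measure ℝ) :=
  𝓕⁻ ((memLp_hilbertSymbol_mul (Lp.memLp (𝓕 f))).toLp
    (fun ξ => hilbertSymbol ξ * (𝓕 f : Lp ℂ 2 (volume : Measure ℝ)) ξ))

open Classical in
/-- The Hilbert transform of a square integrable function, as a function defined up to null sets.
It is set to `0` off `L²`, where it is never used. -/
def hilbert (f : ℝ → ℂ) : ℝ → ℂ :=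
  if hf : MemLp f 2 volume then hilbertL2 (hf.toLp f) else 0

/-! ### Weak derivatives and homogeneous Sobolev spaces -/

/-- `g` is the `k`-th derivative of `v` in the sense of distributions, both being in `L¹_loc`. -/
def IsWeakDeriv (k : ℕ) (v g : ℝ → ℝ) : Prop :=
  LocallyIntegrable v volume ∧ LocallyIntegrable g volume ∧
    ∀ φ : ℝ → ℝ, ContDiff ℝ ∞ φ → HasCompactSupport φ →
      ∫ x, v x * iteratedDeriv k φ x = (-1) ^ k * ∫ x, g x * φ x

/-- `v` has a `k`-th distributional derivative in `L¹_loc`. -/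
def HasWeakDeriv (k : ℕ) (v : ℝ → ℝ) : Prop := ∃ g, IsWeakDeriv k v g

open Classical in
/-- The `k`-th distributional derivative of `v`, a function determined up to null sets
when `HasWeakDeriv k v` (and `0` otherwise). -/
def weakDeriv (k : ℕ) (v : ℝ → ℝ) : ℝ → ℝ :=
  if h : HasWeakDeriv k v then Classical.choose h else 0

/-- Membership in the homogeneous Sobolev space `Ḣᵏ(ℝ)`, `k` a natural number. -/
def MemHdot (k : ℕ) (v : ℝ → ℝ) : Prop :=
  HasWeakDeriv k v ∧ MemLp (weakDeriv k v) 2 volume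

/-! ### The profile `G` and the weight `w` -/

/-- The exponent `a = 1 + 2 ε / π`. -/
def aExp (ε : ℝ) : ℝ := 1 + 2 * ε / Real.pi

/-- `Ĝ_x(ξ) = (√2 / √π) exp (-a |ξ|³)`, for the Fourier transform
`f̂(ξ) = (1 / √(2π)) ∫ exp (-i x ξ) f(x) dx`. -/
def dGHat (a ξ : ℝ) : ℝ := Real.sqrt 2 / Real.sqrt Real.pi * Real.exp (-a * |ξ| ^ 3)

/-- `i ℍ G_x`, by Fourier inversion of `i · (-sgn ξ) · Ĝ_x(ξ)`; the integral is real. -/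
def iHdG (a x : ℝ) : ℝ :=
  ((1 / Real.sqrt (2 * Real.pi) : ℝ) *
    ∫ ξ : ℝ, Complex.exp (Complex.I * x * ξ) *
      (Complex.I * hilbertSymbol ξ * (dGHat a ξ : ℂ)) : ℂ).re

/-- `V(x) = -∫_x^∞ (i ℍ G_x(y) - (2 / π) y / (a² + y²)) dy`: up to a constant,
`i ℍ G` is `(1 / π) log (a² + x²) + V(x)`, and `V` vanishes at infinity. -/
def profileV (a x : ℝ) : ℝ :=
  -∫ y in Set.Ioi x, (iHdG a y - 2 / Real.pi * (y / (a ^ 2 + y ^ 2)))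

/-- The primitive `i ℍ G` of `i ℍ G_x`, with its additive constant fixed by
`i ℍ G(x) - (1 / π) log (a² + x²) → (1 / ε) log (1 + 2 ε / π)` at infinity.
(For `ε = 0` the value of the constant is immaterial, since only `ε · i ℍ G` is used.) -/
def iHG (ε x : ℝ) : ℝ :=
  1 / Real.pi * Real.log (aExp ε ^ 2 + x ^ 2) + 1 / ε * Real.log (1 + 2 * ε / Real.pi)
    + profileV (aExp ε) x

/-- The weight `w = exp (3 ε i ℍ G)`. -/
def weight (ε x : ℝ) : ℝ := Real.exp (3 * ε * iHG ε x)

/-! ### Weighted spaces, the norm of `X`, and the linear equation -/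

/-- `v ∈ L²_w`, i.e. `w^{1/2} v ∈ L²`. -/
def MemL2w (ε : ℝ) (v : ℝ → ℝ) : Prop :=
  MemLp (fun x => weight ε x ^ (1 / 2 : ℝ) * v x) 2 volume

/-- `‖v‖_{L²_w} = ‖w^{1/2} v‖_{L²}`. -/
def normL2w (ε : ℝ) (v : ℝ → ℝ) : ℝ≥0∞ :=
  eLpNorm (fun x => weight ε x ^ (1 / 2 : ℝ) * v x) 2 volume

/-- `‖v‖_{Ḣᵏ} = ‖∂ₓᵏ v‖_{L²}`. -/
def normHdot (k : ℕ) (v : ℝ → ℝ) : ℝ≥0∞ := eLpNorm (weakDeriv k v) 2 volume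

/-- `‖v‖_X = ‖v‖_{L²_w} + ‖x v_x‖_{L²_w} + ‖v‖_{Ḣ¹} + ‖v‖_{Ḣ³}`. -/
def normX (ε : ℝ) (v : ℝ → ℝ) : ℝ≥0∞ :=
  normL2w ε v + normL2w ε (fun x => x * weakDeriv 1 v x) + normHdot 1 v + normHdot 3 v

/-- `v ∈ L²_w ∩ Ḣ¹ ∩ Ḣ³` with `x v_x ∈ L²_w`. -/
def MemX (ε : ℝ) (v : ℝ → ℝ) : Prop :=
  MemL2w ε v ∧ MemHdot 1 v ∧ MemHdot 3 v ∧ MemL2w ε (fun x => x * weakDeriv 1 v x)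

/-- `v` solves `i ℍ v_xxx + w (x / (3a)) v_x = F` almost everywhere. For `v` in the class `MemX`,
all terms are locally square integrable functions. -/
def SolvesLinear (ε : ℝ) (F v : ℝ → ℝ) : Prop :=
  ∀ᵐ x ∂(volume : Measure ℝ),
    Complex.I * hilbert (fun y => (weakDeriv 3 v y : ℂ)) x
      + ((weight ε x * (x / (3 * aExp ε)) * weakDeriv 1 v x : ℝ) : ℂ) = (F x : ℂ)

/-- `‖F‖_{L²} + ‖w^{-1/2} F‖_{L²}`. -/
def normData (ε : ℝ) (F : ℝ → ℝ) : ℝ≥0∞ :=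
  eLpNorm F 2 volume + eLpNorm (fun x => weight ε x ^ (-(1 / 2) : ℝ) * F x) 2 volume

end SelfSimilar

end

open SelfSimilar

namespace SelfSimilar

open Filter Topology
open scoped ComplexConjugate

/-! ### Real functions with smooth compactly supported Fourier transform -/

/-! On the Fourier side `i ℍ ∂ₓ³` is `-|D|³`, so with `W = w / a` the equation reads `-|D|³ v + W x
v' / 3 = F`. Everything rests on one cancellation. Commuting the dilation generator `x ∂ₓ` with an
operator of homogeneity exactly three gives `⟨|D|³ v, v⟩ = ⟨|D|³ v, x v'⟩`. Testing the equation
with `v - x v'` therefore removes the nonlocal term and leaves the transport term, which controls `∫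
W v²` and `∫ W (x v')²` when the weight varies slowly, in the sense `|x W'| ≤ W / 2`; coefficients
within a factor `1 ± 1/10` of such a weight are also allowed (`energy_estimate`).

The profile differs from the conjugate Poisson kernel by an integrable remainder, so for small `ε`
the quotient `w / a` is close to a power of `1 + x²` (`goodWeight`). It is compared with
`modelWeight`, a sum of functions `x² / (4ᵏ + x²)` which is bounded for fixed `N`, satisfies
estimates uniform in `N`, and has an explicit commutator with the Hilbert transform. If the weight
decays, `|D|³ v` is read off the equation. If it grows, the energy does not control `W x v'` in
`L²`; then `F²` is expanded, the cross term is integrated by parts once, and what remains is a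
commutator bounded by `‖v'‖²` (`abs_integral_hilbert_mul_model_le`). Interpolation closes
`apriori_estimate`.

For existence, the range on test functions is dense in `L²`: the method of continuity reduces this
to `W = 1`, where the operator is a first order differential operator in frequency and an orthogonal
function would be a multiple of `exp (κ ξ³)` on a half-line, which is not square integrable. The
test functions have smooth Fourier transform with compact support away from the origin, where all
multipliers in use are smooth. Approximate solutions with truncated weights then converge weakly to
a solution (`GoodWeight.exists_solution`).

For uniqueness, a solution of the homogeneous equation is tested with a cut-off of itself: `-|D|³`
and the transport term both give nonpositive forms, hence both vanish
(`GoodWeight.eq_zero_of_homogeneous`). The weighted bounds come from testing `v'''` with `(1 +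
x²)^{1/4} v'`, and from integrating the derivative of `(1 + x²)^{1/4} v²`. -/

/-- Smooth compactly supported functions on the frequency side which are the Fourier transform
of a real function. -/
structure IsHermTest (g : ℝ → ℂ) : Prop where
  smooth : ContDiff ℝ ∞ g
  compact : HasCompactSupport g
  herm : ∀ ξ, g (-ξ) = conj (g ξ)

/-- Frequency side test functions which moreover vanish near the origin. -/
structure IsSpectral (g : ℝ → ℂ) : Prop extends IsHermTest g where
  zero : ∀ᶠ ξ in 𝓝 0, g ξ = 0

/-- The real function with Fourier transform `g`. -/
noncomputable def synth (g : ℝ → ℂ) (x : ℝ) : ℝ := (𝓕⁻ g x).re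

theorem fourierInv_real_eq (g : ℝ → ℂ) (x : ℝ) :
    𝓕⁻ g x = ∫ ξ : ℝ, Complex.exp (2 * Real.pi * Complex.I * x * ξ) * g ξ := by
  rw [Real.fourierInv_eq']
  congr 1
  ext ξ
  simp only [smul_eq_mul, RCLike.inner_apply, conj_trivial]
  congr 2
  push_cast
  ring

theorem conj_fourierInv_of_herm {g : ℝ → ℂ} (hg : ∀ ξ, g (-ξ) = conj (g ξ)) (x : ℝ) :
    conj (𝓕⁻ g x) = 𝓕⁻ g x := by
  rw [fourierInv_real_eq, ← integral_conj, ← integral_neg_eq_self]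
  congr 1
  ext ξ
  simp only [map_mul, hg, Complex.conj_conj, ← Complex.exp_conj, Complex.conj_ofReal,
    Complex.conj_I, map_ofNat]
  congr 2
  push_cast
  ring

theorem coe_synth_of_herm {g : ℝ → ℂ} (hg : ∀ ξ, g (-ξ) = conj (g ξ)) (x : ℝ) :
    (synth g x : ℂ) = 𝓕⁻ g x :=
  Complex.conj_eq_iff_re.mp (conj_fourierInv_of_herm hg x)

theorem IsHermTest.coe_synth {g : ℝ → ℂ} (hg : IsHermTest g) (x : ℝ) :
    (synth g x : ℂ) = 𝓕⁻ g x := coe_synth_of_herm hg.herm x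

/-- The Schwartz function underlying a test function. -/
noncomputable def IsHermTest.schwartz {g : ℝ → ℂ} (hg : IsHermTest g) : SchwartzMap ℝ ℂ :=
  hg.compact.toSchwartzMap hg.smooth

theorem IsHermTest.coe_schwartz {g : ℝ → ℂ} (hg : IsHermTest g) : (hg.schwartz : ℝ → ℂ) = g := rfl

theorem IsHermTest.fourierInv_schwartz {g : ℝ → ℂ} (hg : IsHermTest g) (x : ℝ) :
    (𝓕⁻ hg.schwartz) x = (synth g x : ℂ) := by
  rw [hg.coe_synth, SchwartzMap.fourierInv_coe, hg.coe_schwartz]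

theorem IsHermTest.memLp_coe_synth {g : ℝ → ℂ} (hg : IsHermTest g) :
    MemLp (fun x => (synth g x : ℂ)) 2 volume := by
  have := (𝓕⁻ hg.schwartz).memLp 2 volume
  refine this.congr_norm ?_ ?_
  · refine this.1.congr (ae_of_all _ fun x => hg.fourierInv_schwartz x)
  · exact ae_of_all _ fun x => by rw [hg.fourierInv_schwartz]

theorem IsHermTest.memLp_synth {g : ℝ → ℂ} (hg : IsHermTest g) : MemLp (synth g) 2 volume := by
  simpa using hg.memLp_coe_synth.re

theorem IsHermTest.memLp {g : ℝ → ℂ} (hg : IsHermTest g) : MemLp g 2 volume :=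
  hg.smooth.continuous.memLp_of_hasCompactSupport hg.compact

theorem IsHermTest.integrable {g : ℝ → ℂ} (hg : IsHermTest g) : Integrable g :=
  hg.smooth.continuous.integrable_of_hasCompactSupport hg.compact

/-- Parseval's identity. -/
theorem integral_synth_mul_synth {g₁ g₂ : ℝ → ℂ} (h₁ : IsHermTest g₁) (h₂ : IsHermTest g₂) :
    ∫ x, synth g₁ x * synth g₂ x = ∫ ξ, (conj (g₁ ξ) * g₂ ξ).re := by
  have h := SchwartzMap.integral_inner_fourier_fourier (𝓕⁻ h₁.schwartz) (𝓕⁻ h₂.schwartz)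
  simp only [FourierTransform.fourier_fourierInv_eq, h₁.fourierInv_schwartz,
    h₂.fourierInv_schwartz, h₁.coe_schwartz, h₂.coe_schwartz, RCLike.inner_apply,
    Complex.conj_ofReal] at h
  have h' := congrArg Complex.re h
  have e : (∫ x, (synth g₂ x : ℂ) * (synth g₁ x : ℂ)) = ((∫ x, synth g₁ x * synth g₂ x : ℝ) : ℂ) := by
    rw [← integral_complex_ofReal]
    congr 1; ext x; push_cast; ring_nf
  rw [e, Complex.ofReal_re] at h'
  rw [← h', ← RCLike.re_eq_complex_re, ← integral_re]
  · congr 1; ext ξ; rw [mul_comm]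
  · exact h₂.memLp.integrable_mul h₁.memLp.star

theorem integral_synth_sq {g : ℝ → ℂ} (h : IsHermTest g) :
    ∫ x, synth g x ^ 2 = ∫ ξ, ‖g ξ‖ ^ 2 := by
  simp only [pow_two (synth g _), integral_synth_mul_synth h h]
  congr 1; ext ξ
  rw [← Complex.normSq_eq_conj_mul_self, Complex.ofReal_re, Complex.normSq_eq_norm_sq]

theorem IsHermTest.add {g₁ g₂ : ℝ → ℂ} (h₁ : IsHermTest g₁) (h₂ : IsHermTest g₂) :
    IsHermTest (fun ξ => g₁ ξ + g₂ ξ) where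
  smooth := h₁.smooth.add h₂.smooth
  compact := h₁.compact.add h₂.compact
  herm ξ := by simp [h₁.herm, h₂.herm]

theorem IsHermTest.smul {g : ℝ → ℂ} (h : IsHermTest g) (c : ℝ) :
    IsHermTest (fun ξ => (c : ℂ) * g ξ) where
  smooth := contDiff_const.mul h.smooth
  compact := h.compact.mul_left
  herm ξ := by simp [h.herm]

theorem IsSpectral.add {g₁ g₂ : ℝ → ℂ} (h₁ : IsSpectral g₁) (h₂ : IsSpectral g₂) :
    IsSpectral (fun ξ => g₁ ξ + g₂ ξ) where
  toIsHermTest := h₁.toIsHermTest.add h₂.toIsHermTest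
  zero := by filter_upwards [h₁.zero, h₂.zero] with ξ a b; simp [a, b]

theorem IsSpectral.smul {g : ℝ → ℂ} (h : IsSpectral g) (c : ℝ) :
    IsSpectral (fun ξ => (c : ℂ) * g ξ) where
  toIsHermTest := h.toIsHermTest.smul c
  zero := by filter_upwards [h.zero] with ξ a; simp [a]

/-- Multiplication by a Hermitian multiplier which is smooth off the origin. -/
theorem IsSpectral.mul {g : ℝ → ℂ} (h : IsSpectral g) {m : ℝ → ℂ}
    (hm : ∀ ξ, ξ ≠ 0 → ContDiffAt ℝ ∞ m ξ) (hm' : ∀ ξ, ξ ≠ 0 → m (-ξ) = conj (m ξ)) :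
    IsSpectral (fun ξ => m ξ * g ξ) where
  smooth := by
    rw [contDiff_iff_contDiffAt]
    intro ξ
    by_cases hξ : ξ = 0
    · subst hξ
      refine (contDiffAt_const (c := (0 : ℂ))).congr_of_eventuallyEq ?_
      filter_upwards [h.zero] with ξ a; simp [a]
    · exact (hm ξ hξ).mul h.smooth.contDiffAt
  compact := h.compact.mul_left
  herm ξ := by
    by_cases hξ : ξ = 0
    · subst hξ; simp [h.zero.self_of_nhds]
    · simp [h.herm, hm' ξ hξ]
  zero := by filter_upwards [h.zero] with ξ a; simp [a]

/-- The symbol of the derivative. -/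
noncomputable def symD (ξ : ℝ) : ℂ := 2 * Real.pi * Complex.I * ξ

/-- The symbol `|2πξ|³` of `|D|³`. -/
noncomputable def symA (ξ : ℝ) : ℂ := ((|2 * Real.pi * ξ| ^ 3 : ℝ) : ℂ)

/-- The symbol `-i sgn ξ` of the real Hilbert transform. -/
noncomputable def symS (ξ : ℝ) : ℂ := -Complex.I * (Real.sign ξ : ℝ)

/-- The frequency side of differentiation. -/
noncomputable def mulD (g : ℝ → ℂ) (ξ : ℝ) : ℂ := symD ξ * g ξ

/-- The frequency side of `|D|³`. -/
noncomputable def mulA (g : ℝ → ℂ) (ξ : ℝ) : ℂ := symA ξ * g ξ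

/-- The frequency side of the real Hilbert transform. -/
noncomputable def mulS (g : ℝ → ℂ) (ξ : ℝ) : ℂ := symS ξ * g ξ

theorem IsSpectral.test_mulD {g : ℝ → ℂ} (h : IsSpectral g) : IsSpectral (mulD g) := by
  refine h.mul (fun ξ _ => ?_) (fun ξ _ => ?_)
  · unfold symD
    exact (contDiff_const.mul Complex.ofRealCLM.contDiff).contDiffAt
  · simp [symD, map_ofNat]

theorem IsSpectral.test_mulA {g : ℝ → ℂ} (h : IsSpectral g) : IsSpectral (mulA g) := by
  refine h.mul (fun ξ hξ => ?_) (fun ξ _ => ?_)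
  · unfold symA
    refine Complex.ofRealCLM.contDiff.contDiffAt.comp ξ ?_
    refine ContDiffAt.pow (ContDiffAt.abs (by fun_prop) ?_) 3
    have := Real.pi_pos
    positivity
  · simp [symA, abs_mul, map_ofNat]

/-- The sign is locally constant off the origin, and vanishing near the origin hides its jump; this
is the reason for working with `IsSpectral` rather than `IsHermTest`. -/
theorem IsSpectral.test_mulS {g : ℝ → ℂ} (h : IsSpectral g) : IsSpectral (mulS g) := by
  refine h.mul (fun ξ hξ => ?_) (fun ξ _ => ?_)
  · unfold symS
    refine contDiffAt_const.mul ?_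
    refine (contDiffAt_const (c := ((Real.sign ξ : ℝ) : ℂ))).congr_of_eventuallyEq ?_
    rcases lt_or_gt_of_ne hξ with h0 | h0
    · filter_upwards [gt_mem_nhds h0] with y hy
      rw [Real.sign_of_neg h0, Real.sign_of_neg hy]
    · filter_upwards [lt_mem_nhds h0] with y hy
      rw [Real.sign_of_pos h0, Real.sign_of_pos hy]
  · simp [symS, Real.sign_neg]

theorem IsHermTest.hasDerivAt_synth {g : ℝ → ℂ} (h : IsHermTest g) (x : ℝ) :
    HasDerivAt (synth g) (synth (mulD g) x) x := by
  have i₂ : Integrable (fun ξ : ℝ => ξ • g ξ) := by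
    refine Continuous.integrable_of_hasCompactSupport ?_ ?_
    · have := h.smooth.continuous
      fun_prop
    · exact HasCompactSupport.smul_left (f := fun ξ : ℝ => ξ) (f' := g) h.compact
  have h1 := Real.hasDerivAt_fourier h.integrable i₂ (-x)
  have h2 := h1.scomp x (hasDerivAt_neg x)
  have h3 : HasDerivAt (fun y => 𝓕⁻ g y) (𝓕⁻ (mulD g) x) x := by
    have e1 : (fun y => 𝓕⁻ g y) = 𝓕 g ∘ Neg.neg := by
      ext y; rw [Real.fourierInv_eq_fourier_neg]; rfl
    have e2 : 𝓕⁻ (mulD g) x =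
        (-1 : ℝ) • 𝓕 (fun ξ : ℝ => (-2 * Real.pi * Complex.I * ξ) • g ξ) (-x) := by
      rw [Real.fourierInv_eq_fourier_neg, Real.fourier_real_eq, Real.fourier_real_eq,
        ← integral_smul]
      congr 1; ext ξ
      simp only [smul_eq_mul, mulD, symD, neg_mul, neg_smul, one_smul, smul_neg, neg_neg]
    rw [e1, e2]; exact h2
  exact Complex.reCLM.hasFDerivAt.comp_hasDerivAt x h3

theorem continuous_synth {g : ℝ → ℂ} (h : IsHermTest g) : Continuous (synth g) :=
  continuous_iff_continuousAt.mpr fun x => (h.hasDerivAt_synth x).continuousAt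

/-- The frequency side of multiplication by `x`. -/
noncomputable def opX (g : ℝ → ℂ) (ξ : ℝ) : ℂ := Complex.I / (2 * Real.pi) * deriv g ξ

/-- The minus sign is compensated by the factor `i` in `opX`, so that multiplication by `x`
preserves real functions. -/
theorem deriv_herm {g : ℝ → ℂ} (hg : Differentiable ℝ g) (h : ∀ ξ, g (-ξ) = conj (g ξ)) (ξ : ℝ) :
    deriv g (-ξ) = -conj (deriv g ξ) := by
  have h1 : HasDerivAt (fun y => g (-y)) ((-1 : ℝ) • deriv g (-ξ)) ξ :=
    (hg (-ξ)).hasDerivAt.scomp ξ (hasDerivAt_neg ξ)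
  have h2 : HasDerivAt (fun y => conj (g y)) (conj (deriv g ξ)) ξ :=
    (Complex.conjCLE : ℂ →L[ℝ] ℂ).hasFDerivAt.comp_hasDerivAt ξ (hg ξ).hasDerivAt
  have e : (fun y => g (-y)) = fun y => conj (g y) := funext h
  rw [e] at h1
  have := h1.unique h2
  rw [← this]; simp

theorem IsHermTest.differentiable {g : ℝ → ℂ} (h : IsHermTest g) : Differentiable ℝ g :=
  h.smooth.differentiable (by simp)

theorem IsHermTest.test_opX {g : ℝ → ℂ} (h : IsHermTest g) : IsHermTest (opX g) where
  smooth := contDiff_const.mul (contDiff_infty_iff_deriv.mp h.smooth).2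
  compact := h.compact.deriv.mul_left
  herm ξ := by
    unfold opX
    rw [deriv_herm h.differentiable h.herm]
    simp [neg_div, map_ofNat]

theorem IsSpectral.test_opX {g : ℝ → ℂ} (h : IsSpectral g) : IsSpectral (opX g) where
  toIsHermTest := h.toIsHermTest.test_opX
  zero := by
    filter_upwards [h.zero.eventually_nhds] with ξ a
    have : deriv g ξ = 0 := by
      rw [Filter.EventuallyEq.deriv_eq (f := fun _ => (0 : ℂ)) a]; simp
    simp [opX, this]

theorem IsHermTest.synth_opX {g : ℝ → ℂ} (h : IsHermTest g) (x : ℝ) :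
    synth (opX g) x = x * synth g x := by
  have i : Integrable (deriv g) :=
    (h.smooth.continuous_deriv (by simp)).integrable_of_hasCompactSupport h.compact.deriv
  have h1 := congrFun (Real.fourier_deriv h.integrable h.differentiable i) (-x)
  apply Complex.ofReal_injective
  rw [h.test_opX.coe_synth, Complex.ofReal_mul, h.coe_synth, Real.fourierInv_eq_fourier_neg,
    Real.fourierInv_eq_fourier_neg]
  have e : 𝓕 (opX g) (-x) = Complex.I / (2 * Real.pi) * 𝓕 (deriv g) (-x) := by
    rw [Real.fourier_real_eq, Real.fourier_real_eq, ← integral_const_mul]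
    congr 1; ext ξ
    simp only [opX, Circle.smul_def, smul_eq_mul]; ring
  rw [e, h1]
  have hp : (Real.pi : ℂ) ≠ 0 := by exact_mod_cast Real.pi_ne_zero
  simp only [smul_eq_mul]
  push_cast
  field_simp
  linear_combination (-(x : ℂ) * 𝓕 g (-x)) * Complex.I_sq

end SelfSimilar

namespace SelfSimilar

open Filter Topology
open scoped ComplexConjugate

/-! ### Quadratic identities on the frequency side -/

theorem norm_symA (ξ : ℝ) : ‖symA ξ‖ = |2 * Real.pi * ξ| ^ 3 := by
  rw [symA, Complex.norm_real, Real.norm_of_nonneg (by positivity)]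

theorem norm_symD (ξ : ℝ) : ‖symD ξ‖ = |2 * Real.pi * ξ| := by
  simp [symD, abs_mul]

/-- Compared with `integral_mulA_mul_dilation`, this makes `|D|³ v` orthogonal to `v - x v'`, the
cancellation behind `energy_estimate`. -/
theorem integral_mulA_mul_self {g : ℝ → ℂ} (h : IsSpectral g) :
    ∫ x, synth (mulA g) x * synth g x = ∫ ξ, |2 * Real.pi * ξ| ^ 3 * ‖g ξ‖ ^ 2 := by
  rw [integral_synth_mul_synth h.test_mulA.toIsHermTest h.toIsHermTest]
  congr 1; ext ξ
  rw [mulA, symA, map_mul, Complex.conj_ofReal, mul_assoc, ← Complex.normSq_eq_conj_mul_self,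
    ← Complex.ofReal_mul, Complex.ofReal_re, Complex.normSq_eq_norm_sq]

theorem hasDerivAt_normSq {z : ℝ → ℂ} (hz : Differentiable ℝ z) (ξ : ℝ) :
    HasDerivAt (fun y => Complex.normSq (z y)) (2 * (conj (z ξ) * deriv z ξ).re) ξ := by
  have hd := (hz ξ).hasDerivAt
  have h1 : HasDerivAt (fun y => (z y).re) (deriv z ξ).re ξ :=
    Complex.reCLM.hasFDerivAt.comp_hasDerivAt ξ hd
  have h2 : HasDerivAt (fun y => (z y).im) (deriv z ξ).im ξ :=
    Complex.imCLM.hasFDerivAt.comp_hasDerivAt ξ hd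
  refine HasDerivAt.congr_deriv (f := fun y => Complex.normSq (z y))
    ((h1.mul h1).add (h2.mul h2)) ?_
  simp only [Complex.mul_re, Complex.conj_re, Complex.conj_im]
  ring

/-- Integration by parts of `p · |z|²` for `z` vanishing near the origin. -/
theorem integral_mul_re_conj_mul_deriv {z : ℝ → ℂ} (hz : IsSpectral z) {p p' : ℝ → ℝ}
    (hp : ∀ ξ, ξ ≠ 0 → HasDerivAt p (p' ξ) ξ) (hpb : LocallyIntegrable p) (hpb' : LocallyIntegrable p') :
    ∫ ξ, p ξ * (2 * (conj (z ξ) * deriv z ξ).re) = -∫ ξ, p' ξ * Complex.normSq (z ξ) := by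
  -- Since `|z|²` vanishes near the origin, a singularity of `p` there contributes no boundary term.
  have h0 : (0 : ℝ) ∉ tsupport fun y => Complex.normSq (z y) := by
    rw [notMem_tsupport_iff_eventuallyEq]
    filter_upwards [hz.zero] with ξ a; simp [a]
  have hc : Continuous fun y => Complex.normSq (z y) :=
    Complex.continuous_normSq.comp hz.smooth.continuous
  have hcs : HasCompactSupport fun y => Complex.normSq (z y) := hz.compact.comp_left (by simp)
  have hc' : Continuous fun ξ => 2 * (conj (z ξ) * deriv z ξ).re := by
    have a := hz.smooth.continuous
    have b := hz.smooth.continuous_deriv (by simp)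
    fun_prop
  have hcs' : HasCompactSupport fun ξ => 2 * (conj (z ξ) * deriv z ξ).re := by
    refine hz.compact.mono ?_
    intro ξ hξ
    contrapose! hξ
    simp [Function.notMem_support.mp hξ]
  refine integral_mul_deriv_eq_deriv_mul_of_integrable (u := p) (u' := p')
    (v := fun y => Complex.normSq (z y)) (fun ξ hξ => hp ξ ?_)
    (fun ξ _ => hasDerivAt_normSq hz.differentiable ξ) ?_ ?_ ?_
  · rintro rfl; exact h0 hξ
  · refine (hpb.integrable_smul_left_of_hasCompactSupport hc' hcs').congr (ae_of_all _ fun ξ => ?_)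
    exact mul_comm _ _
  · refine (hpb'.integrable_smul_left_of_hasCompactSupport hc hcs).congr (ae_of_all _ fun ξ => ?_)
    exact mul_comm _ _
  · refine (hpb.integrable_smul_left_of_hasCompactSupport hc hcs).congr (ae_of_all _ fun ξ => ?_)
    exact mul_comm _ _

/-- The commutation of `|D|³` with the generator `x ∂ₓ` of dilations. -/
theorem integral_mulA_mul_dilation {g : ℝ → ℂ} (h : IsSpectral g) :
    ∫ x, synth (mulA g) x * (x * synth (mulD g) x) = ∫ ξ, |2 * Real.pi * ξ| ^ 3 * ‖g ξ‖ ^ 2 := by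
  have hz : IsSpectral (mulD g) := h.test_mulD
  simp only [← hz.synth_opX]
  rw [integral_synth_mul_synth h.test_mulA.toIsHermTest hz.test_opX.toIsHermTest]
  have hpi := Real.pi_pos
  -- With `z = mulD g` the integrand is a multiple of `ξ|ξ| Re (z̄ z')`. The derivative `2|ξ|` of
  -- `ξ|ξ|` turns `|ξ| |z|²` back into `|ξ|³ |g|²`; the constant is exactly one because the degree
  -- is three.
  have key := integral_mul_re_conj_mul_deriv hz (p := fun ξ => ξ * |ξ|) (p' := fun ξ => 2 * |ξ|)
    (fun ξ hξ => by
      refine HasDerivAt.congr_deriv ((hasDerivAt_id ξ).mul (hasDerivAt_abs hξ)) ?_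
      simp only [id, one_mul, self_mul_sign]
      ring)
    (Continuous.locallyIntegrable (by fun_prop)) (Continuous.locallyIntegrable (by fun_prop))
  have e1 : (fun ξ => (conj (mulA g ξ) * opX (mulD g) ξ).re) =
      fun ξ => -Real.pi * ((ξ * |ξ|) * (2 * (conj (mulD g ξ) * deriv (mulD g) ξ).re)) := by
    ext ξ
    have e2 : conj (mulA g ξ) * opX (mulD g) ξ =
        ((-(2 * Real.pi * (ξ * |ξ|)) : ℝ) : ℂ) * (conj (mulD g ξ) * deriv (mulD g) ξ) := by
      have hp : (Real.pi : ℂ) ≠ 0 := by exact_mod_cast Real.pi_ne_zero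
      have e3 : |2 * Real.pi * ξ| ^ 3 = (2 * Real.pi) ^ 3 * (ξ ^ 2 * |ξ|) := by
        rw [abs_mul, abs_of_pos (by positivity), mul_pow, pow_succ |ξ|, sq_abs]
      simp only [opX, mulA, symA, e3]
      rw [show conj (mulD g ξ) = -(2 * Real.pi * Complex.I * ξ) * conj (g ξ) by
        simp [mulD, symD, map_ofNat]]
      rw [map_mul, Complex.conj_ofReal]
      push_cast
      field_simp
    rw [e2, Complex.re_ofReal_mul]
    ring
  rw [e1, integral_const_mul, key, mul_neg, neg_mul, neg_neg, ← integral_const_mul]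
  congr 1; ext ξ
  rw [Complex.normSq_eq_norm_sq, mulD, norm_mul, norm_symD, abs_mul, abs_mul]
  rw [abs_of_pos hpi, abs_two]
  ring

/-- `⟨H f, x f⟩ = 0`. -/
theorem integral_hilbert_mul_position {h : ℝ → ℂ} (hh : IsSpectral h) :
    ∫ x, synth (mulS h) x * (x * synth h x) = 0 := by
  simp only [← hh.synth_opX]
  rw [integral_synth_mul_synth hh.test_mulS.toIsHermTest hh.test_opX.toIsHermTest]
  have hm : Measurable Real.sign :=
    Measurable.ite measurableSet_Iio measurable_const
      (Measurable.ite measurableSet_Ioi measurable_const measurable_const)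
  -- The symbol has zero derivative off the origin, and `h` does not see its jump.
  have key := integral_mul_re_conj_mul_deriv hh (p := Real.sign) (p' := fun _ => 0)
    (fun ξ hξ => by
      refine (hasDerivAt_const ξ (Real.sign ξ)).congr_of_eventuallyEq ?_
      rcases lt_or_gt_of_ne hξ with h0 | h0
      · filter_upwards [gt_mem_nhds h0] with y hy
        rw [Real.sign_of_neg h0, Real.sign_of_neg hy]
      · filter_upwards [lt_mem_nhds h0] with y hy
        rw [Real.sign_of_pos h0, Real.sign_of_pos hy])
    ((locallyIntegrable_const (1 : ℝ)).mono hm.aestronglyMeasurable (ae_of_all _ fun ξ => by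
      rcases Real.sign_apply_eq ξ with h | h | h <;> simp [h])) (locallyIntegrable_const _)
  have e1 : (fun ξ => (conj (mulS h ξ) * opX h ξ).re) =
      fun ξ => -(1 / (4 * Real.pi)) * (Real.sign ξ * (2 * (conj (h ξ) * deriv h ξ).re)) := by
    ext ξ
    have e2 : conj (mulS h ξ) * opX h ξ =
        ((-(1 / (2 * Real.pi)) * Real.sign ξ : ℝ) : ℂ) * (conj (h ξ) * deriv h ξ) := by
      have hp : (Real.pi : ℂ) ≠ 0 := by exact_mod_cast Real.pi_ne_zero
      simp only [opX, mulS, symS, map_mul, map_neg, Complex.conj_I, Complex.conj_ofReal]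
      push_cast
      field_simp
      linear_combination (Real.sign ξ * conj (h ξ) * deriv h ξ : ℂ) * Complex.I_sq
    rw [e2, Complex.re_ofReal_mul]
    ring
  rw [e1, integral_const_mul, key]
  simp

/-- The frequency side of multiplication by `sin (2π τ x)`. -/
noncomputable def opSin (τ : ℝ) (h : ℝ → ℂ) (ξ : ℝ) : ℂ :=
  (h (ξ - τ) - h (ξ + τ)) / (2 * Complex.I)

theorem IsHermTest.test_opSin {h : ℝ → ℂ} (hh : IsHermTest h) (τ : ℝ) :
    IsHermTest (opSin τ h) where
  smooth := by
    have := hh.smooth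
    unfold opSin
    refine ContDiff.div_const (ContDiff.sub ?_ ?_) _
    · exact this.comp (by fun_prop)
    · exact this.comp (by fun_prop)
  compact := by
    have h1 : HasCompactSupport fun ξ => h (ξ - τ) := by
      simpa [sub_eq_add_neg] using! hh.compact.comp_homeomorph (Homeomorph.addRight (-τ))
    have h2 : HasCompactSupport fun ξ => h (ξ + τ) := by
      simpa using! hh.compact.comp_homeomorph (Homeomorph.addRight τ)
    unfold opSin
    simp only [div_eq_mul_inv]
    exact (h1.sub h2).mul_right
  herm ξ := by
    unfold opSin
    rw [show -ξ - τ = -(ξ + τ) by ring, show -ξ + τ = -(ξ - τ) by ring, hh.herm, hh.herm]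
    simp only [map_div₀, map_sub, map_mul, Complex.conj_I, map_ofNat]
    rw [mul_neg, div_neg, ← neg_div, neg_sub]

theorem IsHermTest.synth_opSin {h : ℝ → ℂ} (hh : IsHermTest h) (τ x : ℝ) :
    synth (opSin τ h) x = Real.sin (2 * Real.pi * τ * x) * synth h x := by
  apply Complex.ofReal_injective
  rw [(hh.test_opSin τ).coe_synth, Complex.ofReal_mul, hh.coe_synth, fourierInv_real_eq,
    fourierInv_real_eq]
  set E : ℝ → ℂ := fun ξ => Complex.exp (2 * Real.pi * Complex.I * x * ξ) with hE
  have hi (c : ℝ) : Integrable fun ξ => E ξ * h (ξ + c) := by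
    have h2 : HasCompactSupport fun ξ => h (ξ + c) := by
      simpa using! hh.compact.comp_homeomorph (Homeomorph.addRight c)
    refine Continuous.integrable_of_hasCompactSupport ?_ h2.mul_left
    have := hh.smooth.continuous
    fun_prop
  have hs (c : ℝ) : ∫ ξ, E ξ * h (ξ + c) = E (-c) * ∫ ξ, E ξ * h ξ := by
    rw [← integral_add_right_eq_self (fun ξ => E ξ * h ξ) c, ← integral_const_mul]
    congr 1; ext ξ
    rw [← mul_assoc, hE]
    simp only
    rw [← Complex.exp_add]
    congr 2
    push_cast; ring
  have e : ∀ ξ, E ξ * opSin τ h ξ =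
      (2 * Complex.I)⁻¹ * (E ξ * h (ξ + -τ) - E ξ * h (ξ + τ)) := by
    intro ξ; rw [opSin, sub_eq_add_neg ξ τ]; ring
  rw [integral_congr_ae (ae_of_all _ e), integral_const_mul, integral_sub (hi _) (hi _), hs, hs, neg_neg, ← sub_mul, ← mul_assoc]
  congr 1
  rw [Complex.ofReal_sin, Complex.sin, hE]
  push_cast
  rw [mul_inv, Complex.inv_I]
  rw [show (2 * Real.pi * Complex.I * x * τ : ℂ) = 2 * Real.pi * τ * x * Complex.I by ring,
    show (2 * Real.pi * Complex.I * x * -τ : ℂ) = -(2 * Real.pi * τ * x) * Complex.I by ring]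
  ring

/-- Multiplication by the sine shifts frequencies by `±τ`, and antisymmetry leaves only pairs `ξ`,
`ξ - τ` whose signs differ, that is `0 ≤ ξ ≤ τ`. There the two derivatives cost at most `(2π)² ξ (τ
- ξ) ≤ π² τ²`, so the form is bounded by `k` without derivatives. -/
theorem abs_integral_hilbert_mul_sin_le {k : ℝ → ℂ} (hk : IsSpectral k) {τ : ℝ} (hτ : 0 ≤ τ) :
    |∫ x, synth (mulS (mulD k)) x * (Real.sin (2 * Real.pi * τ * x) * synth (mulD k) x)|
      ≤ Real.pi ^ 2 * τ ^ 2 * ∫ x, synth k x ^ 2 := by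
  set h := mulD k with hh
  have hs : IsSpectral h := hk.test_mulD
  have hpi := Real.pi_pos
  simp only [← hs.synth_opSin]
  rw [integral_synth_mul_synth hs.test_mulS.toIsHermTest (hs.toIsHermTest.test_opSin τ)]
  have hm : Measurable Real.sign :=
    Measurable.ite measurableSet_Iio measurable_const
      (Measurable.ite measurableSet_Ioi measurable_const measurable_const)
  have hsb (ξ : ℝ) : |Real.sign ξ| ≤ 1 := by
    rcases Real.sign_apply_eq ξ with h | h | h <;> simp [h]
  set c : ℝ → ℝ → ℝ := fun s ξ => (conj (h ξ) * h (ξ + s)).re with hc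
  have hcc (s : ℝ) : Continuous (c s) := by
    have := hs.smooth.continuous
    fun_prop
  have hci (s : ℝ) : Integrable (c s) := by
    refine (hcc s).integrable_of_hasCompactSupport (hs.compact.mono fun ξ hξ => ?_)
    contrapose! hξ
    simp [hc, Function.notMem_support.mp hξ]
  have hsi (s t : ℝ) : Integrable fun ξ => Real.sign (ξ + t) * c s ξ :=
    (hci s).bdd_mul (c := 1) (hm.comp (measurable_add_const t)).aestronglyMeasurable
      (ae_of_all _ fun ξ => hsb _)
  have e1 : (fun ξ => (conj (mulS h ξ) * opSin τ h ξ).re) =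
      fun ξ => 2⁻¹ * (Real.sign (ξ + 0) * c (-τ) ξ - Real.sign (ξ + 0) * c τ ξ) := by
    ext ξ
    have e2 : conj (mulS h ξ) * opSin τ h ξ =
        ((2⁻¹ * Real.sign ξ : ℝ) : ℂ) * (conj (h ξ) * h (ξ + -τ) - conj (h ξ) * h (ξ + τ)) := by
      simp only [opSin, mulS, symS, map_mul, map_neg, Complex.conj_I, Complex.conj_ofReal,
        sub_eq_add_neg ξ τ]
      have := Complex.I_ne_zero
      push_cast
      field_simp
    rw [e2, Complex.re_ofReal_mul, Complex.sub_re, add_zero]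
    ring
  -- A translation by `τ` gives both correlations the same shift, so that only the difference of two
  -- signs multiplies them.
  have e3 : ∫ ξ, Real.sign (ξ + 0) * c τ ξ = ∫ ξ, Real.sign (ξ + -τ) * c (-τ) ξ := by
    rw [← integral_add_right_eq_self (fun ξ => Real.sign (ξ + 0) * c τ ξ) (-τ)]
    congr 1; ext ξ
    simp only [hc, add_zero, neg_add_cancel_right, Complex.mul_re, Complex.conj_re,
      Complex.conj_im]
    ring
  rw [e1, integral_const_mul, integral_sub (hsi _ _) (hsi _ _), e3,
    ← integral_sub (hsi _ _) (hsi _ _), integral_synth_sq hk.toIsHermTest]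
  have hk2 : Integrable fun ξ => ‖k ξ‖ ^ 2 := (memLp_two_iff_integrable_sq_norm
    hk.smooth.continuous.aestronglyMeasurable).mp hk.memLp
  have hk2' : Integrable fun ξ => ‖k (ξ + -τ)‖ ^ 2 := hk2.comp_add_right (-τ)
  have bound : ∀ ξ, ‖Real.sign (ξ + 0) * c (-τ) ξ - Real.sign (ξ + -τ) * c (-τ) ξ‖ ≤
      Real.pi ^ 2 * τ ^ 2 * (‖k ξ‖ ^ 2 + ‖k (ξ + -τ)‖ ^ 2) := by
    intro ξ
    rw [← sub_mul, norm_mul, add_zero, Real.norm_eq_abs, Real.norm_eq_abs]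
    have h1 : |c (-τ) ξ| ≤ |2 * Real.pi * ξ| * ‖k ξ‖ * (|2 * Real.pi * (ξ + -τ)| * ‖k (ξ + -τ)‖) := by
      refine (Complex.abs_re_le_norm _).trans ?_
      rw [norm_mul, RCLike.norm_conj, hh, mulD, mulD, norm_mul, norm_mul, norm_symD, norm_symD]
    -- The endpoints, where one of the signs is `0`, belong to the first case.
    by_cases hin : 0 ≤ ξ ∧ ξ ≤ τ
    · have h2 : |Real.sign ξ - Real.sign (ξ + -τ)| ≤ 2 := by
        have := abs_sub (Real.sign ξ) (Real.sign (ξ + -τ))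
        linarith [hsb ξ, hsb (ξ + -τ)]
      rw [abs_mul, abs_mul (2 * Real.pi), abs_of_pos (show 0 < 2 * Real.pi by positivity),
        abs_of_nonneg hin.1, abs_of_nonpos (by linarith [hin.2] : ξ + -τ ≤ 0)] at h1
      have h3 : ξ * -(ξ + -τ) ≤ τ ^ 2 / 4 := by nlinarith [sq_nonneg (ξ - τ / 2)]
      have h4 : ‖k ξ‖ * ‖k (ξ + -τ)‖ ≤ (‖k ξ‖ ^ 2 + ‖k (ξ + -τ)‖ ^ 2) / 2 := by
        nlinarith [sq_nonneg (‖k ξ‖ - ‖k (ξ + -τ)‖)]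
      have h5 : ξ * -(ξ + -τ) * (‖k ξ‖ * ‖k (ξ + -τ)‖) ≤
          τ ^ 2 / 4 * ((‖k ξ‖ ^ 2 + ‖k (ξ + -τ)‖ ^ 2) / 2) :=
        mul_le_mul h3 h4 (by positivity) (by positivity)
      calc |Real.sign ξ - Real.sign (ξ + -τ)| * |c (-τ) ξ|
          ≤ 2 * (2 * Real.pi * ξ * ‖k ξ‖ * (2 * Real.pi * -(ξ + -τ) * ‖k (ξ + -τ)‖)) :=
            mul_le_mul h2 h1 (abs_nonneg _) (by norm_num)
        _ = 8 * Real.pi ^ 2 * (ξ * -(ξ + -τ) * (‖k ξ‖ * ‖k (ξ + -τ)‖)) := by ring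
        _ ≤ 8 * Real.pi ^ 2 * (τ ^ 2 / 4 * ((‖k ξ‖ ^ 2 + ‖k (ξ + -τ)‖ ^ 2) / 2)) := by gcongr
        _ = _ := by ring
    · have : Real.sign ξ = Real.sign (ξ + -τ) := by
        rcases lt_or_ge ξ 0 with h0 | h0
        · rw [Real.sign_of_neg h0, Real.sign_of_neg (by linarith)]
        · have : τ < ξ := by
            by_contra hcon; exact hin ⟨h0, not_lt.mp hcon⟩
          rw [Real.sign_of_pos (by linarith), Real.sign_of_pos (by linarith)]
      rw [this, sub_self, abs_zero, zero_mul]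
      positivity
  have hfin := norm_integral_le_of_norm_le ((hk2.add hk2').const_mul (Real.pi ^ 2 * τ ^ 2))
    (ae_of_all _ bound)
  have e4 : ∫ ξ, Real.pi ^ 2 * τ ^ 2 * (‖k ξ‖ ^ 2 + ‖k (ξ + -τ)‖ ^ 2) =
      2 * (Real.pi ^ 2 * τ ^ 2 * ∫ ξ, ‖k ξ‖ ^ 2) := by
    rw [integral_const_mul, integral_add hk2 hk2',
      integral_add_right_eq_self (fun ξ => ‖k ξ‖ ^ 2) (-τ)]
    ring
  rw [abs_mul, abs_of_pos (by norm_num : (0 : ℝ) < 2⁻¹)]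
  have hfin' := hfin.trans_eq e4
  rw [Real.norm_eq_abs] at hfin'
  linarith

end SelfSimilar

/-! ### Laplace superpositions of sines and the commutator of the Hilbert transform with `x / (l² +
x²)`. -/

namespace SelfSimilar

open Filter Topology

/-- This is the imaginary part of `∫ exp ((-b + iy) t)`. It serves twice: to write the commutator
coefficient as a superposition of sines, and to recognize the Poisson part of the profile. -/
theorem integral_sin_mul_exp_neg {b : ℝ} (hb : 0 < b) (y : ℝ) :
    ∫ t in Set.Ioi (0 : ℝ), Real.sin (y * t) * Real.exp (-b * t) = y / (b ^ 2 + y ^ 2) := by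
  have ha : ((-b : ℂ) + y * Complex.I).re < 0 := by simpa using hb
  have h1 := integral_exp_mul_complex_Ioi ha 0
  have h2 := integrableOn_exp_mul_complex_Ioi ha 0
  have h3 := congrArg Complex.im h1
  rw [← RCLike.im_eq_complex_im, ← integral_im h2] at h3
  have e1 : ∀ t : ℝ, RCLike.im (Complex.exp (((-b : ℂ) + y * Complex.I) * t)) =
      Real.sin (y * t) * Real.exp (-b * t) := by
    intro t
    rw [RCLike.im_eq_complex_im, Complex.exp_im]
    simp [mul_comm]
  simp only [e1] at h3
  rw [h3]
  have hne : b ^ 2 + y ^ 2 ≠ 0 := by positivity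
  simp [Complex.div_im, Complex.normSq_apply]
  field_simp

theorem integrableOn_sin_mul_exp_neg {b : ℝ} (hb : 0 < b) (y : ℝ) :
    IntegrableOn (fun t => Real.sin (y * t) * Real.exp (-b * t)) (Set.Ioi 0) :=
  (exp_neg_integrableOn_Ioi 0 hb).bdd_mul (c := 1) (by fun_prop)
    (ae_of_all _ fun t => by simpa using Real.abs_sin_le_one _)

theorem integral_sq_mul_exp_neg {b : ℝ} (hb : 0 < b) :
    ∫ t in Set.Ioi (0 : ℝ), t ^ 2 * Real.exp (-b * t) = 2 / b ^ 3 := by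
  have h := Real.integral_rpow_mul_exp_neg_mul_Ioi (a := 3) (r := b) (by norm_num) hb
  have e : ∀ t : ℝ, t ^ ((3 : ℝ) - 1) * Real.exp (-(b * t)) = t ^ 2 * Real.exp (-b * t) := by
    intro t
    rw [show (3 : ℝ) - 1 = (2 : ℕ) by norm_num, Real.rpow_natCast, neg_mul]
  simp only [e] at h
  rw [h, show (3 : ℝ) = (2 : ℕ) + 1 by norm_num, Real.Gamma_nat_eq_factorial]
  rw [show ((2 : ℕ) : ℝ) + 1 = (3 : ℕ) by norm_num, Real.rpow_natCast]
  simp [Nat.factorial]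
  field_simp

theorem integrableOn_sq_mul_exp_neg {b : ℝ} (hb : 0 < b) :
    IntegrableOn (fun t : ℝ => t ^ 2 * Real.exp (-b * t)) (Set.Ioi 0) := by
  have h := integrableOn_rpow_mul_exp_neg_mul_rpow (s := 2) (p := 1) (b := b) (by norm_num)
    (by norm_num) hb
  simpa using h

/-- The commutator of the Hilbert transform with `x / (ℓ² + x²)`, as a quadratic form. -/
theorem abs_integral_hilbert_mul_div_le {k : ℝ → ℂ} (hk : IsSpectral k) {l : ℝ} (hl : 0 < l) :
    |∫ x, synth (mulS (mulD k)) x * (x / (l ^ 2 + x ^ 2) * synth (mulD k) x)|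
      ≤ 1 / (2 * l ^ 3) * ∫ x, synth k x ^ 2 := by
  have hpi := Real.pi_pos
  set p : ℝ → ℝ := fun x => synth (mulS (mulD k)) x * synth (mulD k) x with hp
  have hpi1 : Integrable p :=
    hk.test_mulD.test_mulS.memLp_synth.integrable_mul hk.test_mulD.memLp_synth
  -- The rate `2πl` matches the phase `2πτx`, so that the superposition equals `(2π)⁻¹ x / (l² +
  -- x²)`. Integrating the bound `π² τ²` for each sine against `exp (-bτ)` then produces the power
  -- `l⁻³`.
  set b := 2 * Real.pi * l with hb
  have hb0 : 0 < b := by positivity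
  set q : ℝ → ℝ → ℝ := fun x τ =>
    p x * (Real.sin (2 * Real.pi * τ * x) * Real.exp (-b * τ)) with hq
  have hint : Integrable (Function.uncurry q) (volume.prod (volume.restrict (Set.Ioi 0))) := by
    have h1 := hpi1.mul_prod (ν := volume.restrict (Set.Ioi (0 : ℝ)))
      (exp_neg_integrableOn_Ioi 0 hb0)
    have h2 := h1.bdd_mul (c := 1) (f := fun z : ℝ × ℝ => Real.sin (2 * Real.pi * z.2 * z.1))
      (Continuous.aestronglyMeasurable (by fun_prop))
      (ae_of_all _ fun t => by simpa using Real.abs_sin_le_one _)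
    refine h2.congr (ae_of_all _ fun z => ?_)
    simp only [hq, Function.uncurry]
    ring
  have hswap := integral_integral_swap hint
  have e1 : ∀ x, ∫ τ in Set.Ioi 0, q x τ = (2 * Real.pi)⁻¹ *
      (synth (mulS (mulD k)) x * (x / (l ^ 2 + x ^ 2) * synth (mulD k) x)) := by
    intro x
    simp only [hq]
    rw [integral_const_mul]
    have := integral_sin_mul_exp_neg hb0 (2 * Real.pi * x)
    simp only [show ∀ t, 2 * Real.pi * x * t = 2 * Real.pi * t * x from fun t => by ring] at this
    rw [this, hb, hp]
    have : l ^ 2 + x ^ 2 ≠ 0 := by positivity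
    field_simp
  have e2 : ∀ τ, ∫ x, q x τ = Real.exp (-b * τ) *
      ∫ x, synth (mulS (mulD k)) x * (Real.sin (2 * Real.pi * τ * x) * synth (mulD k) x) := by
    intro τ
    rw [← integral_const_mul]
    congr 1; ext x
    simp only [hq, hp]; ring
  simp only [e1, e2] at hswap
  rw [integral_const_mul] at hswap
  set U := ∫ x, synth k x ^ 2 with hU
  have hbound := norm_integral_le_of_norm_le (μ := volume.restrict (Set.Ioi 0))
    (f := fun τ => Real.exp (-b * τ) *
      ∫ x, synth (mulS (mulD k)) x * (Real.sin (2 * Real.pi * τ * x) * synth (mulD k) x))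
    ((integrableOn_sq_mul_exp_neg hb0).const_mul (Real.pi ^ 2 * U))
    ((ae_restrict_iff' measurableSet_Ioi).mpr (ae_of_all _ fun τ (hτ : 0 < τ) => by
      rw [norm_mul, Real.norm_of_nonneg (Real.exp_pos _).le, Real.norm_eq_abs]
      refine (mul_le_mul_of_nonneg_left (abs_integral_hilbert_mul_sin_le hk hτ.le)
        (Real.exp_pos _).le).trans_eq ?_
      ring))
  rw [integral_const_mul, integral_sq_mul_exp_neg hb0, ← hswap, norm_mul,
    Real.norm_of_nonneg (by positivity), Real.norm_eq_abs] at hbound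
  have h3 : 2 * Real.pi * (Real.pi ^ 2 * U * (2 / b ^ 3)) = 1 / (2 * l ^ 3) * U := by
    rw [hb]; field_simp
  rw [← h3]
  rw [inv_mul_le_iff₀ (by positivity)] at hbound
  exact hbound

end SelfSimilar

namespace SelfSimilar

open Filter Topology

/-! ### Model weights

A finite superposition of the functions `x² / (4ᵏ + x²)` which is comparable to `|x|^{2s}`,
`r = 4ˢ`, up to the scale `2ᴺ`. -/

/-- The model weight. -/
noncomputable def modelWeight (r : ℝ) (N : ℕ) (x : ℝ) : ℝ :=
  1 + ∑ k ∈ Finset.range N, (r ^ (k + 1) - r ^ k) * (x ^ 2 / (4 ^ (k + 1) + x ^ 2))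

/-- The derivative of the model weight. -/
noncomputable def modelWeight' (r : ℝ) (N : ℕ) (x : ℝ) : ℝ :=
  ∑ k ∈ Finset.range N,
    (r ^ (k + 1) - r ^ k) * (2 * x * 4 ^ (k + 1) / (4 ^ (k + 1) + x ^ 2) ^ 2)

theorem hasDerivAt_modelWeight (r : ℝ) (N : ℕ) (x : ℝ) :
    HasDerivAt (modelWeight r N) (modelWeight' r N x) x := by
  unfold modelWeight modelWeight'
  refine HasDerivAt.const_add 1 (HasDerivAt.fun_sum fun k _ => HasDerivAt.const_mul _ ?_)
  have h1 : HasDerivAt (fun x : ℝ => x ^ 2) (2 * x) x := by simpa using hasDerivAt_pow 2 x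
  have h2 : HasDerivAt (fun x : ℝ => (4 : ℝ) ^ (k + 1) + x ^ 2) (2 * x) x := h1.const_add _
  refine HasDerivAt.congr_deriv (h1.div h2 (by positivity)) ?_
  congr 1
  ring

theorem sum_half_pow_sub_le (J : ℕ) : ∑ k ∈ Finset.range J, (1 / 2 : ℝ) ^ (J - k) ≤ 1 := by
  induction J with
  | zero => simp
  | succ J ih =>
    rw [Finset.sum_range_succ, Nat.add_sub_cancel_left, pow_one]
    have : ∑ k ∈ Finset.range J, (1 / 2 : ℝ) ^ (J + 1 - k) =
        (1 / 2) * ∑ k ∈ Finset.range J, (1 / 2 : ℝ) ^ (J - k) := by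
      rw [Finset.mul_sum]
      refine Finset.sum_congr rfl fun k hk => ?_
      rw [Nat.succ_sub (Finset.mem_range.mp hk).le, pow_succ]
      ring
    rw [this]
    linarith

theorem sum_Ico_half_pow_le (J N : ℕ) : ∑ k ∈ Finset.Ico J N, (1 / 2 : ℝ) ^ (k - J) ≤ 2 := by
  rw [Finset.sum_Ico_eq_sum_range]
  simp only [Nat.add_sub_cancel_left]
  exact sum_geometric_two_le _

/-- The localized error of the model weight at a point with `4ʲ ≤ 1 + x² < 4ʲ⁺¹`. -/
theorem sum_model_error_le {r : ℝ} (hr : 1 / 2 ≤ r) (hr' : r ≤ 2) {x : ℝ} {j N : ℕ}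
    (h1 : 4 ^ j ≤ 1 + x ^ 2) (h2 : 1 + x ^ 2 < 4 ^ (j + 1)) :
    ∑ k ∈ Finset.range (min j N), r ^ k * (4 ^ (k + 1) / (4 ^ (k + 1) + x ^ 2)) +
      ∑ k ∈ Finset.Ico (min j N) N, r ^ k * (x ^ 2 / (4 ^ (k + 1) + x ^ 2))
      ≤ 6 * r ^ (min j N) := by
  have hr0 : 0 < r := by linarith
  set J := min j N with hJ
  -- Scales below `x`: the quotient decays like `4^{-(J - k)}`, which beats the ratio `r^{k - J} ≤
  -- 2^{J - k}`. The scales above `x` are treated symmetrically.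
  have a1 : ∑ k ∈ Finset.range J, r ^ k * (4 ^ (k + 1) / (4 ^ (k + 1) + x ^ 2)) ≤
      4 * r ^ J * ∑ k ∈ Finset.range J, (1 / 2 : ℝ) ^ (J - k) := by
    rw [Finset.mul_sum]
    refine Finset.sum_le_sum fun k hk => ?_
    obtain ⟨i, hi⟩ := Nat.exists_eq_add_of_lt (Finset.mem_range.mp hk)
    have hi' : J - k = i + 1 := by omega
    rw [hi', show r ^ J = r ^ k * r ^ (i + 1) by rw [← pow_add]; congr 1]
    have h3 : (4 : ℝ) ^ J ≤ 4 ^ (k + 1) + x ^ 2 := by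
      have : (4 : ℝ) ^ J ≤ 4 ^ j := pow_le_pow_right₀ (by norm_num) (min_le_left _ _)
      have : (1 : ℝ) ≤ 4 ^ (k + 1) := one_le_pow₀ (by norm_num)
      linarith
    have h4 : (4 : ℝ) ^ (k + 1) / (4 ^ (k + 1) + x ^ 2) ≤ (1 / 4) ^ i := by
      rw [div_le_iff₀ (by positivity)]
      calc (4 : ℝ) ^ (k + 1) = (1 / 4) ^ i * 4 ^ J := by
            rw [show J = (k + 1) + i by omega, pow_add 4 (k + 1), one_div, inv_pow]; field_simp
        _ ≤ _ := by gcongr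
    have h5 : (1 / 4 : ℝ) ^ i ≤ 4 * (r ^ (i + 1) * (1 / 2) ^ (i + 1)) := by
      rw [← mul_pow, pow_succ]
      have : (1 / 4 : ℝ) ^ i ≤ (r * (1 / 2)) ^ i := pow_le_pow_left₀ (by norm_num) (by linarith) i
      nlinarith [pow_pos (show 0 < r * (1 / 2) by linarith) i]
    calc r ^ k * (4 ^ (k + 1) / (4 ^ (k + 1) + x ^ 2)) ≤
        r ^ k * (4 * (r ^ (i + 1) * (1 / 2) ^ (i + 1))) := by gcongr; exact h4.trans h5
      _ = _ := by ring
  have a2 : ∑ k ∈ Finset.Ico J N, r ^ k * (x ^ 2 / (4 ^ (k + 1) + x ^ 2)) ≤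
      r ^ J * ∑ k ∈ Finset.Ico J N, (1 / 2 : ℝ) ^ (k - J) := by
    rw [Finset.mul_sum]
    refine Finset.sum_le_sum fun k hk => ?_
    obtain ⟨hk1, hk2⟩ := Finset.mem_Ico.mp hk
    -- An index `k` with `J ≤ k < N` forces `J < N`, so the minimum defining `J` is `j`.
    have hJj : J = j := by omega
    obtain ⟨i, rfl⟩ := Nat.exists_eq_add_of_le hk1
    rw [Nat.add_sub_cancel_left, pow_add, mul_assoc]
    refine mul_le_mul_of_nonneg_left ?_ (by positivity)
    have h4 : x ^ 2 / (4 ^ (J + i + 1) + x ^ 2) ≤ (1 / 4) ^ i := by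
      rw [div_le_iff₀ (by positivity)]
      have : (1 / 4 : ℝ) ^ i * 4 ^ (J + i + 1) = 4 ^ (j + 1) := by
        rw [hJj, show j + i + 1 = i + (j + 1) by ring, pow_add, one_div, inv_pow]; field_simp
      rw [mul_add, this]
      have : 0 ≤ (1 / 4 : ℝ) ^ i * x ^ 2 := by positivity
      linarith
    calc r ^ i * (x ^ 2 / (4 ^ (J + i + 1) + x ^ 2)) ≤ 2 ^ i * (1 / 4) ^ i := by gcongr
      _ = (1 / 2) ^ i := by rw [← mul_pow]; norm_num
  have b1 := sum_half_pow_sub_le J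
  have b2 := sum_Ico_half_pow_le J N
  have : 0 < r ^ J := by positivity
  nlinarith

/-- If each `x² / (4ᵏ⁺¹ + x²)` were the indicator of `k < J`, the model weight would be exactly `r ^
J`; the coefficients are differences for this purpose. -/
theorem one_add_sum_range_sub (r : ℝ) (J : ℕ) :
    1 + ∑ k ∈ Finset.range J, (r ^ (k + 1) - r ^ k) = r ^ J := by
  rw [Finset.sum_range_sub]; simp

theorem abs_modelWeight_sub_le {r : ℝ} (hr : 1 / 2 ≤ r) (hr' : r ≤ 2) {x : ℝ} {j N : ℕ}
    (h1 : 4 ^ j ≤ 1 + x ^ 2) (h2 : 1 + x ^ 2 < 4 ^ (j + 1)) :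
    |modelWeight r N x - r ^ (min j N)| ≤ 6 * |r - 1| * r ^ (min j N) := by
  have hr0 : 0 < r := by linarith
  have key := sum_model_error_le hr hr' (N := N) h1 h2
  set J := min j N with hJ
  have hJN : J ≤ N := min_le_right _ _
  have e : modelWeight r N x - r ^ J =
      ∑ k ∈ Finset.range J, (r ^ (k + 1) - r ^ k) * -(4 ^ (k + 1) / (4 ^ (k + 1) + x ^ 2)) +
      ∑ k ∈ Finset.Ico J N, (r ^ (k + 1) - r ^ k) * (x ^ 2 / (4 ^ (k + 1) + x ^ 2)) := by
    rw [modelWeight, ← one_add_sum_range_sub r J, ← Finset.sum_range_add_sum_Ico _ hJN,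
      add_sub_add_left_eq_sub, add_sub_right_comm, ← Finset.sum_sub_distrib]
    congr 1
    refine Finset.sum_congr rfl fun k _ => ?_
    have : (4 : ℝ) ^ (k + 1) + x ^ 2 ≠ 0 := by positivity
    field_simp
    ring
  have hd : ∀ k : ℕ, |r ^ (k + 1) - r ^ k| = |r - 1| * r ^ k := by
    intro k
    rw [show r ^ (k + 1) - r ^ k = (r - 1) * r ^ k by ring, abs_mul, abs_of_pos (pow_pos hr0 k)]
  rw [e]
  refine (abs_add_le _ _).trans ?_
  have c1 := Finset.abs_sum_le_sum_abs
    (fun k => (r ^ (k + 1) - r ^ k) * -((4 : ℝ) ^ (k + 1) / (4 ^ (k + 1) + x ^ 2)))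
    (Finset.range J)
  have c2 := Finset.abs_sum_le_sum_abs
    (fun k => (r ^ (k + 1) - r ^ k) * (x ^ 2 / ((4 : ℝ) ^ (k + 1) + x ^ 2))) (Finset.Ico J N)
  refine (add_le_add c1 c2).trans ?_
  simp only [abs_mul, hd, abs_neg]
  have d1 : ∀ k : ℕ, |(4 : ℝ) ^ (k + 1) / (4 ^ (k + 1) + x ^ 2)| =
      4 ^ (k + 1) / (4 ^ (k + 1) + x ^ 2) := fun k => abs_of_nonneg (by positivity)
  have d2 : ∀ k : ℕ, |x ^ 2 / ((4 : ℝ) ^ (k + 1) + x ^ 2)| =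
      x ^ 2 / (4 ^ (k + 1) + x ^ 2) := fun k => abs_of_nonneg (by positivity)
  simp only [d1, d2, mul_assoc]
  rw [← Finset.mul_sum, ← Finset.mul_sum, ← mul_add]
  nlinarith [abs_nonneg (r - 1)]

/-- Up to a factor `2`, `x ∂ₓ` of each quotient is the product of the quotient and its complement to
one. Each factor is at most one, so the error sum of `sum_model_error_le` bounds this as well. -/
theorem abs_mul_modelWeight'_le {r : ℝ} (hr : 1 / 2 ≤ r) (hr' : r ≤ 2) {x : ℝ} {j N : ℕ}
    (h1 : 4 ^ j ≤ 1 + x ^ 2) (h2 : 1 + x ^ 2 < 4 ^ (j + 1)) :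
    |x * modelWeight' r N x| ≤ 12 * |r - 1| * r ^ (min j N) := by
  have hr0 : 0 < r := by linarith
  have key := sum_model_error_le hr hr' (N := N) h1 h2
  set J := min j N with hJ
  have hJN : J ≤ N := min_le_right _ _
  have hd : ∀ k : ℕ, |r ^ (k + 1) - r ^ k| = |r - 1| * r ^ k := by
    intro k
    rw [show r ^ (k + 1) - r ^ k = (r - 1) * r ^ k by ring, abs_mul, abs_of_pos (pow_pos hr0 k)]
  have hq : ∀ k : ℕ, |x * ((r ^ (k + 1) - r ^ k) *
      (2 * x * 4 ^ (k + 1) / (4 ^ (k + 1) + x ^ 2) ^ 2))| = 2 * |r - 1| *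
        (r ^ k * ((4 ^ (k + 1) / (4 ^ (k + 1) + x ^ 2)) * (x ^ 2 / (4 ^ (k + 1) + x ^ 2)))) := by
    intro k
    rw [show x * ((r ^ (k + 1) - r ^ k) * (2 * x * 4 ^ (k + 1) / (4 ^ (k + 1) + x ^ 2) ^ 2)) =
      (r ^ (k + 1) - r ^ k) * (2 * ((4 ^ (k + 1) / (4 ^ (k + 1) + x ^ 2)) *
        (x ^ 2 / (4 ^ (k + 1) + x ^ 2)))) by
          have : (4 : ℝ) ^ (k + 1) + x ^ 2 ≠ 0 := by positivity
          field_simp, abs_mul, hd, abs_of_nonneg (a := 2 * _) (by positivity)]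
    ring
  rw [modelWeight', Finset.mul_sum, ← Finset.sum_range_add_sum_Ico _ hJN]
  refine (abs_add_le _ _).trans ?_
  refine (add_le_add (Finset.abs_sum_le_sum_abs _ _) (Finset.abs_sum_le_sum_abs _ _)).trans ?_
  simp only [hq]
  rw [← Finset.mul_sum, ← Finset.mul_sum, ← mul_add]
  have s1 : ∑ k ∈ Finset.range J, r ^ k * ((4 ^ (k + 1) / (4 ^ (k + 1) + x ^ 2)) *
      (x ^ 2 / (4 ^ (k + 1) + x ^ 2))) ≤
      ∑ k ∈ Finset.range J, r ^ k * (4 ^ (k + 1) / (4 ^ (k + 1) + x ^ 2)) := by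
    refine Finset.sum_le_sum fun k _ => mul_le_mul_of_nonneg_left ?_ (by positivity)
    refine mul_le_of_le_one_right (by positivity) ((div_le_one (by positivity)).mpr ?_)
    have : (0 : ℝ) < 4 ^ (k + 1) := by positivity
    linarith
  have s2 : ∑ k ∈ Finset.Ico J N, r ^ k * ((4 ^ (k + 1) / (4 ^ (k + 1) + x ^ 2)) *
      (x ^ 2 / (4 ^ (k + 1) + x ^ 2))) ≤
      ∑ k ∈ Finset.Ico J N, r ^ k * (x ^ 2 / (4 ^ (k + 1) + x ^ 2)) := by
    refine Finset.sum_le_sum fun k _ => mul_le_mul_of_nonneg_left ?_ (by positivity)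
    refine mul_le_of_le_one_left (by positivity) ((div_le_one (by positivity)).mpr ?_)
    nlinarith [sq_nonneg x]
  nlinarith [abs_nonneg (r - 1)]

theorem exists_dyadic (x : ℝ) : ∃ j : ℕ, (4 : ℝ) ^ j ≤ 1 + x ^ 2 ∧ 1 + x ^ 2 < 4 ^ (j + 1) :=
  exists_nat_pow_near (by nlinarith [sq_nonneg x]) (by norm_num)

theorem modelWeight_pos {r : ℝ} (hr : |r - 1| ≤ 1 / 32) (N : ℕ) (x : ℝ) :
    0 < modelWeight r N x := by
  obtain ⟨j, h1, h2⟩ := exists_dyadic x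
  have h := abs_le.mp hr
  have := (abs_le.mp (abs_modelWeight_sub_le (r := r) (by linarith) (by linarith) (N := N) h1 h2)).1
  have hp : 0 < r ^ min j N := pow_pos (by linarith) _
  nlinarith

/-- The two dyadic bounds reduce this to `12/32 ≤ (1 - 6/32) / 2`, whence the threshold `1/32`. The
slow variation obtained here is the hypothesis of `energy_estimate`. -/
theorem abs_mul_modelWeight'_le_half {r : ℝ} (hr : |r - 1| ≤ 1 / 32) (N : ℕ) (x : ℝ) :
    |x * modelWeight' r N x| ≤ modelWeight r N x / 2 := by
  obtain ⟨j, h1, h2⟩ := exists_dyadic x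
  have h := abs_le.mp hr
  have a := (abs_le.mp (abs_modelWeight_sub_le (r := r) (by linarith) (by linarith) (N := N) h1 h2)).1
  have b := abs_mul_modelWeight'_le (r := r) (by linarith) (by linarith) (N := N) h1 h2
  have hp : 0 < r ^ min j N := pow_pos (by linarith) _
  nlinarith

/-- On a fixed scale range the model weight is bounded above and below. -/
theorem exists_modelWeight_bounds {r : ℝ} (hr : |r - 1| ≤ 1 / 32) (N : ℕ) :
    ∃ m M : ℝ, 0 < m ∧ ∀ x, m ≤ modelWeight r N x ∧ modelWeight r N x ≤ M := by
  have h := abs_le.mp hr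
  refine ⟨1 / 2 * (1 / 2) ^ N, 2 * 2 ^ N, by positivity, fun x => ?_⟩
  obtain ⟨j, h1, h2⟩ := exists_dyadic x
  have a := abs_le.mp (abs_modelWeight_sub_le (r := r) (by linarith) (by linarith) (N := N) h1 h2)
  have hp : 0 < r ^ min j N := pow_pos (by linarith) _
  have l1 : (1 / 2 : ℝ) ^ N ≤ r ^ min j N :=
    (pow_le_pow_of_le_one (by norm_num) (by norm_num) (min_le_right j N)).trans
      (pow_le_pow_left₀ (by norm_num) (by linarith) _)
  have l2 : r ^ min j N ≤ 2 ^ N :=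
    (pow_le_pow_left₀ (by linarith) (by linarith) _).trans
      (pow_le_pow_right₀ (by norm_num) (min_le_right j N))
  constructor <;> nlinarith

theorem measurable_modelWeight (r : ℝ) (N : ℕ) : Measurable (modelWeight r N) :=
  (continuous_iff_continuousAt.mpr
    fun x => (hasDerivAt_modelWeight r N x).continuousAt).measurable

end SelfSimilar

namespace SelfSimilar

open Filter Topology

/-! ### A priori estimates -/

theorem integrable_bdd_mul_mul {c p q : ℝ → ℝ} {M : ℝ} (hc : AEStronglyMeasurable c volume)
    (hb : ∀ x, |c x| ≤ M) (hp : MemLp p 2 volume) (hq : MemLp q 2 volume) :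
    Integrable fun x => c x * (p x * q x) :=
  (hp.integrable_mul hq).bdd_mul hc (ae_of_all _ hb)

theorem integrable_bdd_mul_sq {c p : ℝ → ℝ} {M : ℝ} (hc : AEStronglyMeasurable c volume)
    (hb : ∀ x, |c x| ≤ M) (hp : MemLp p 2 volume) :
    Integrable fun x => c x * p x ^ 2 := by
  simpa only [pow_two] using integrable_bdd_mul_mul hc hb hp hp

theorem memLp_bdd_mul {c p : ℝ → ℝ} {M : ℝ} (hc : AEStronglyMeasurable c volume)
    (hb : ∀ x, |c x| ≤ M) (hp : MemLp p 2 volume) : MemLp (fun x => c x * p x) 2 volume := by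
  refine MemLp.of_le_mul (c := M) hp (hc.mul hp.1) (ae_of_all _ fun x => ?_)
  rw [norm_mul]
  exact mul_le_mul_of_nonneg_right (hb x) (norm_nonneg _)

theorem IsSpectral.memLp_dilation {g : ℝ → ℂ} (h : IsSpectral g) :
    MemLp (fun x => x * synth (mulD g) x) 2 volume := by
  simp only [← h.test_mulD.synth_opX]
  exact h.test_mulD.test_opX.memLp_synth

/-- Integration by parts of the transport term. -/
theorem integral_transport {g : ℝ → ℂ} (h : IsSpectral g) {w w' : ℝ → ℝ} {M : ℝ}
    (hw : ∀ x, HasDerivAt w (w' x) x) (hb : ∀ x, |w x| ≤ M) (hb' : ∀ x, |x * w' x| ≤ M) :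
    ∫ x, (w x * (x * synth (mulD g) x * synth g x) +
      2⁻¹ * ((w x + x * w' x) * synth g x ^ 2)) = 0 := by
  have hwc : Continuous w := continuous_iff_continuousAt.mpr fun x => (hw x).continuousAt
  have hw'm : Measurable w' := by
    have : w' = deriv w := funext fun x => (hw x).deriv.symm
    rw [this]; exact measurable_deriv w
  have hxw : AEStronglyMeasurable (fun x => x * w' x) volume :=
    (measurable_id.mul hw'm).aestronglyMeasurable
  have hv := h.memLp_synth
  have hy := h.memLp_dilation
  have hxv : MemLp (fun x => x * synth g x) 2 volume := by
    simp only [← h.synth_opX]; exact h.test_opX.memLp_synth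
  have i1 := integrable_bdd_mul_mul hwc.aestronglyMeasurable hb hy hv
  have i2 : Integrable fun x => (w x + x * w' x) * synth g x ^ 2 :=
    integrable_bdd_mul_sq (M := M + M) (hwc.aestronglyMeasurable.add hxw)
      (fun x => (abs_add_le _ _).trans (add_le_add (hb x) (hb' x))) hv
  -- The integrand to be shown of mean zero is half the derivative of `x w v²`.
  have ibp := integral_mul_deriv_eq_deriv_mul_of_integrable
    (u := fun x => w x * x * synth g x)
    (u' := fun x => (w' x * x + w x) * synth g x + w x * x * synth (mulD g) x)
    (v := synth g) (v' := synth (mulD g))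
    (fun x _ => by
      have h1 := ((hw x).mul (hasDerivAt_id x)).mul (h.hasDerivAt_synth x)
      refine HasDerivAt.congr_deriv h1 ?_
      simp)
    (fun x _ => h.hasDerivAt_synth x)
    (i1.congr (ae_of_all _ fun x => by simp only [Pi.mul_apply]; ring))
    ((i2.add i1).congr (ae_of_all _ fun x => by simp only [Pi.add_apply, Pi.mul_apply]; ring))
    ((integrable_bdd_mul_mul hwc.aestronglyMeasurable hb hxv hv).congr
      (ae_of_all _ fun x => by simp only [Pi.mul_apply]; ring))
  have e1 : ∫ x, w x * x * synth g x * synth (mulD g) x =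
      ∫ x, w x * (x * synth (mulD g) x * synth g x) := by
    congr 1; ext x; ring
  have e2 : ∫ x, ((w' x * x + w x) * synth g x + w x * x * synth (mulD g) x) * synth g x =
      ∫ x, ((w x + x * w' x) * synth g x ^ 2 + w x * (x * synth (mulD g) x * synth g x)) := by
    congr 1; ext x; ring
  rw [e1, e2, integral_add i2 i1] at ibp
  rw [integral_add i1 (i2.const_mul _), integral_const_mul]
  linarith

/-- The linear operator with coefficient `W`, on the function with Fourier transform `g`. -/
noncomputable def linOp (W : ℝ → ℝ) (g : ℝ → ℂ) (x : ℝ) : ℝ :=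
  -synth (mulA g) x + W x * (x * synth (mulD g) x) / 3

theorem memLp_linOp {g : ℝ → ℂ} (h : IsSpectral g) {W : ℝ → ℝ} {M : ℝ}
    (hW : AEStronglyMeasurable W volume) (hb : ∀ x, |W x| ≤ M) :
    MemLp (linOp W g) 2 volume := by
  have h2 := (memLp_bdd_mul hW hb h.memLp_dilation).const_mul (1 / 3)
  refine (h.test_mulA.memLp_synth.neg.add h2).ae_eq (ae_of_all _ fun x => ?_)
  simp only [Pi.add_apply, Pi.neg_apply, linOp]
  ring

theorem integrable_sq_div {F w : ℝ → ℝ} {m : ℝ} (hF : MemLp F 2 volume) (hw : Measurable w)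
    (hm : 0 < m) (hmw : ∀ x, m ≤ w x) : Integrable fun x => F x ^ 2 / w x := by
  have := integrable_bdd_mul_sq (c := fun x => (w x)⁻¹) (M := m⁻¹)
    hw.inv.aestronglyMeasurable (fun x => by
      rw [abs_of_pos (inv_pos.mpr (hm.trans_le (hmw x)))]
      exact inv_anti₀ hm (hmw x)) hF
  refine this.congr (ae_of_all _ fun x => ?_)
  simp only; rw [div_eq_inv_mul]

/-- The weighted energy estimate. -/
theorem energy_estimate {g : ℝ → ℂ} (h : IsSpectral g) {w w' ρ : ℝ → ℝ} {m M : ℝ}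
    (hw : ∀ x, HasDerivAt w (w' x) x) (hm : 0 < m) (hmw : ∀ x, m ≤ w x) (hb : ∀ x, w x ≤ M)
    (hb' : ∀ x, |x * w' x| ≤ w x / 2) (hρm : Measurable ρ) (hρ : ∀ x, |ρ x - 1| ≤ 1 / 10) :
    (∫ x, w x * synth g x ^ 2) + ∫ x, w x * (x * synth (mulD g) x) ^ 2 ≤
      300 * ∫ x, linOp (fun x => ρ x * w x) g x ^ 2 / w x := by
  have hwc : Continuous w := continuous_iff_continuousAt.mpr fun x => (hw x).continuousAt
  have hw0 : ∀ x, 0 < w x := fun x => hm.trans_le (hmw x)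
  have hwb : ∀ x, |w x| ≤ M := fun x => by rw [abs_of_pos (hw0 x)]; exact hb x
  have hv := h.memLp_synth
  have hy := h.memLp_dilation
  have hA := h.test_mulA.memLp_synth
  set F := linOp (fun x => ρ x * w x) g with hF
  have hFm : MemLp F 2 volume := memLp_linOp (M := 11 / 10 * M) h
    (hρm.mul hwc.measurable).aestronglyMeasurable (fun x => by
      rw [abs_mul, abs_of_pos (hw0 x)]
      have h1 : |ρ x| ≤ 11 / 10 := by
        have := abs_le.mp (hρ x); rw [abs_le]; constructor <;> linarith
      exact mul_le_mul h1 (hb x) (hw0 x).le (by norm_num))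
  have iF : Integrable fun x => F x ^ 2 / w x :=
    integrable_sq_div hFm hwc.measurable hm hmw
  have iv := integrable_bdd_mul_sq hwc.aestronglyMeasurable hwb hv
  have iy := integrable_bdd_mul_sq hwc.aestronglyMeasurable hwb hy
  have iAv : Integrable fun x => synth (mulA g) x * synth g x := hA.integrable_mul hv
  have iAy : Integrable fun x => synth (mulA g) x * (x * synth (mulD g) x) :=
    hA.integrable_mul hy
  set T : ℝ → ℝ := fun x => w x * (x * synth (mulD g) x * synth g x) +
      2⁻¹ * ((w x + x * w' x) * synth g x ^ 2) with hT
  have hT0 : ∫ x, T x = 0 := integral_transport h hw hwb (fun x => (hb' x).trans (by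
    linarith [hb x, hw0 x]))
  have hw'm : Measurable w' := by
    have : w' = deriv w := funext fun x => (hw x).deriv.symm
    rw [this]; exact measurable_deriv w
  have iT : Integrable T := by
    refine (integrable_bdd_mul_mul hwc.aestronglyMeasurable hwb hy hv).add
      (Integrable.const_mul (integrable_bdd_mul_sq (M := M + M)
        (hwc.aestronglyMeasurable.add (measurable_id.mul hw'm).aestronglyMeasurable)
        (fun x => (abs_add_le _ _).trans (add_le_add (hwb x) ?_)) hv) _)
    exact (hb' x).trans (by linarith [hb x, hw0 x])
  have iG : Integrable fun x => synth (mulA g) x * synth g x -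
      synth (mulA g) x * (x * synth (mulD g) x) - 1 / 3 * T x :=
    (iAv.sub iAy).sub (iT.const_mul _)
  -- This integrand has mean zero by the dilation identity and by `integral_transport`, so it may be
  -- subtracted from a pointwise inequality at no cost.
  have hG0 : ∫ x, (synth (mulA g) x * synth g x -
      synth (mulA g) x * (x * synth (mulD g) x) - 1 / 3 * T x) = 0 := by
    have i3 : Integrable fun x => synth (mulA g) x * synth g x -
        synth (mulA g) x * (x * synth (mulD g) x) := iAv.sub iAy
    rw [integral_sub i3 (iT.const_mul _), integral_sub iAv iAy, integral_const_mul,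
      hT0, integral_mulA_mul_self h, integral_mulA_mul_dilation h]
    simp
  have key : ∀ x, 1 / 30 * (w x * synth g x ^ 2 + w x * (x * synth (mulD g) x) ^ 2) ≤
      10 * (F x ^ 2 / w x) - (synth (mulA g) x * synth g x -
      synth (mulA g) x * (x * synth (mulD g) x) - 1 / 3 * T x) := by
    intro x
    have hx := hw0 x
    -- In terms of `s = F / w` and `θ = x w' / w`, the weight factors out and the claim becomes an
    -- inequality between quadratic forms in `v`, `y = x v'` and `s`.
    obtain ⟨s, hs⟩ : ∃ s, F x = w x * s := ⟨F x / w x, by field_simp⟩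
    obtain ⟨θ, hθ⟩ : ∃ θ, x * w' x = w x * θ := ⟨x * w' x / w x, by field_simp⟩
    have hθ' : -(1 / 2) ≤ θ := by
      have := (abs_le.mp (hb' x)).1
      rw [hθ] at this
      by_contra hc
      push Not at hc
      nlinarith
    have hρx := abs_le.mp (hρ x)
    have hA' : synth (mulA g) x = w x * (ρ x * (x * synth (mulD g) x) / 3 - s) := by
      have : F x = -synth (mulA g) x + ρ x * w x * (x * synth (mulD g) x) / 3 := rfl
      rw [hs] at this
      linarith
    rw [hs, hT, hA']
    simp only
    rw [hθ]
    set v := synth g x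
    set y := x * synth (mulD g) x
    have e : (w x * s) ^ 2 / w x = w x * s ^ 2 := by field_simp
    rw [e]
    -- Coercivity: `θ ≥ -1/2` gives `v² / 12`, `ρ ≥ 9/10` gives `3 y² / 10`, the cross term carries
    -- the small factor `ρ - 1`, and `10 s²` absorbs the source.
    have q : 1 / 30 * (v ^ 2 + y ^ 2) ≤ 10 * s ^ 2 + (1 + θ) * v ^ 2 / 6 + ρ x * y ^ 2 / 3
        - (ρ x - 1) * (y * v) / 3 + s * v - s * y := by
      have h1 : v ^ 2 / 12 ≤ (1 + θ) * v ^ 2 / 6 := by nlinarith [sq_nonneg v]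
      have h2 : 3 / 10 * y ^ 2 ≤ ρ x * y ^ 2 / 3 := by nlinarith [sq_nonneg y]
      have h3 : (ρ x - 1) * (y * v) ≤ 1 / 20 * (y ^ 2 + v ^ 2) := by
        have : |(ρ x - 1) * (y * v)| ≤ 1 / 10 * ((y ^ 2 + v ^ 2) / 2) := by
          rw [abs_mul]
          refine mul_le_mul (hρ x) ?_ (abs_nonneg _) (by norm_num)
          rw [abs_le]; constructor <;> nlinarith [sq_nonneg (y + v), sq_nonneg (y - v)]
        linarith [le_abs_self ((ρ x - 1) * (y * v))]
      nlinarith [sq_nonneg (v + 15 * s), sq_nonneg (y - 5 * s)]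
    nlinarith [mul_le_mul_of_nonneg_left q hx.le]
  have fin := integral_mono ((iv.add iy).const_mul (1 / 30)) ((iF.const_mul 10).sub iG) key
  simp only [Pi.add_apply, Pi.sub_apply] at fin
  rw [integral_const_mul, integral_add iv iy, integral_sub (iF.const_mul 10) iG,
    integral_const_mul, hG0] at fin
  linarith

end SelfSimilar

/-! ### Interpolation inequalities and the commutator with the model transport coefficient. -/

namespace SelfSimilar

open Filter Topology

theorem IsHermTest.integrable_norm_sq {g : ℝ → ℂ} (h : IsHermTest g) :
    Integrable fun ξ => ‖g ξ‖ ^ 2 :=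
  (memLp_two_iff_integrable_sq_norm h.smooth.continuous.aestronglyMeasurable).mp h.memLp

theorem IsHermTest.integrable_synth_sq {g : ℝ → ℂ} (h : IsHermTest g) :
    Integrable fun x => synth g x ^ 2 :=
  (memLp_two_iff_integrable_sq h.memLp_synth.1).mp h.memLp_synth

theorem norm_mulD_sq (g : ℝ → ℂ) (ξ : ℝ) :
    ‖mulD g ξ‖ ^ 2 = |2 * Real.pi * ξ| ^ 2 * ‖g ξ‖ ^ 2 := by
  rw [mulD, norm_mul, norm_symD, mul_pow]

theorem norm_mulA_sq (g : ℝ → ℂ) (ξ : ℝ) :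
    ‖mulA g ξ‖ ^ 2 = (|2 * Real.pi * ξ| ^ 2) ^ 3 * ‖g ξ‖ ^ 2 := by
  rw [mulA, norm_mul, norm_symA, mul_pow]; ring

theorem norm_symS_le (ξ : ℝ) : ‖symS ξ‖ ≤ 1 := by
  rcases Real.sign_apply_eq ξ with h | h | h <;> simp [symS, h]

theorem integral_mulS_sq_le {g : ℝ → ℂ} (h : IsSpectral g) :
    ∫ x, synth (mulS g) x ^ 2 ≤ ∫ x, synth g x ^ 2 := by
  rw [integral_synth_sq h.test_mulS.toIsHermTest, integral_synth_sq h.toIsHermTest]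
  refine integral_mono h.test_mulS.integrable_norm_sq h.integrable_norm_sq fun ξ => ?_
  simp only [mulS, norm_mul]
  refine pow_le_pow_left₀ (by positivity) (mul_le_of_le_one_left (norm_nonneg _) (norm_symS_le ξ)) 2

/-- Interpolation: `‖v''‖² ≤ ‖v'‖² + ‖|D|³v‖²`. -/
theorem integral_second_sq_le {g : ℝ → ℂ} (h : IsSpectral g) :
    ∫ x, synth (mulD (mulD g)) x ^ 2 ≤
      (∫ x, synth (mulD g) x ^ 2) + ∫ x, synth (mulA g) x ^ 2 := by
  rw [integral_synth_sq h.test_mulD.test_mulD.toIsHermTest,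
    integral_synth_sq h.test_mulD.toIsHermTest, integral_synth_sq h.test_mulA.toIsHermTest,
    ← integral_add h.test_mulD.integrable_norm_sq h.test_mulA.integrable_norm_sq]
  refine integral_mono h.test_mulD.test_mulD.integrable_norm_sq
    (h.test_mulD.integrable_norm_sq.add h.test_mulA.integrable_norm_sq) fun ξ => ?_
  simp only [norm_mulD_sq, norm_mulA_sq, ← mul_assoc, ← add_mul]
  refine mul_le_mul_of_nonneg_right ?_ (by positivity)
  set t := |2 * Real.pi * ξ| ^ 2
  have ht : 0 ≤ t := by positivity
  nlinarith [mul_nonneg ht (sq_nonneg (t - 1))]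

/-- Interpolation of the intermediate derivatives. -/
theorem integral_intermediate_le {g : ℝ → ℂ} (h : IsSpectral g) :
    10 * (∫ x, synth (mulD (mulD g)) x ^ 2) + ∫ x, synth (mulD g) x ^ 2 ≤
      1 / 2 * (∫ x, synth (mulA g) x ^ 2) + 3000 * ∫ x, synth g x ^ 2 := by
  rw [integral_synth_sq h.test_mulD.test_mulD.toIsHermTest, integral_synth_sq h.toIsHermTest,
    integral_synth_sq h.test_mulD.toIsHermTest, integral_synth_sq h.test_mulA.toIsHermTest,
    ← integral_const_mul, ← integral_const_mul, ← integral_const_mul,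
    ← integral_add (h.test_mulD.test_mulD.integrable_norm_sq.const_mul _)
      h.test_mulD.integrable_norm_sq,
    ← integral_add (h.test_mulA.integrable_norm_sq.const_mul _)
      (h.integrable_norm_sq.const_mul _)]
  refine integral_mono ((h.test_mulD.test_mulD.integrable_norm_sq.const_mul _).add
      h.test_mulD.integrable_norm_sq) ((h.test_mulA.integrable_norm_sq.const_mul _).add
      (h.integrable_norm_sq.const_mul _)) fun ξ => ?_
  simp only [norm_mulD_sq, norm_mulA_sq, ← mul_assoc, ← add_mul]
  refine mul_le_mul_of_nonneg_right ?_ (by positivity)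
  set t := |2 * Real.pi * ξ| ^ 2
  have ht : 0 ≤ t := by positivity
  -- With `t = |2πξ|²` the claim is `10 t² + t ≤ t³ / 2 + 3000`; expanding `(t + 12)(t - 18)² ≥ 0`
  -- bounds the cubic term from below.
  have := mul_nonneg (show 0 ≤ t + 12 by linarith) (sq_nonneg (t - 18))
  nlinarith [mul_nonneg ht (sq_nonneg (t - 20)), sq_nonneg (t - 20)]

theorem integral_third_sq {g : ℝ → ℂ} (h : IsSpectral g) :
    ∫ x, synth (mulD (mulD (mulD g))) x ^ 2 = ∫ x, synth (mulA g) x ^ 2 := by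
  rw [integral_synth_sq h.test_mulD.test_mulD.test_mulD.toIsHermTest,
    integral_synth_sq h.test_mulA.toIsHermTest]
  congr 1; ext ξ
  simp only [norm_mulD_sq, norm_mulA_sq]
  ring

/-- Writing `|D|³` as minus the derivative of the Hilbert transform of `v''` isolates one
derivative, which `integral_cross` moves onto the transport term. -/
theorem mulA_eq (g : ℝ → ℂ) (ξ : ℝ) : mulA g ξ = -mulD (mulS (mulD (mulD g))) ξ := by
  simp only [mulA, mulD, mulS, symA, symD, symS]
  rcases lt_trichotomy ξ 0 with h | h | h
  · rw [Real.sign_of_neg h, abs_mul, abs_of_pos (by positivity), abs_of_neg h]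
    push_cast
    linear_combination (-8 * Real.pi ^ 3 * ξ ^ 3 * g ξ : ℂ) * (1 - Complex.I ^ 2) * Complex.I_sq
  · simp [h]
  · rw [Real.sign_of_pos h, abs_mul, abs_of_pos (by positivity), abs_of_pos h]
    push_cast
    linear_combination (8 * Real.pi ^ 3 * ξ ^ 3 * g ξ : ℂ) * (1 - Complex.I ^ 2) * Complex.I_sq

theorem synth_neg (g : ℝ → ℂ) (x : ℝ) : synth (fun ξ => -g ξ) x = -synth g x := by
  simp only [synth, fourierInv_real_eq, mul_neg]
  rw [integral_neg, Complex.neg_re]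

theorem synth_mulA_eq (g : ℝ → ℂ) (x : ℝ) :
    synth (mulA g) x = -synth (mulD (mulS (mulD (mulD g)))) x := by
  rw [show mulA g = fun ξ => -mulD (mulS (mulD (mulD g))) ξ from funext (mulA_eq g), synth_neg]

/-- The commutator of the Hilbert transform with the model transport coefficient. -/
theorem abs_integral_hilbert_mul_model_le {k : ℝ → ℂ} (hk : IsSpectral k) {r : ℝ} (hr : 1 ≤ r)
    (hr' : r ≤ 33 / 32) (N : ℕ) :
    |∫ x, synth (mulS (mulD k)) x * (modelWeight r N x * (x * synth (mulD k) x))| ≤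
      1 / 32 * ∫ x, synth k x ^ 2 := by
  set S := synth (mulS (mulD k)) with hS
  set f := synth (mulD k) with hf
  have hSm : MemLp S 2 volume := hk.test_mulD.test_mulS.memLp_synth
  have hfm : MemLp f 2 volume := hk.test_mulD.memLp_synth
  have hxf : MemLp (fun x => x * f x) 2 volume := by
    simp only [hf, ← hk.test_mulD.synth_opX]
    exact hk.test_mulD.test_opX.memLp_synth
  have i0 : Integrable fun x => S x * (x * f x) := hSm.integrable_mul hxf
  have h0 : ∫ x, S x * (x * f x) = 0 := integral_hilbert_mul_position hk.test_mulD
  have ik (j : ℕ) : Integrable fun x => S x * (x / (4 ^ (j + 1) + x ^ 2) * f x) := by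
    have := integrable_bdd_mul_mul (c := fun x : ℝ => x / (4 ^ (j + 1) + x ^ 2)) (M := 1)
      (Measurable.aestronglyMeasurable (by fun_prop)) (fun x => by
        rw [abs_div, abs_of_pos (a := 4 ^ (j + 1) + x ^ 2) (by positivity),
          div_le_one (by positivity)]
        have : (1 : ℝ) ≤ 4 ^ (j + 1) := one_le_pow₀ (by norm_num)
        nlinarith [sq_abs x, sq_nonneg (|x| - 1)]) hSm hfm
    exact this.congr (ae_of_all _ fun x => by simp only; ring)
  -- From `x³ / (L + x²) = x - L x / (L + x²)`, the coefficient is a multiple of `x`, whose form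
  -- vanishes, minus bounded coefficients at the scales `2ʲ⁺¹`.
  have e : ∀ x, S x * (modelWeight r N x * (x * f x)) =
      (1 + ∑ j ∈ Finset.range N, (r ^ (j + 1) - r ^ j)) * (S x * (x * f x)) -
      ∑ j ∈ Finset.range N, ((r ^ (j + 1) - r ^ j) * 4 ^ (j + 1)) *
        (S x * (x / (4 ^ (j + 1) + x ^ 2) * f x)) := by
    intro x
    have e1 : modelWeight r N x * x = (1 + ∑ j ∈ Finset.range N, (r ^ (j + 1) - r ^ j)) * x -
        ∑ j ∈ Finset.range N, ((r ^ (j + 1) - r ^ j) * 4 ^ (j + 1)) *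
          (x / (4 ^ (j + 1) + x ^ 2)) := by
      rw [modelWeight, add_mul, add_mul, Finset.sum_mul, Finset.sum_mul, add_sub_assoc,
        ← Finset.sum_sub_distrib]
      congr 1
      refine Finset.sum_congr rfl fun j _ => ?_
      have : (4 : ℝ) ^ (j + 1) + x ^ 2 ≠ 0 := by positivity
      field_simp
      ring
    calc S x * (modelWeight r N x * (x * f x)) = (modelWeight r N x * x) * (S x * f x) := by ring
      _ = _ := by
        rw [e1, sub_mul, Finset.sum_mul]
        congr 1
        · ring
        · exact Finset.sum_congr rfl fun j _ => by ring
  simp only [e]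
  rw [integral_sub (i0.const_mul _) (integrable_finsetSum _ fun j _ => (ik j).const_mul _),
    integral_const_mul, h0, mul_zero, zero_sub, abs_neg,
    integral_finsetSum _ fun j _ => (ik j).const_mul _]
  refine (Finset.abs_sum_le_sum_abs _ _).trans ?_
  set U := ∫ x, synth k x ^ 2 with hU
  have hU0 : 0 ≤ U := integral_nonneg fun x => sq_nonneg _
  -- The coefficient `(r - 1) rʲ 4ʲ⁺¹` meets `l⁻³ = 8^{-(j+1)}`. What remains decays like `(r /
  -- 2)ʲ`, so the sum is bounded independently of `N`.
  have term : ∀ j : ℕ, |∫ x, ((r ^ (j + 1) - r ^ j) * 4 ^ (j + 1)) *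
      (S x * (x / (4 ^ (j + 1) + x ^ 2) * f x))| ≤ 1 / 4 * (r - 1) * U * (3 / 4) ^ j := by
    intro j
    rw [integral_const_mul, abs_mul]
    have h1 := abs_integral_hilbert_mul_div_le hk (l := 2 ^ (j + 1)) (by positivity)
    have e4 : ((2 : ℝ) ^ (j + 1)) ^ 2 = 4 ^ (j + 1) := by
      rw [← pow_mul, mul_comm, pow_mul]; norm_num
    have e8 : ((2 : ℝ) ^ (j + 1)) ^ 3 = 4 ^ (j + 1) * 2 ^ (j + 1) := by
      rw [pow_succ, e4]
    rw [e4, e8] at h1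
    have hc : |(r ^ (j + 1) - r ^ j) * 4 ^ (j + 1)| = (r - 1) * r ^ j * 4 ^ (j + 1) := by
      rw [show (r ^ (j + 1) - r ^ j) = (r - 1) * r ^ j by ring]
      refine abs_of_nonneg ?_
      have : 0 ≤ r - 1 := by linarith
      positivity
    rw [hc]
    have hr0 : 0 ≤ r - 1 := by linarith
    have hpow : r ^ j * (1 / 2) ^ j ≤ (3 / 4) ^ j := by
      rw [← mul_pow]; exact pow_le_pow_left₀ (by linarith) (by linarith) j
    calc (r - 1) * r ^ j * 4 ^ (j + 1) * |∫ x, S x * (x / (4 ^ (j + 1) + x ^ 2) * f x)| ≤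
        (r - 1) * r ^ j * 4 ^ (j + 1) * (1 / (2 * (4 ^ (j + 1) * 2 ^ (j + 1))) * U) :=
          mul_le_mul_of_nonneg_left h1 (by positivity)
      _ = 1 / 4 * (r - 1) * U * (r ^ j * (1 / 2) ^ j) := by
        rw [one_div_pow, pow_succ (2 : ℝ)]
        field_simp
        ring
      _ ≤ _ := by gcongr
  refine (Finset.sum_le_sum fun j _ => term j).trans ?_
  rw [← Finset.mul_sum]
  have geo : ∑ j ∈ Finset.range N, (3 / 4 : ℝ) ^ j ≤ 4 := by
    have := geom_sum_eq (x := (3 / 4 : ℝ)) (by norm_num) N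
    rw [this]
    have : (0 : ℝ) < (3 / 4) ^ N := by positivity
    rw [div_le_iff_of_neg (by norm_num)]
    linarith
  have hr0 : 0 ≤ r - 1 := by linarith
  calc 1 / 4 * (r - 1) * U * ∑ j ∈ Finset.range N, (3 / 4 : ℝ) ^ j ≤ 1 / 4 * (r - 1) * U * 4 := by
        gcongr
    _ ≤ 1 / 4 * (1 / 32) * U * 4 := by gcongr; linarith
    _ = _ := by ring

end SelfSimilar

/-! ### The a priori estimate, uniform in the truncation scale. -/

namespace SelfSimilar

open Filter Topology

theorem one_le_modelWeight {r : ℝ} (hr : 1 ≤ r) (N : ℕ) (x : ℝ) : 1 ≤ modelWeight r N x := by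
  unfold modelWeight
  refine le_add_of_nonneg_right (Finset.sum_nonneg fun k _ => mul_nonneg ?_ (by positivity))
  exact sub_nonneg.mpr (pow_le_pow_right₀ hr (Nat.le_succ k))

theorem modelWeight_le_one {r : ℝ} (hr0 : 0 ≤ r) (hr : r ≤ 1) (N : ℕ) (x : ℝ) :
    modelWeight r N x ≤ 1 := by
  unfold modelWeight
  refine add_le_of_nonpos_right (Finset.sum_nonpos fun k _ =>
    mul_nonpos_of_nonpos_of_nonneg ?_ (by positivity))
  exact sub_nonpos.mpr (pow_le_pow_of_le_one hr0 hr (Nat.le_succ k))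

theorem modelWeight_le_two {r : ℝ} (hr : |r - 1| ≤ 1 / 32) (N : ℕ) {x : ℝ} (hx : |x| ≤ 1) :
    modelWeight r N x ≤ 2 := by
  have h := abs_le.mp hr
  have hx2 : x ^ 2 ≤ 1 := by rw [← sq_abs]; nlinarith [abs_nonneg x]
  have a := (abs_le.mp (abs_modelWeight_sub_le (r := r) (by linarith) (by linarith) (N := N)
    (x := x) (j := 0) (by nlinarith [sq_nonneg x]) (by norm_num; linarith))).2
  simp at a
  linarith

/-- A decaying model weight loses at most a factor `4` per shell since `4 r ≥ 1`. This replaces a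
positive lower bound, which could not be uniform in `N`. -/
theorem half_le_modelWeight_mul {r : ℝ} (hr : |r - 1| ≤ 1 / 32) (N : ℕ) (x : ℝ) :
    1 / 2 ≤ modelWeight r N x * (1 + x ^ 2) := by
  have h := abs_le.mp hr
  obtain ⟨j, h1, h2⟩ := exists_dyadic x
  have a := (abs_le.mp (abs_modelWeight_sub_le (r := r) (by linarith) (by linarith) (N := N)
    h1 h2)).1
  have hp : 0 < r ^ min j N := pow_pos (by linarith) _
  have h3 : 1 ≤ r ^ min j N * (1 + x ^ 2) := by
    calc (1 : ℝ) ≤ (r * 4) ^ min j N := one_le_pow₀ (by linarith)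
      _ = r ^ min j N * 4 ^ min j N := mul_pow _ _ _
      _ ≤ r ^ min j N * 4 ^ j := by gcongr; norm_num; exact min_le_left _ _
      _ ≤ _ := by gcongr
  nlinarith [sq_nonneg x]

theorem measurable_modelWeight' (r : ℝ) (N : ℕ) : Measurable (modelWeight' r N) := by
  have : modelWeight' r N = deriv (modelWeight r N) :=
    funext fun x => (hasDerivAt_modelWeight r N x).deriv.symm
  rw [this]; exact measurable_deriv _

/-- Integration by parts of the cross term. -/
theorem integral_cross {g : ℝ → ℂ} (h : IsSpectral g) {r : ℝ} (hr : |r - 1| ≤ 1 / 32) (N : ℕ) :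
    ∫ x, synth (mulA g) x * (modelWeight r N x * (x * synth (mulD g) x)) =
      (∫ x, (modelWeight r N x + x * modelWeight' r N x) *
        (synth (mulS (mulD (mulD g))) x * synth (mulD g) x)) +
      ∫ x, synth (mulS (mulD (mulD g))) x *
        (modelWeight r N x * (x * synth (mulD (mulD g)) x)) := by
  set w := modelWeight r N
  set w' := modelWeight' r N
  set S := synth (mulS (mulD (mulD g))) with hS
  have hSs : IsSpectral (mulS (mulD (mulD g))) := h.test_mulD.test_mulD.test_mulS
  obtain ⟨m, M, hm, hmM⟩ := exists_modelWeight_bounds hr N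
  have hw0 : ∀ x, 0 < w x := modelWeight_pos hr N
  have hwb : ∀ x, |w x| ≤ M := fun x => by rw [abs_of_pos (hw0 x)]; exact (hmM x).2
  have hwm : AEStronglyMeasurable w volume := (measurable_modelWeight r N).aestronglyMeasurable
  have hxw : AEStronglyMeasurable (fun x => x * w' x) volume :=
    (measurable_id.mul (measurable_modelWeight' r N)).aestronglyMeasurable
  have hxb : ∀ x, |w x + x * w' x| ≤ M + M := fun x => (abs_add_le _ _).trans
    (add_le_add (hwb x) ((abs_mul_modelWeight'_le_half hr N x).trans
      (by linarith [hwb x, abs_of_pos (hw0 x), hw0 x])))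
  have hu := h.test_mulD.memLp_synth
  have hSm := hSs.memLp_synth
  have hy := h.memLp_dilation
  have hxf := h.test_mulD.memLp_dilation
  have i1 := integrable_bdd_mul_mul hwm hwb hy h.test_mulA.memLp_synth
  have i2 : Integrable fun x => (w x + x * w' x) * (S x * synth (mulD g) x) :=
    integrable_bdd_mul_mul (hwm.add hxw) hxb hSm hu
  have i3 := integrable_bdd_mul_mul hwm hwb hxf hSm
  have i4 := integrable_bdd_mul_mul hwm hwb hy hSm
  -- The factor to be differentiated back is the Hilbert transform of `v''`, with derivative `-|D|³
  -- v`.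
  have ibp := integral_mul_deriv_eq_deriv_mul_of_integrable
    (u := fun x => w x * x * synth (mulD g) x)
    (u' := fun x => (w' x * x + w x) * synth (mulD g) x + w x * x * synth (mulD (mulD g)) x)
    (v := S) (v' := fun x => -synth (mulA g) x)
    (fun x _ => by
      have h1 := ((hasDerivAt_modelWeight r N x).mul (hasDerivAt_id x)).mul
        (h.test_mulD.hasDerivAt_synth x)
      refine HasDerivAt.congr_deriv h1 ?_
      simp [w, w'])
    (fun x _ => by
      have := hSs.hasDerivAt_synth x
      rw [synth_mulA_eq, neg_neg]; exact this)
    (i1.neg.congr (ae_of_all _ fun x => by simp only [Pi.mul_apply, Pi.neg_apply]; ring))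
    ((i2.add i3).congr (ae_of_all _ fun x => by simp only [Pi.add_apply, Pi.mul_apply]; ring))
    (i4.congr (ae_of_all _ fun x => by simp only [Pi.mul_apply]; ring))
  have i3' : Integrable fun x => S x * (w x * (x * synth (mulD (mulD g)) x)) :=
    i3.congr (ae_of_all _ fun x => by simp only; ring)
  rw [← integral_add i2 i3', ← neg_inj, ← integral_neg]
  calc _ = ∫ x, w x * x * synth (mulD g) x * -synth (mulA g) x := by congr 1; ext x; ring
    _ = _ := ibp
    _ = _ := by congr 2; ext x; ring

/-- The high frequency estimate for a growing weight. -/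
theorem integral_mulA_sq_le_of_one_le {g : ℝ → ℂ} (h : IsSpectral g) {r : ℝ} (hr1 : 1 ≤ r)
    (hr2 : r ≤ 33 / 32) (N : ℕ) {ρ : ℝ → ℝ} (hρm : Measurable ρ)
    (hρ : ∀ x, |ρ x - 1| ≤ 1 / 10) :
    ∫ x, synth (mulA g) x ^ 2 ≤
      4 * (∫ x, linOp (fun x => ρ x * modelWeight r N x) g x ^ 2) +
        6000 * ∫ x, synth g x ^ 2 := by
  have hr : |r - 1| ≤ 1 / 32 := by rw [abs_le]; constructor <;> linarith
  set w := modelWeight r N with hw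
  set w' := modelWeight' r N with hw'
  set A := synth (mulA g) with hA
  set S := synth (mulS (mulD (mulD g))) with hS
  set u := synth (mulD g) with hu
  set F := linOp (fun x => ρ x * w x) g with hF
  obtain ⟨m, M, hm, hmM⟩ := exists_modelWeight_bounds hr N
  have hw0 : ∀ x, 0 < w x := modelWeight_pos hr N
  have hwb : ∀ x, |w x| ≤ M := fun x => by rw [abs_of_pos (hw0 x)]; exact (hmM x).2
  have hwm : AEStronglyMeasurable w volume := (measurable_modelWeight r N).aestronglyMeasurable
  have hxw : AEStronglyMeasurable (fun x => x * w' x) volume :=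
    (measurable_id.mul (measurable_modelWeight' r N)).aestronglyMeasurable
  have hxb : ∀ x, |w x + x * w' x| ≤ M + M := fun x => (abs_add_le _ _).trans
    (add_le_add (hwb x) ((abs_mul_modelWeight'_le_half hr N x).trans
      (by linarith [hwb x, abs_of_pos (hw0 x), hw0 x])))
  have hAm : MemLp A 2 volume := h.test_mulA.memLp_synth
  have hum : MemLp u 2 volume := h.test_mulD.memLp_synth
  have hSm : MemLp S 2 volume := h.test_mulD.test_mulD.test_mulS.memLp_synth
  have hwy : MemLp (fun x => w x * (x * u x)) 2 volume := memLp_bdd_mul hwm hwb h.memLp_dilation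
  have hFm : MemLp F 2 volume := memLp_linOp (M := 11 / 10 * M) h
    (hρm.mul (measurable_modelWeight r N)).aestronglyMeasurable (fun x => by
      rw [abs_mul]
      have h1 : |ρ x| ≤ 11 / 10 := by
        have := abs_le.mp (hρ x); rw [abs_le]; constructor <;> linarith
      exact mul_le_mul h1 (hwb x) (abs_nonneg _) (by norm_num))
  have sq {p : ℝ → ℝ} (hp : MemLp p 2 volume) : Integrable fun x => p x ^ 2 :=
    (memLp_two_iff_integrable_sq hp.1).mp hp
  have iA := sq hAm
  have iu := sq hum
  have iS := sq hSm
  have iwy := sq hwy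
  have iF := sq hFm
  have iAwy : Integrable fun x => A x * (w x * (x * u x)) := hAm.integrable_mul hwy
  have i2 : Integrable fun x => (w x + x * w' x) * (S x * u x) :=
    integrable_bdd_mul_mul (hwm.add hxw) hxb hSm hum
  -- For a growing weight the energy estimate does not bound `w x v'` in `L²`. The cross term of
  -- `|D|³ v` and `w x v'` splits into a lower order term and the commutator form, bounded by `‖v'‖²
  -- / 32`.
  have cross := integral_cross h hr N
  have comm := abs_le.mp (abs_integral_hilbert_mul_model_le h.test_mulD hr1 hr2 N)
  have hlow : ∫ x, (w x + x * w' x) * (S x * u x) ≤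
      14 * (∫ x, S x ^ 2) + 1 / 24 * (4 * (∫ x, u x ^ 2) + ∫ x, (w x * (x * u x)) ^ 2) := by
    rw [← integral_const_mul, ← integral_const_mul, ← integral_add (iu.const_mul _) iwy,
      ← integral_const_mul, ← integral_add (iS.const_mul _) (((iu.const_mul _).fun_add iwy).const_mul _)]
    refine integral_mono i2 ((iS.const_mul _).add (((iu.const_mul _).add iwy).const_mul _))
      fun x => ?_
    simp only
    have b1 := abs_mul_modelWeight'_le_half hr N x
    have b2 : |w x + x * w' x| ≤ 3 / 2 * w x := (abs_add_le _ _).trans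
      (by rw [abs_of_pos (hw0 x)]; change _ + |x * modelWeight' r N x| ≤ _
          have : modelWeight r N x = w x := rfl
          linarith)
    -- Near the origin `w ≤ 2`; where `|x| ≥ 1` the extra factor `x` only helps.
    have b3 : (w x * u x) ^ 2 ≤ 4 * u x ^ 2 + (w x * (x * u x)) ^ 2 := by
      rcases le_total |x| 1 with hx | hx
      · have := modelWeight_le_two hr N hx
        have h4 : w x ^ 2 ≤ 4 := by nlinarith [hw0 x]
        nlinarith [sq_nonneg (u x), sq_nonneg (w x * (x * u x))]
      · have hx2 : 1 ≤ x ^ 2 := by rw [← sq_abs]; nlinarith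
        nlinarith [sq_nonneg (u x), sq_nonneg (w x * u x)]
    have b4 : (w x + x * w' x) * (S x * u x) ≤ 3 / 2 * (|S x| * |w x * u x|) := by
      refine (le_abs_self _).trans ?_
      rw [abs_mul, abs_mul, abs_mul, abs_of_pos (hw0 x)]
      nlinarith [mul_le_mul_of_nonneg_right b2 (mul_nonneg (abs_nonneg (S x)) (abs_nonneg (u x)))]
    have b5 : 3 / 2 * (|S x| * |w x * u x|) ≤ 14 * S x ^ 2 + 1 / 24 * (w x * u x) ^ 2 := by
      rw [← sq_abs (S x), ← sq_abs (w x * u x)]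
      nlinarith [sq_nonneg (56 / 3 * |S x| - |w x * u x|), sq_nonneg (|S x|),
        sq_nonneg (|w x * u x|)]
    nlinarith
  have hS2 := integral_mulS_sq_le h.test_mulD.test_mulD
  have interp := integral_intermediate_le h
  -- Expansion of `F²`. The squares of `|D|³ v` and `w x v'` stay on the left, the cross term keeps
  -- the coefficient belonging to `ρ = 1`, and the reserved multiple of `(w x v')²` pays for the
  -- lower order part of that cross term.
  have hexp : (∫ x, A x ^ 2) + 1 / 12 * (∫ x, (w x * (x * u x)) ^ 2) ≤
      2 * (∫ x, F x ^ 2) + 2 / 3 * (∫ x, A x * (w x * (x * u x)))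
        - 1 / 40 * ∫ x, (w x * (x * u x)) ^ 2 := by
    rw [← integral_const_mul, ← integral_const_mul, ← integral_const_mul, ← integral_const_mul,
      ← integral_add iA (iwy.const_mul _), ← integral_add (iF.const_mul _) (iAwy.const_mul _),
      ← integral_sub ((iF.const_mul _).fun_add (iAwy.const_mul _)) (iwy.const_mul _)]
    refine integral_mono (iA.add (iwy.const_mul _))
      (((iF.const_mul _).add (iAwy.const_mul _)).sub (iwy.const_mul _)) fun x => ?_
    simp only
    have e : F x = -A x + ρ x * w x * (x * u x) / 3 := rfl
    obtain ⟨δ, hδ⟩ : ∃ δ, ρ x = 1 + δ := ⟨ρ x - 1, by ring⟩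
    have hδ' : |δ| ≤ 1 / 10 := by have := hρ x; rwa [hδ, add_sub_cancel_left] at this
    rw [e, hδ]
    set z := w x * (x * u x)
    rw [show (1 + δ) * w x * (x * u x) = (1 + δ) * z by simp only [z]; ring]
    have hd := abs_le.mp hδ'
    have hδ2 : δ ^ 2 ≤ 1 / 100 := by nlinarith
    have hz := mul_le_mul_of_nonneg_right hδ2 (sq_nonneg z)
    nlinarith [sq_nonneg (-A x + z / 3 + 2 * (δ * z / 3)), sq_nonneg z]
  have hU0 : 0 ≤ ∫ x, (w x * (x * u x)) ^ 2 := integral_nonneg fun x => sq_nonneg _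
  have hu0 : 0 ≤ ∫ x, u x ^ 2 := integral_nonneg fun x => sq_nonneg _
  have hf0 : 0 ≤ ∫ x, synth (mulD (mulD g)) x ^ 2 := integral_nonneg fun x => sq_nonneg _
  rw [cross] at hexp
  have c2 := comm.2
  linarith

/-- Control of `v'` in `L²`. -/
theorem integral_deriv_sq_le {g : ℝ → ℂ} (h : IsSpectral g) {w : ℝ → ℝ} {M : ℝ}
    (hwm : Measurable w) (hw : ∀ x, 1 / 2 ≤ w x * (1 + x ^ 2)) (hb : ∀ x, w x ≤ M) :
    ∫ x, synth (mulD g) x ^ 2 ≤ 32 * (∫ x, w x * synth g x ^ 2) +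
      8 * (∫ x, w x * (x * synth (mulD g) x) ^ 2) + ∫ x, synth (mulA g) x ^ 2 := by
  have hw0 : ∀ x, 0 < w x := fun x => by
    by_contra hc
    push Not at hc
    nlinarith [hw x, sq_nonneg x]
  have hwb : ∀ x, |w x| ≤ M := fun x => by rw [abs_of_pos (hw0 x)]; exact hb x
  set v := synth g with hv
  set u := synth (mulD g) with hu
  set f := synth (mulD (mulD g)) with hf
  set φ : ℝ → ℝ := fun x => (1 + x ^ 2)⁻¹ with hφ
  set φ' : ℝ → ℝ := fun x => -(2 * x) / (1 + x ^ 2) ^ 2 with hφ'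
  have hφd : ∀ x, HasDerivAt φ (φ' x) x := fun x => by
    have h1 : HasDerivAt (fun x : ℝ => 1 + x ^ 2) (2 * x) x := by
      simpa using (hasDerivAt_pow 2 x).const_add 1
    exact h1.inv (by positivity)
  have hφ0 : ∀ x, 0 < φ x := fun x => by simp only [hφ]; positivity
  have hφ1 : ∀ x, φ x ≤ 1 := fun x => inv_le_one_of_one_le₀ (by nlinarith [sq_nonneg x])
  have hφ'b : ∀ x, |φ' x| ≤ φ x := fun x => by
    simp only [hφ', hφ]
    rw [abs_div, abs_of_pos (a := (1 + x ^ 2) ^ 2) (by positivity), div_le_iff₀ (by positivity),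
      pow_two (1 + x ^ 2), ← mul_assoc, inv_mul_cancel₀ (by positivity), one_mul, abs_neg, abs_mul,
      abs_two, ← sq_abs x]
    nlinarith [sq_nonneg (|x| - 1)]
  have hφm : AEStronglyMeasurable φ volume := Measurable.aestronglyMeasurable (by fun_prop)
  have hφ'm : AEStronglyMeasurable φ' volume := Measurable.aestronglyMeasurable (by fun_prop)
  have hφb1 : ∀ x, |φ x| ≤ 1 := fun x => by rw [abs_of_pos (hφ0 x)]; exact hφ1 x
  have hφb2 : ∀ x, |φ' x| ≤ 1 := fun x => (hφ'b x).trans (hφ1 x)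
  have hvm : MemLp v 2 volume := h.memLp_synth
  have hum : MemLp u 2 volume := h.test_mulD.memLp_synth
  have hfm : MemLp f 2 volume := h.test_mulD.test_mulD.memLp_synth
  have j1 := integrable_bdd_mul_mul hφm hφb1 hum hum
  have j2 := integrable_bdd_mul_mul hφm hφb1 hvm hfm
  have j3 := integrable_bdd_mul_mul hφ'm hφb2 hvm hum
  have j4 := integrable_bdd_mul_mul hφm hφb1 hum hvm
  have ibp := integral_mul_deriv_eq_deriv_mul_of_integrable
    (u := fun x => φ x * u x) (u' := fun x => φ' x * u x + φ x * f x) (v := v) (v' := u)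
    (fun x _ => (hφd x).mul (h.test_mulD.hasDerivAt_synth x))
    (fun x _ => h.hasDerivAt_synth x)
    (j1.congr (ae_of_all _ fun x => by simp only [Pi.mul_apply]; ring))
    ((j3.add j2).congr (ae_of_all _ fun x => by simp only [Pi.add_apply, Pi.mul_apply]; ring))
    (j4.congr (ae_of_all _ fun x => by simp only [Pi.mul_apply]; ring))
  have sq {p : ℝ → ℝ} (hp : MemLp p 2 volume) : Integrable fun x => p x ^ 2 :=
    (memLp_two_iff_integrable_sq hp.1).mp hp
  have iu := sq hum
  have iff := sq hfm
  have iv := integrable_bdd_mul_sq hwm.aestronglyMeasurable hwb hvm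
  have iy := integrable_bdd_mul_sq hwm.aestronglyMeasurable hwb h.memLp_dilation
  have iφ := integrable_bdd_mul_sq hφm hφb1 hum
  -- Near the origin `x v'` carries no information on `v'`, which is recovered by interpolation
  -- between `v` and `v''`.
  have s1 : ∫ x, φ x * u x ^ 2 ≤ 8 * (∫ x, w x * v x ^ 2) + 1 / 8 * (∫ x, u x ^ 2)
      + 1 / 8 * ∫ x, f x ^ 2 := by
    have e1 : ∫ x, φ x * u x ^ 2 = ∫ x, -((φ' x * u x + φ x * f x) * v x) := by
      rw [integral_neg, ← ibp]; congr 1; ext x; ring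
    rw [e1, ← integral_const_mul, ← integral_const_mul, ← integral_const_mul,
      ← integral_add (iv.const_mul _) (iu.const_mul _),
      ← integral_add ((iv.const_mul _).fun_add (iu.const_mul _)) (iff.const_mul _)]
    refine integral_mono ((j3.add j2).neg.congr (ae_of_all _ fun x => ?_))
      (((iv.const_mul _).add (iu.const_mul _)).add (iff.const_mul _)) fun x => ?_
    · simp only [Pi.neg_apply, Pi.add_apply]; ring
    · simp only
      have a1 : -((φ' x * u x + φ x * f x) * v x) ≤ φ x * |v x| * |u x| + φ x * |v x| * |f x| := by
        refine (neg_le_abs _).trans ?_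
        rw [abs_mul]
        have : |φ' x * u x + φ x * f x| ≤ φ x * |u x| + φ x * |f x| := by
          refine (abs_add_le _ _).trans (add_le_add ?_ ?_)
          · rw [abs_mul]; exact mul_le_mul_of_nonneg_right (hφ'b x) (abs_nonneg _)
          · rw [abs_mul, abs_of_pos (hφ0 x)]
        nlinarith [mul_le_mul_of_nonneg_right this (abs_nonneg (v x))]
      have a2 : φ x * v x ^ 2 ≤ 2 * (w x * v x ^ 2) := by
        have : φ x ≤ 2 * w x := by
          simp only [hφ]
          rw [inv_le_iff_one_le_mul₀ (by positivity)]
          linarith [hw x]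
        nlinarith [sq_nonneg (v x)]
      have a3 : (φ x * |v x|) ^ 2 ≤ φ x * v x ^ 2 := by
        rw [mul_pow, sq_abs]
        nlinarith [sq_nonneg (v x), hφ0 x, hφ1 x, mul_nonneg (hφ0 x).le (sq_nonneg (v x))]
      rw [← sq_abs (u x), ← sq_abs (f x)]
      nlinarith [sq_nonneg (4 * (φ x * |v x|) - |u x|), sq_nonneg (4 * (φ x * |v x|) - |f x|)]
  have s2 : ∫ x, u x ^ 2 ≤ 2 * (∫ x, φ x * u x ^ 2) + 4 * ∫ x, w x * (x * u x) ^ 2 := by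
    rw [← integral_const_mul, ← integral_const_mul,
      ← integral_add (iφ.const_mul _) (iy.const_mul _)]
    refine integral_mono iu ((iφ.const_mul _).add (iy.const_mul _)) fun x => ?_
    simp only
    -- For `|x| ≥ 1` the bound `w (1 + x²) ≥ 1/2` gives `w x² ≥ 1/4`, so the dilation term controls
    -- `v'`.
    have a1 : 1 ≤ 2 * φ x + 4 * (w x * x ^ 2) := by
      rcases le_total (x ^ 2) 1 with hx | hx
      · have : 1 / 2 ≤ φ x := by
          simp only [hφ]
          rw [one_div]
          exact inv_anti₀ (by positivity) (by linarith)
        nlinarith [mul_nonneg (hw0 x).le (sq_nonneg x)]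
      · nlinarith [hw x, hw0 x, hφ0 x]
    nlinarith [sq_nonneg (u x)]
  have s3 := integral_second_sq_le h
  have s4 : 0 ≤ ∫ x, synth (mulA g) x ^ 2 := integral_nonneg fun x => sq_nonneg _
  linarith

/-- The a priori estimate. -/
theorem apriori_estimate {g : ℝ → ℂ} (h : IsSpectral g) {r : ℝ} (hr : |r - 1| ≤ 1 / 32) (N : ℕ)
    {ρ : ℝ → ℝ} (hρm : Measurable ρ) (hρ : ∀ x, |ρ x - 1| ≤ 1 / 10) {F : ℝ → ℝ}
    (hF : F = linOp (fun x => ρ x * modelWeight r N x) g) :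
    (∫ x, modelWeight r N x * synth g x ^ 2) +
      (∫ x, modelWeight r N x * (x * synth (mulD g) x) ^ 2) + (∫ x, synth (mulD g) x ^ 2) +
      (∫ x, synth (mulA g) x ^ 2) ≤
      10 ^ 8 * ((∫ x, F x ^ 2) + ∫ x, F x ^ 2 / modelWeight r N x) := by
  obtain ⟨m, M, hm, hmM⟩ := exists_modelWeight_bounds hr N
  have hrr := abs_le.mp hr
  have hw0 : ∀ x, 0 < modelWeight r N x := modelWeight_pos hr N
  have hwb : ∀ x, |modelWeight r N x| ≤ M := fun x => by
    rw [abs_of_pos (hw0 x)]; exact (hmM x).2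
  have hwm := measurable_modelWeight r N
  have h1 := energy_estimate h (hasDerivAt_modelWeight r N) hm (fun x => (hmM x).1)
    (fun x => (hmM x).2) (abs_mul_modelWeight'_le_half hr N) hρm hρ
  have h2 := integral_deriv_sq_le h hwm (half_le_modelWeight_mul hr N) (fun x => (hmM x).2)
  rw [← hF] at h1
  have hFm : MemLp F 2 volume := by
    rw [hF]
    refine memLp_linOp (M := 11 / 10 * M) h (hρm.mul hwm).aestronglyMeasurable (fun x => ?_)
    rw [abs_mul]
    have h1 : |ρ x| ≤ 11 / 10 := by
      have := abs_le.mp (hρ x); rw [abs_le]; constructor <;> linarith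
    exact mul_le_mul h1 (hwb x) (abs_nonneg _) (by norm_num)
  have iF : Integrable fun x => F x ^ 2 := (memLp_two_iff_integrable_sq hFm.1).mp hFm
  have iFw : Integrable fun x => F x ^ 2 / modelWeight r N x :=
    integrable_sq_div hFm hwm hm fun x => (hmM x).1
  have iv := integrable_bdd_mul_sq hwm.aestronglyMeasurable hwb h.memLp_synth
  have iy := integrable_bdd_mul_sq hwm.aestronglyMeasurable hwb h.memLp_dilation
  have p1 : 0 ≤ ∫ x, F x ^ 2 := integral_nonneg fun x => sq_nonneg _
  have p2 : 0 ≤ ∫ x, F x ^ 2 / modelWeight r N x :=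
    integral_nonneg fun x => div_nonneg (sq_nonneg _) (hw0 x).le
  have p3 : 0 ≤ ∫ x, modelWeight r N x * synth g x ^ 2 :=
    integral_nonneg fun x => mul_nonneg (hw0 x).le (sq_nonneg _)
  have p4 : 0 ≤ ∫ x, modelWeight r N x * (x * synth (mulD g) x) ^ 2 :=
    integral_nonneg fun x => mul_nonneg (hw0 x).le (sq_nonneg _)
  have h3 : ∫ x, synth (mulA g) x ^ 2 ≤
      10 ^ 7 * ((∫ x, F x ^ 2) + ∫ x, F x ^ 2 / modelWeight r N x) := by
    -- A growing weight is at least one, so the energy controls `v` in `L²` as the high frequency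
    -- estimate requires. A decaying weight is at most one, so the energy controls `W x v'` in `L²`
    -- and the equation yields `|D|³ v`.
    rcases le_total 1 r with h1r | h1r
    · have a := integral_mulA_sq_le_of_one_le h h1r (by linarith) N hρm hρ
      rw [← hF] at a
      have b : ∫ x, synth g x ^ 2 ≤ ∫ x, modelWeight r N x * synth g x ^ 2 :=
        integral_mono h.integrable_synth_sq iv fun x =>
          le_mul_of_one_le_left (sq_nonneg _) (one_le_modelWeight h1r N x)
      linarith
    · have a : ∫ x, synth (mulA g) x ^ 2 ≤
          2 * (∫ x, F x ^ 2) + ∫ x, modelWeight r N x * (x * synth (mulD g) x) ^ 2 := by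
        rw [← integral_const_mul, ← integral_add (iF.const_mul _) iy]
        refine integral_mono h.test_mulA.integrable_synth_sq ((iF.const_mul _).add iy) fun x => ?_
        have e : F x = -synth (mulA g) x +
            ρ x * modelWeight r N x * (x * synth (mulD g) x) / 3 := by rw [hF]; rfl
        have hw1 := modelWeight_le_one (by linarith) h1r N x
        simp only
        set w := modelWeight r N x
        set y := x * synth (mulD g) x
        rw [show synth (mulA g) x = ρ x * w * y / 3 - F x by linarith]
        have hwx : 0 < w := hw0 x
        have c1 : (ρ x * w * y) ^ 2 ≤ 2 * (w * y ^ 2) := by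
          have hρx := abs_le.mp (hρ x)
          have : (ρ x) ^ 2 ≤ 2 := by nlinarith
          have hw2 : w ^ 2 ≤ w := by nlinarith
          have : ρ x ^ 2 * w ^ 2 ≤ 2 * w := mul_le_mul this hw2 (sq_nonneg _) (by norm_num)
          nlinarith [sq_nonneg y]
        nlinarith [sq_nonneg (ρ x * w * y / 3 + F x)]
      linarith
  linarith

end SelfSimilar

namespace SelfSimilar

open Filter Topology
open scoped ComplexConjugate

/-! ### Density of the range -/

/-- The method of continuity, for densely defined operators. -/
theorem denseRange_of_continuity {D E : Type*} [AddCommGroup D] [Module ℝ D]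
    [NormedAddCommGroup E] [InnerProductSpace ℝ E] [CompleteSpace E] (L₀ B : D →ₗ[ℝ] E) (C : ℝ)
    (hC : ∀ t : ℝ, 0 ≤ t → t ≤ 1 → ∀ v, ‖B v‖ ≤ C * ‖L₀ v + t • B v‖)
    (h0 : (LinearMap.range L₀)ᗮ = ⊥) : (LinearMap.range (L₀ + B))ᗮ = ⊥ := by
  -- The parameter moves from `0` to `1` in `n` equal steps, each of relative size `C / n < 1`.
  obtain ⟨n, hn⟩ := exists_nat_gt (max C 1)
  have hn0 : (0 : ℝ) < n := lt_trans (by positivity) ((le_max_right C 1).trans_lt hn)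
  have hCn : C < n := (le_max_left C 1).trans_lt hn
  have step : ∀ k : ℕ, k ≤ n → (LinearMap.range (L₀ + ((k : ℝ) / n) • B))ᗮ = ⊥ := by
    intro k
    induction k with
    | zero => intro _; simpa using h0
    | succ k ih =>
      intro hk
      have ih' := ih (Nat.le_of_succ_le hk)
      rw [Submodule.eq_bot_iff]
      intro F hF
      by_contra hF0
      set t : ℝ := (k : ℝ) / n with ht
      have ht0 : 0 ≤ t := by positivity
      have ht1 : t ≤ 1 := by
        rw [ht, div_le_one hn0]; exact_mod_cast Nat.le_of_succ_le hk
      have hFv : ∀ v, inner ℝ (L₀ v + t • B v) F = -(1 / n) * inner ℝ (B v) F := by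
        intro v
        have h1 := (Submodule.mem_orthogonal _ F).mp hF _ (LinearMap.mem_range_self _ v)
        simp only [LinearMap.add_apply, LinearMap.smul_apply, inner_add_left,
          real_inner_smul_left] at h1 ⊢
        have : ((k + 1 : ℕ) : ℝ) / n = t + 1 / n := by rw [ht]; push_cast; ring
        rw [this] at h1
        linarith
      have hcl : F ∈ (LinearMap.range (L₀ + t • B)).topologicalClosure := by
        rw [Submodule.topologicalClosure_eq_top_iff.mpr ih']; trivial
      -- Orthogonality to the next range bounds the pairing with the current range by `C / n`. By
      -- density this extends to `z = F`, which gives `‖F‖² ≤ (C / n) ‖F‖²`.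
      have hbound : ∀ z ∈ (LinearMap.range (L₀ + t • B)).topologicalClosure,
          inner ℝ z F ≤ C / n * ‖z‖ * ‖F‖ := by
        intro z hz
        have hclosed : IsClosed {z : E | inner ℝ z F ≤ C / n * ‖z‖ * ‖F‖} :=
          isClosed_le (by fun_prop) (by fun_prop)
        refine closure_minimal ?_ hclosed hz
        rintro _ ⟨v, rfl⟩
        simp only [Set.mem_ofPred_eq, LinearMap.add_apply, LinearMap.smul_apply]
        rw [hFv v]
        have a := hC t ht0 ht1 v
        have b := abs_real_inner_le_norm (B v) F
        calc -(1 / (n : ℝ)) * inner ℝ (B v) F ≤ 1 / n * (‖B v‖ * ‖F‖) := by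
              rw [neg_mul, ← mul_neg]
              exact mul_le_mul_of_nonneg_left ((neg_le_abs _).trans b) (by positivity)
          _ ≤ 1 / n * (C * ‖L₀ v + t • B v‖ * ‖F‖) := by gcongr
          _ = _ := by ring
      have := hbound F hcl
      rw [real_inner_self_eq_norm_sq] at this
      have hpos : 0 < ‖F‖ := norm_pos_iff.mpr hF0
      have hlt : C / n < 1 := (div_lt_one hn0).mpr hCn
      nlinarith [mul_pos hpos hpos]
  have := step n le_rfl
  rwa [div_self hn0.ne', one_smul] at this

theorem synth_add {g₁ g₂ : ℝ → ℂ} (h₁ : IsHermTest g₁) (h₂ : IsHermTest g₂) (x : ℝ) :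
    synth (fun ξ => g₁ ξ + g₂ ξ) x = synth g₁ x + synth g₂ x := by
  have hi {g : ℝ → ℂ} (h : IsHermTest g) :
      Integrable fun ξ : ℝ => Complex.exp (2 * Real.pi * Complex.I * x * ξ) * g ξ := by
    have := h.smooth.continuous
    exact Continuous.integrable_of_hasCompactSupport (by fun_prop) h.compact.mul_left
  simp only [synth, fourierInv_real_eq, mul_add]
  rw [integral_add (hi h₁) (hi h₂), Complex.add_re]

theorem synth_smul (g : ℝ → ℂ) (c x : ℝ) : synth (fun ξ => (c : ℂ) * g ξ) x = c * synth g x := by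
  simp only [synth, fourierInv_real_eq]
  rw [← Complex.re_ofReal_mul, ← integral_const_mul]
  congr 2; ext ξ; ring

theorem mulA_add (g₁ g₂ : ℝ → ℂ) : mulA (g₁ + g₂) = fun ξ => mulA g₁ ξ + mulA g₂ ξ := by
  ext ξ; simp [mulA, mul_add]

theorem mulD_add (g₁ g₂ : ℝ → ℂ) : mulD (g₁ + g₂) = fun ξ => mulD g₁ ξ + mulD g₂ ξ := by
  ext ξ; simp [mulD, mul_add]

theorem mulA_smul (c : ℝ) (g : ℝ → ℂ) : mulA (c • g) = fun ξ => (c : ℂ) * mulA g ξ := by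
  ext ξ; simp [mulA]; ring

theorem mulD_smul (c : ℝ) (g : ℝ → ℂ) : mulD (c • g) = fun ξ => (c : ℂ) * mulD g ξ := by
  ext ξ; simp [mulD]; ring

/-- The space of frequency side test functions. -/
def spectralSpace : Submodule ℝ (ℝ → ℂ) where
  carrier := {g | IsSpectral g}
  add_mem' h₁ h₂ := h₁.add h₂
  zero_mem' := ⟨⟨contDiff_const, HasCompactSupport.zero, by simp⟩, by simp⟩
  smul_mem' c g hg := by
    have e : c • g = fun ξ => (c : ℂ) * g ξ := by ext ξ; simp
    rw [Set.mem_ofPred_eq, e]; exact hg.smul c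

theorem linOp_add (W : ℝ → ℝ) {g₁ g₂ : ℝ → ℂ} (h₁ : IsSpectral g₁) (h₂ : IsSpectral g₂) (x : ℝ) :
    linOp W (g₁ + g₂) x = linOp W g₁ x + linOp W g₂ x := by
  simp only [linOp, mulA_add, mulD_add]
  rw [synth_add h₁.test_mulA.toIsHermTest h₂.test_mulA.toIsHermTest,
    synth_add h₁.test_mulD.toIsHermTest h₂.test_mulD.toIsHermTest]
  ring

theorem linOp_smul (W : ℝ → ℝ) (c : ℝ) (g : ℝ → ℂ) (x : ℝ) :
    linOp W (c • g) x = c * linOp W g x := by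
  simp only [linOp, mulA_smul, mulD_smul, synth_smul]
  ring

/-- The linear operator as a map into `L²`. -/
noncomputable def linMap (W : ℝ → ℝ) {M : ℝ} (hW : Measurable W) (hb : ∀ x, |W x| ≤ M) :
    spectralSpace →ₗ[ℝ] Lp ℝ 2 (volume : Measure ℝ) where
  toFun g := (memLp_linOp g.2 hW.aestronglyMeasurable hb).toLp _
  map_add' g₁ g₂ := by
    rw [← MemLp.toLp_add]
    refine MemLp.toLp_congr _ _ (ae_of_all _ fun x => ?_)
    exact linOp_add W g₁.2 g₂.2 x
  map_smul' c g := by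
    rw [RingHom.id_apply, ← MemLp.toLp_const_smul]
    refine MemLp.toLp_congr _ _ (ae_of_all _ fun x => ?_)
    exact linOp_smul W c g x

theorem norm_toLp_sq {f : ℝ → ℝ} (hf : MemLp f 2 volume) :
    ‖hf.toLp f‖ ^ 2 = ∫ x, f x ^ 2 := by
  rw [← real_inner_self_eq_norm_sq, L2.inner_def]
  refine integral_congr_ae ?_
  filter_upwards [hf.coeFn_toLp] with x hx
  simp [hx, pow_two]

theorem inner_toLp {f g : ℝ → ℝ} (hf : MemLp f 2 volume) (hg : MemLp g 2 volume) :
    inner ℝ (hf.toLp f) (hg.toLp g) = ∫ x, f x * g x := by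
  rw [L2.inner_def]
  refine integral_congr_ae ?_
  filter_upwards [hf.coeFn_toLp, hg.coeFn_toLp] with x hx hx'
  simp [hx, hx', mul_comm]

/-- A primitive of a test function of vanishing mean is a test function. -/
theorem exists_primitive {q : ℝ → ℝ} (hq : ContDiff ℝ ∞ q) (hc : HasCompactSupport q)
    (h0 : ∫ x, q x = 0) : ∃ θ : ℝ → ℝ, ContDiff ℝ ∞ θ ∧ HasCompactSupport θ ∧
      (∀ x, HasDerivAt θ (q x) x) ∧ ∀ a, (∀ x < a, q x = 0) → ∀ x < a, θ x = 0 := by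
  have hi : Integrable q := hq.continuous.integrable_of_hasCompactSupport hc
  set θ : ℝ → ℝ := fun x => ∫ y in Set.Iic x, q y with hθ
  have hd : ∀ x, HasDerivAt θ (q x) x := fun x => by
    have e : θ = fun y => (∫ z in Set.Iic (0 : ℝ), q z) + ∫ z in (0 : ℝ)..y, q z := by
      ext y
      rw [← intervalIntegral.integral_Iic_sub_Iic hi.integrableOn hi.integrableOn]
      ring
    rw [e]
    exact (intervalIntegral.integral_hasDerivAt_right (hi.intervalIntegrable)
      (hq.continuous.stronglyMeasurableAtFilter _ _) hq.continuous.continuousAt).const_add _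
  have hz : ∀ a, (∀ x < a, q x = 0) → ∀ x < a, θ x = 0 := fun a ha x hx => by
    refine (setIntegral_congr_fun measurableSet_Iic fun y hy => ?_).trans (integral_zero _ _)
    exact ha y (lt_of_le_of_lt hy hx)
  refine ⟨θ, ?_, ?_, hd, hz⟩
  · rw [contDiff_infty_iff_deriv]
    refine ⟨fun x => (hd x).differentiableAt, ?_⟩
    rw [show deriv θ = q from funext fun x => (hd x).deriv]
    exact hq
  · obtain ⟨R, hR⟩ := hc.isCompact.isBounded.subset_closedBall 0
    have hq0 : ∀ x, R < |x| → q x = 0 := fun x hx => by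
      by_contra hne
      have := hR (subset_tsupport _ hne)
      rw [mem_closedBall_zero_iff, Real.norm_eq_abs] at this
      linarith
    refine HasCompactSupport.of_support_subset_isCompact (isCompact_Icc (a := -|R|) (b := |R|)) ?_
    intro x hx
    by_contra hxn
    refine hx ?_
    rw [Set.mem_Icc, not_and_or, not_le, not_le] at hxn
    rcases hxn with hxn | hxn
    · refine hz (-|R|) (fun y hy => hq0 y ?_) x hxn
      have : -y ≤ |y| := neg_le_abs y
      linarith [le_abs_self R]
    · have : θ x = (∫ y, q y) - ∫ y in Set.Ioi x, q y := by
        have := integral_add_compl (measurableSet_Iic (a := x)) hi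
        rw [Set.compl_Iic] at this
        simp only [hθ]; linarith
      rw [this, h0, zero_sub, neg_eq_zero]
      refine (setIntegral_congr_fun measurableSet_Ioi fun y hy => ?_).trans (integral_zero _ _)
      refine hq0 y ?_
      have h1 : x < y := hy
      linarith [le_abs_self y, le_abs_self R]

end SelfSimilar

/-! ### The unperturbed operator: an ordinary differential operator in frequency. -/

namespace SelfSimilar

open Filter Topology
open scoped ComplexConjugate

theorem memLp_coe {F : ℝ → ℝ} (hF : MemLp F 2 volume) : MemLp (fun x => (F x : ℂ)) 2 volume :=
  hF.ofReal

/-- Pairing of a square integrable function with a test function, on the frequency side. -/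
theorem integral_mul_synth {F : ℝ → ℝ} (hF : MemLp F 2 volume) {h : ℝ → ℂ} (hh : IsHermTest h) :
    ((∫ x, synth h x * F x : ℝ) : ℂ) =
      ∫ ξ, conj (h ξ) * (𝓕 ((memLp_coe hF).toLp _) : Lp ℂ 2 (volume : Measure ℝ)) ξ := by
  set Fc := (memLp_coe hF).toLp _ with hFc
  have h1 := Lp.inner_fourier_eq ((𝓕⁻ hh.schwartz).toLp 2) Fc
  rw [SchwartzMap.toLp_fourier_eq, FourierTransform.fourier_fourierInv_eq, L2.inner_def,
    L2.inner_def] at h1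
  have e1 : ∫ x, inner ℂ ((hh.schwartz.toLp 2 : Lp ℂ 2 (volume : Measure ℝ)) x)
      ((𝓕 Fc : Lp ℂ 2 (volume : Measure ℝ)) x) =
      ∫ ξ, conj (h ξ) * (𝓕 Fc : Lp ℂ 2 (volume : Measure ℝ)) ξ := by
    refine integral_congr_ae ?_
    filter_upwards [hh.schwartz.coeFn_toLp 2 volume] with x hx
    rw [hx, hh.coe_schwartz, RCLike.inner_apply, mul_comm]
  have e2 : ∫ x, inner ℂ (((𝓕⁻ hh.schwartz).toLp 2 : Lp ℂ 2 (volume : Measure ℝ)) x) (Fc x) =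
      ((∫ x, synth h x * F x : ℝ) : ℂ) := by
    rw [← integral_complex_ofReal]
    refine integral_congr_ae ?_
    filter_upwards [(𝓕⁻ hh.schwartz).coeFn_toLp 2 volume, (memLp_coe hF).coeFn_toLp] with x hx hx'
    rw [hx, hFc, hx', hh.fourierInv_schwartz, RCLike.inner_apply, Complex.conj_ofReal]
    push_cast; ring
  rw [e1, e2] at h1
  exact h1.symm

/-- The frequency side of the unperturbed operator `-|D|³ + x ∂ₓ / 3`. -/
noncomputable def freqOp (g : ℝ → ℂ) (ξ : ℝ) : ℂ :=
  -mulA g ξ + ((1 / 3 : ℝ) : ℂ) * opX (mulD g) ξ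

theorem IsSpectral.test_freqOp {g : ℝ → ℂ} (h : IsSpectral g) : IsSpectral (freqOp g) := by
  have h1 := h.test_mulA.smul (-1)
  have h2 := h.test_mulD.test_opX.smul (1 / 3)
  have e : freqOp g = fun ξ => (((-1 : ℝ) : ℂ) * mulA g ξ) + ((1 / 3 : ℝ) : ℂ) * opX (mulD g) ξ := by
    ext ξ; simp [freqOp]
  rw [e]
  exact h1.add h2

theorem synth_freqOp {g : ℝ → ℂ} (h : IsSpectral g) (x : ℝ) :
    synth (freqOp g) x = linOp (fun _ => 1) g x := by
  have h1 := h.test_mulA.smul (-1)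
  have h2 := h.test_mulD.test_opX.smul (1 / 3)
  have e : freqOp g = fun ξ => (((-1 : ℝ) : ℂ) * mulA g ξ) + ((1 / 3 : ℝ) : ℂ) * opX (mulD g) ξ := by
    ext ξ; simp [freqOp]
  rw [e, synth_add h1.toIsHermTest h2.toIsHermTest, synth_smul, synth_smul,
    h.test_mulD.synth_opX, linOp]
  ring

/-- In the unknown `ξ g` the operator is of first order; on the positive half-line its integrating
factor is `exp ((2π)³ ξ³)`. -/
theorem freqOp_eq {g : ℝ → ℂ} {ξ : ℝ} {z' : ℂ}
    (hz : HasDerivAt (fun y : ℝ => (y : ℂ) * g y) z' ξ) :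
    freqOp g ξ = -(((2 * Real.pi) ^ 3 * |ξ| ^ 3 : ℝ) * g ξ + z' / 3) := by
  have e : mulD g = fun y : ℝ => (2 * Real.pi * Complex.I) * ((y : ℂ) * g y) := by
    ext y; simp [mulD, symD]; ring
  have h1 : deriv (mulD g) ξ = (2 * Real.pi * Complex.I) * z' := by
    rw [e]; exact (hz.const_mul _).deriv
  have hp : (Real.pi : ℂ) ≠ 0 := by exact_mod_cast Real.pi_ne_zero
  rw [freqOp, opX, h1, mulA, symA, abs_mul, mul_pow,
    abs_of_pos (show 0 < 2 * Real.pi by positivity)]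
  push_cast
  field_simp
  linear_combination (z' : ℂ) * Complex.I_sq

/-- Explicit elements of the range of the unperturbed operator. -/
theorem exists_freqOp_eq {θ q : ℝ → ℝ} (hθ : ContDiff ℝ ∞ θ) (hc : HasCompactSupport θ)
    (hd : ∀ x, HasDerivAt θ (q x) x) {a : ℝ} (ha : 0 < a) (h0 : ∀ x < a, θ x = 0) (c : ℂ) :
    ∃ g, IsSpectral g ∧ ∀ ξ, freqOp g ξ =
      c * ((Real.exp (-((2 * Real.pi) ^ 3 * ξ ^ 3)) * q ξ : ℝ) : ℂ) +
      conj c * ((Real.exp (-((2 * Real.pi) ^ 3 * (-ξ) ^ 3)) * q (-ξ) : ℝ) : ℂ) := by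
  set κ := (2 * Real.pi) ^ 3 with hκ
  set z : ℝ → ℝ := fun ξ => Real.exp (-(κ * ξ ^ 3)) * θ ξ with hz
  set p : ℝ → ℝ := fun ξ => ξ⁻¹ * z ξ with hp
  have hz0 : ∀ x < a, z x = 0 := fun x hx => by simp [hz, h0 x hx]
  have hzs : ContDiff ℝ ∞ z := by
    refine ContDiff.mul ?_ hθ
    exact Real.contDiff_exp.comp (by fun_prop)
  have hps : ContDiff ℝ ∞ p := by
    rw [contDiff_iff_contDiffAt]
    intro ξ
    rcases eq_or_ne ξ 0 with rfl | hξ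
    · refine (contDiffAt_const (c := (0 : ℝ))).congr_of_eventuallyEq ?_
      filter_upwards [gt_mem_nhds ha] with y hy
      simp [hp, hz0 y hy]
    · exact (contDiffAt_inv ℝ hξ).mul hzs.contDiffAt
  have hpc : HasCompactSupport p := (hc.mul_left (f := fun ξ => Real.exp (-(κ * ξ ^ 3)))).mul_left
  have hmul : ∀ ξ, ξ * p ξ = z ξ := fun ξ => by
    rcases eq_or_ne ξ 0 with rfl | hξ
    · rw [zero_mul, hz0 0 ha]
    · simp only [hp]; field_simp
  have habs : ∀ ξ, |ξ| ^ 3 * p ξ = ξ ^ 2 * z ξ := fun ξ => by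
    rcases lt_or_ge ξ a with h | h
    · simp [hp, hz0 ξ h]
    · rw [abs_of_pos (ha.trans_le h), ← hmul]; ring
  have hzd : ∀ ξ, HasDerivAt z (Real.exp (-(κ * ξ ^ 3)) * q ξ - 3 * κ * ξ ^ 2 * z ξ) ξ := fun ξ => by
    have h1 : HasDerivAt (fun y : ℝ => -(κ * y ^ 3)) (-(κ * (3 * ξ ^ 2))) ξ := by
      simpa using! ((hasDerivAt_pow 3 ξ).const_mul κ).neg
    refine (h1.exp.mul (hd ξ)).congr_deriv ?_
    simp only [hz]; ring
  -- With `ξ p = exp (-κ ξ³) θ`, the operator sends `p` to `-(1/3) exp (-κ ξ³) θ'`, so `-3`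
  -- normalizes the result. The reflected conjugate term makes `g` Hermitian.
  set C : ℂ := -3 * c with hC
  set g : ℝ → ℂ := fun ξ => C * (p ξ : ℂ) + conj C * (p (-ξ) : ℂ) with hg
  have hgs : IsSpectral g := by
    refine ⟨⟨?_, ?_, ?_⟩, ?_⟩
    · refine (contDiff_const.mul (Complex.ofRealCLM.contDiff.comp hps)).add
        (contDiff_const.mul (Complex.ofRealCLM.contDiff.comp (hps.comp contDiff_neg)))
    · have h1 : HasCompactSupport fun ξ => (p ξ : ℂ) := hpc.comp_left Complex.ofReal_zero
      have h2 : HasCompactSupport fun ξ => (p (-ξ) : ℂ) := by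
        simpa using! h1.comp_homeomorph (Homeomorph.neg ℝ)
      exact h1.mul_left.add h2.mul_left
    · intro ξ; simp only [hg, neg_neg, map_add, map_mul, Complex.conj_conj, Complex.conj_ofReal]
      ring
    · filter_upwards [Metric.ball_mem_nhds (0 : ℝ) ha] with ξ hξ
      rw [Metric.mem_ball, dist_zero_right, Real.norm_eq_abs, abs_lt] at hξ
      simp [hg, hp, hz0 ξ hξ.2, hz0 (-ξ) (by linarith)]
  refine ⟨g, hgs, fun ξ => ?_⟩
  have hder : HasDerivAt (fun y : ℝ => (y : ℂ) * g y)
      (C * ((Real.exp (-(κ * ξ ^ 3)) * q ξ - 3 * κ * ξ ^ 2 * z ξ : ℝ) : ℂ) +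
        conj C * ((Real.exp (-(κ * (-ξ) ^ 3)) * q (-ξ) - 3 * κ * (-ξ) ^ 2 * z (-ξ) : ℝ) : ℂ)) ξ := by
    have e : (fun y : ℝ => (y : ℂ) * g y) = fun y => C * (z y : ℂ) - conj C * (z (-y) : ℂ) := by
      ext y
      rw [← hmul y, ← hmul (-y)]
      simp only [hg]; push_cast; ring
    rw [e]
    have h2 : HasDerivAt (fun y => z (-y))
        (-(Real.exp (-(κ * (-ξ) ^ 3)) * q (-ξ) - 3 * κ * (-ξ) ^ 2 * z (-ξ))) ξ := by
      have := (hzd (-ξ)).scomp ξ (hasDerivAt_neg ξ)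
      simpa using! this
    refine (((hzd ξ).ofReal_comp.const_mul C).sub (h2.ofReal_comp.const_mul (conj C))).congr_deriv ?_
    push_cast; ring
  rw [freqOp_eq hder]
  have e1 : ((κ * |ξ| ^ 3 : ℝ) : ℂ) * g ξ =
      C * ((κ * (ξ ^ 2 * z ξ) : ℝ) : ℂ) + conj C * ((κ * (ξ ^ 2 * z (-ξ)) : ℝ) : ℂ) := by
    have a1 := habs ξ
    have a2 := habs (-ξ)
    rw [abs_neg, neg_sq] at a2
    rw [← a1, ← a2]
    simp only [hg]; push_cast; ring
  rw [e1, hC]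
  simp only [map_mul, map_neg, map_ofNat]
  push_cast
  ring

theorem integrable_mul_of_test {ψ : ℝ → ℝ} (h1 : Continuous ψ) (h2 : HasCompactSupport ψ)
    {Φ : ℝ → ℂ} (hΦ : MemLp Φ 2 volume) : Integrable fun ξ => (ψ ξ : ℂ) * Φ ξ :=
  ((h1.memLp_of_hasCompactSupport h2 (p := 2) (μ := volume)).ofReal).integrable_mul hΦ

/-- A square integrable function orthogonal to the range of the unperturbed operator. -/
theorem integral_freqOp_test_eq_zero {Φ : ℝ → ℂ} (hΦ : MemLp Φ 2 volume)
    (hort : ∀ g, IsSpectral g → ∫ ξ, conj (freqOp g ξ) * Φ ξ = 0) {q : ℝ → ℝ}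
    (hq : ContDiff ℝ ∞ q) (hc : HasCompactSupport q) (hm : ∫ x, q x = 0) {a : ℝ} (ha : 0 < a)
    (h0 : ∀ x < a, q x = 0) :
    ∫ ξ, ((Real.exp (-((2 * Real.pi) ^ 3 * ξ ^ 3)) * q ξ : ℝ) : ℂ) * Φ ξ = 0 ∧
    ∫ ξ, ((Real.exp (-((2 * Real.pi) ^ 3 * ξ ^ 3)) * q ξ : ℝ) : ℂ) * Φ (-ξ) = 0 := by
  obtain ⟨θ, h1, h2, h3, h4⟩ := exists_primitive hq hc hm
  set P : ℝ → ℝ := fun ξ => Real.exp (-((2 * Real.pi) ^ 3 * ξ ^ 3)) * q ξ with hP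
  have hPc : Continuous P := by have := hq.continuous; fun_prop
  have hPs : HasCompactSupport P := hc.mul_left
  have hΦ' : MemLp (fun ξ => Φ (-ξ)) 2 volume :=
    hΦ.comp_measurePreserving (Measure.measurePreserving_neg volume)
  have i1 := integrable_mul_of_test hPc hPs hΦ
  have i2 := integrable_mul_of_test hPc hPs hΦ'
  have i3 : Integrable fun ξ => (P (-ξ) : ℂ) * Φ ξ := by simpa using i2.comp_neg
  have key : ∀ c : ℂ, conj c * (∫ ξ, (P ξ : ℂ) * Φ ξ) + c * ∫ ξ, (P ξ : ℂ) * Φ (-ξ) = 0 := by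
    intro c
    obtain ⟨g, hg, hgf⟩ := exists_freqOp_eq h1 h2 h3 ha (h4 a h0) c
    have := hort g hg
    simp only [hgf, map_add, map_mul, Complex.conj_conj, Complex.conj_ofReal] at this
    rw [← this]
    have e1 : ∫ ξ, (P ξ : ℂ) * Φ (-ξ) = ∫ ξ, (P (-ξ) : ℂ) * Φ ξ := by
      rw [← integral_neg_eq_self]; simp
    rw [e1, ← integral_const_mul, ← integral_const_mul,
      ← integral_add (i1.const_mul _) (i3.const_mul _)]
    congr 1; ext ξ; simp only [hP]; ring
  -- The orthogonality is real linear in `c`; the values `1` and `i` separate the two half-lines.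
  have k1 := key 1
  have k2 := key Complex.I
  simp only [map_one, one_mul, Complex.conj_I] at k1 k2
  have hI := Complex.I_ne_zero
  have k3 : -(∫ ξ, (P ξ : ℂ) * Φ ξ) + ∫ ξ, (P ξ : ℂ) * Φ (-ξ) = 0 := by
    have : Complex.I * (-(∫ ξ, (P ξ : ℂ) * Φ ξ) + ∫ ξ, (P ξ : ℂ) * Φ (-ξ)) = 0 := by
      rw [← k2]; ring
    exact (mul_eq_zero.mp this).resolve_left hI
  constructor
  · linear_combination (1 / 2) * k1 - (1 / 2) * k3
  · linear_combination (1 / 2) * k1 + (1 / 2) * k3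

theorem memLp_inv_one_add_sq : MemLp (fun ξ : ℝ => (1 + ξ ^ 2)⁻¹) 2 volume := by
  rw [memLp_two_iff_integrable_sq (Measurable.aestronglyMeasurable (by fun_prop))]
  refine integrable_inv_one_add_sq.mono' (Measurable.aestronglyMeasurable (by fun_prop))
    (ae_of_all _ fun ξ => ?_)
  have h1 : (0 : ℝ) < (1 + ξ ^ 2)⁻¹ := by positivity
  have h2 : (1 + ξ ^ 2)⁻¹ ≤ 1 := inv_le_one_of_one_le₀ (by nlinarith [sq_nonneg ξ])
  rw [Real.norm_of_nonneg (by positivity)]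
  nlinarith

/-- Provides a square integrable majorant for the translated bumps in `tendsto_integral_unitBump`.
-/
theorem exp_neg_cube_le {ξ : ℝ} (hξ : 0 ≤ ξ) :
    Real.exp (-((2 * Real.pi) ^ 3 * ξ ^ 3)) ≤ 2 * (1 + ξ ^ 2)⁻¹ := by
  have hκ : 1 ≤ (2 * Real.pi) ^ 3 := one_le_pow₀ (by linarith [Real.pi_gt_three])
  have h1 := Real.add_one_le_exp ((2 * Real.pi) ^ 3 * ξ ^ 3)
  have h3 : 0 ≤ ξ ^ 3 := by positivity
  have h2 : (1 + ξ ^ 2) / 2 ≤ Real.exp ((2 * Real.pi) ^ 3 * ξ ^ 3) := by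
    have : (1 + ξ ^ 2) / 2 ≤ 1 + ξ ^ 3 := by
      rcases le_total ξ 1 with h | h
      · nlinarith
      · nlinarith [sq_nonneg ξ]
    nlinarith
  rw [Real.exp_neg, show 2 * (1 + ξ ^ 2)⁻¹ = ((1 + ξ ^ 2) / 2)⁻¹ by rw [inv_div]; rfl]
  exact inv_anti₀ (by positivity) h2

/-- A bump function of unit mass located around `k + 1`. -/
noncomputable def unitBump (k : ℕ) (ξ : ℝ) : ℝ :=
  (⟨1 / 4, 1 / 2, by norm_num, by norm_num⟩ : ContDiffBump (0 : ℝ)).normed volume (ξ - (k + 1))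

theorem contDiff_unitBump (k : ℕ) : ContDiff ℝ ∞ (unitBump k) :=
  (ContDiffBump.contDiff_normed _).comp (by fun_prop)

theorem unitBump_eq_zero {k : ℕ} {ξ : ℝ} (h : 1 / 2 ≤ |ξ - (k + 1)|) : unitBump k ξ = 0 := by
  unfold unitBump
  rw [← Function.notMem_support, ContDiffBump.support_normed_eq, Metric.mem_ball, dist_zero_right,
    Real.norm_eq_abs, not_lt]
  exact h

theorem hasCompactSupport_unitBump (k : ℕ) : HasCompactSupport (unitBump k) := by
  refine HasCompactSupport.of_support_subset_isCompact
    (isCompact_Icc (a := (k : ℝ) + 1 / 2) (b := k + 3 / 2)) fun ξ hξ => ?_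
  by_contra hc
  refine hξ (unitBump_eq_zero ?_)
  rw [Set.mem_Icc, not_and_or, not_le, not_le] at hc
  rw [le_abs]
  rcases hc with hc | hc
  · right; linarith
  · left; linarith

theorem integral_unitBump (k : ℕ) : ∫ ξ, unitBump k ξ = 1 := by
  unfold unitBump
  rw [integral_sub_right_eq_self (fun ξ => ContDiffBump.normed _ volume ξ)]
  exact ContDiffBump.integral_normed _

theorem exists_unitBump_bound : ∃ B : ℝ, ∀ k ξ, |unitBump k ξ| ≤ B := by
  obtain ⟨B, hB⟩ := (contDiff_unitBump 0).continuous.bounded_above_of_compact_support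
    (hasCompactSupport_unitBump 0)
  refine ⟨B, fun k ξ => ?_⟩
  have := hB (ξ - k)
  rw [Real.norm_eq_abs] at this
  convert this using 2
  simp only [unitBump]
  congr 1
  push_cast; ring

/-- The bumps have bounded height and escape to infinity, where the integrating factor decays. The
missing mean of a test function can therefore be placed far away at vanishing cost. -/
theorem tendsto_integral_unitBump {Φ : ℝ → ℂ} (hΦ : MemLp Φ 2 volume) :
    Tendsto (fun k : ℕ => ∫ ξ, ((Real.exp (-((2 * Real.pi) ^ 3 * ξ ^ 3)) * unitBump k ξ : ℝ) : ℂ)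
      * Φ ξ) atTop (𝓝 0) := by
  obtain ⟨B, hB⟩ := exists_unitBump_bound
  have hB0 : 0 ≤ B := (abs_nonneg _).trans (hB 0 0)
  have hint : Integrable fun ξ => B * 2 * ((1 + ξ ^ 2)⁻¹ * ‖Φ ξ‖) :=
    (memLp_inv_one_add_sq.integrable_mul hΦ.norm).const_mul _
  have := tendsto_integral_of_dominated_convergence
    (F := fun (k : ℕ) ξ => ((Real.exp (-((2 * Real.pi) ^ 3 * ξ ^ 3)) * unitBump k ξ : ℝ) : ℂ) * Φ ξ)
    (f := fun _ => 0) _ (fun k => ?_) hint (fun k => ae_of_all _ fun ξ => ?_)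
    (ae_of_all _ fun ξ => ?_)
  · simpa using this
  · have h1 : Continuous fun ξ =>
        ((Real.exp (-((2 * Real.pi) ^ 3 * ξ ^ 3)) * unitBump k ξ : ℝ) : ℂ) := by
      have := (contDiff_unitBump k).continuous
      fun_prop
    exact h1.aestronglyMeasurable.mul hΦ.1
  · rw [norm_mul, Complex.norm_real, norm_mul, Real.norm_of_nonneg (Real.exp_pos _).le,
      Real.norm_eq_abs]
    rcases lt_or_ge ξ 0 with h | h
    · rw [unitBump_eq_zero, abs_zero, mul_zero, zero_mul]
      · positivity
      · rw [le_abs]; right; have : (0 : ℝ) ≤ k := k.cast_nonneg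
        linarith
    · calc Real.exp (-((2 * Real.pi) ^ 3 * ξ ^ 3)) * |unitBump k ξ| * ‖Φ ξ‖
          ≤ 2 * (1 + ξ ^ 2)⁻¹ * B * ‖Φ ξ‖ := by
            gcongr
            · exact exp_neg_cube_le h
            · exact hB k ξ
        _ = _ := by ring
  · refine tendsto_const_nhds.congr' ?_
    obtain ⟨n, hn⟩ := exists_nat_gt ξ
    filter_upwards [eventually_ge_atTop n] with k hk
    rw [unitBump_eq_zero]
    · simp
    · rw [le_abs]; right
      have : (n : ℝ) ≤ k := by exact_mod_cast hk
      linarith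

/-- Orthogonality to mean-zero densities only says that `Φ` is a multiple of `exp (κ ξ³)` on each
half-line. Correcting the mean by a bump sent to infinity uses `Φ ∈ L²` to exclude a nonzero
multiple. -/
theorem integral_halfLine_test_eq_zero {Φ : ℝ → ℂ} (hΦ : MemLp Φ 2 volume)
    (hort : ∀ g, IsSpectral g → ∫ ξ, conj (freqOp g ξ) * Φ ξ = 0) {ψ : ℝ → ℝ}
    (hψ : ContDiff ℝ ∞ ψ) (hc : HasCompactSupport ψ) (hs : tsupport ψ ⊆ Set.Ioi 0) :
    ∫ ξ, (ψ ξ : ℂ) * Φ ξ = 0 ∧ ∫ ξ, (ψ ξ : ℂ) * Φ (-ξ) = 0 := by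
  obtain ⟨a, ha, ha'⟩ : ∃ a : ℝ, 0 < a ∧ ∀ x < a, ψ x = 0 := by
    rcases (tsupport ψ).eq_empty_or_nonempty with h | h
    · refine ⟨1, one_pos, fun x _ => image_eq_zero_of_notMem_tsupport (by simp [h])⟩
    · obtain ⟨b, hb⟩ := hc.isCompact.exists_isLeast h
      exact ⟨b, hs hb.1, fun x hx => image_eq_zero_of_notMem_tsupport
        fun hm => absurd (hb.2 hm) (not_le.mpr hx)⟩
  set e : ℝ → ℝ := fun ξ => Real.exp ((2 * Real.pi) ^ 3 * ξ ^ 3) with he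
  have hes : ContDiff ℝ ∞ e := Real.contDiff_exp.comp (by fun_prop)
  set m := ∫ ξ, e ξ * ψ ξ with hm
  set q : ℕ → ℝ → ℝ := fun k ξ => e ξ * ψ ξ - m * unitBump k ξ with hq
  have hΦ' : MemLp (fun ξ => Φ (-ξ)) 2 volume :=
    hΦ.comp_measurePreserving (Measure.measurePreserving_neg volume)
  have hqs (k : ℕ) : ContDiff ℝ ∞ (q k) :=
    (hes.mul hψ).sub (contDiff_const.mul (contDiff_unitBump k))
  have hqc (k : ℕ) : HasCompactSupport (q k) :=
    hc.mul_left.sub (hasCompactSupport_unitBump k).mul_left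
  have hqi (k : ℕ) : ∫ ξ, q k ξ = 0 := by
    have i1 : Integrable fun ξ => e ξ * ψ ξ :=
      (hes.mul hψ).continuous.integrable_of_hasCompactSupport hc.mul_left
    have i2 : Integrable fun ξ => unitBump k ξ :=
      (contDiff_unitBump k).continuous.integrable_of_hasCompactSupport
        (hasCompactSupport_unitBump k)
    simp only [hq]
    rw [integral_sub i1 (i2.const_mul _), integral_const_mul, integral_unitBump]
    simp [hm]
  have hq0 (k : ℕ) : ∀ x < min a (1 / 2), q k x = 0 := fun x hx => by
    simp only [hq]
    rw [ha' x (hx.trans_le (min_le_left _ _)), unitBump_eq_zero]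
    · simp
    · rw [le_abs]; right
      have : (0 : ℝ) ≤ k := k.cast_nonneg
      linarith [hx.trans_le (min_le_right a (1 / 2))]
  have hid (k : ℕ) (ξ : ℝ) : ((Real.exp (-((2 * Real.pi) ^ 3 * ξ ^ 3)) * q k ξ : ℝ) : ℂ) =
      (ψ ξ : ℂ) - m * ((Real.exp (-((2 * Real.pi) ^ 3 * ξ ^ 3)) * unitBump k ξ : ℝ) : ℂ) := by
    have : Real.exp (-((2 * Real.pi) ^ 3 * ξ ^ 3)) * e ξ = 1 := by
      simp only [he]; rw [← Real.exp_add]; simp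
    rw [← Complex.ofReal_mul, ← Complex.ofReal_sub]
    congr 1
    simp only [hq]
    linear_combination (ψ ξ) * this
  have conclude {Ψ : ℝ → ℂ} (hΨ : MemLp Ψ 2 volume) (hz : ∀ k,
      ∫ ξ, ((Real.exp (-((2 * Real.pi) ^ 3 * ξ ^ 3)) * q k ξ : ℝ) : ℂ) * Ψ ξ = 0) :
      ∫ ξ, (ψ ξ : ℂ) * Ψ ξ = 0 := by
    have hk (k : ℕ) : ∫ ξ, (ψ ξ : ℂ) * Ψ ξ = m * ∫ ξ,
        ((Real.exp (-((2 * Real.pi) ^ 3 * ξ ^ 3)) * unitBump k ξ : ℝ) : ℂ) * Ψ ξ := by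
      have h1 := hz k
      have i1 := integrable_mul_of_test hψ.continuous hc hΨ
      have i2 := integrable_mul_of_test (ψ := fun ξ =>
        Real.exp (-((2 * Real.pi) ^ 3 * ξ ^ 3)) * unitBump k ξ)
        (by have := (contDiff_unitBump k).continuous; fun_prop)
        (hasCompactSupport_unitBump k).mul_left hΨ
      simp only [hid, sub_mul, mul_assoc] at h1
      rw [integral_sub i1 (i2.const_mul _), integral_const_mul] at h1
      exact sub_eq_zero.mp h1
    have lim := (tendsto_integral_unitBump hΨ).const_mul (m : ℂ)
    rw [mul_zero] at lim
    exact tendsto_nhds_unique (tendsto_const_nhds.congr hk) lim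
  have hmin : 0 < min a (1 / 2) := lt_min ha (by norm_num)
  exact ⟨conclude hΦ fun k =>
      (integral_freqOp_test_eq_zero hΦ hort (hqs k) (hqc k) (hqi k) hmin (hq0 k)).1,
    conclude hΦ' fun k =>
      (integral_freqOp_test_eq_zero hΦ hort (hqs k) (hqc k) (hqi k) hmin (hq0 k)).2⟩

theorem ae_eq_zero_of_orthogonal {Φ : ℝ → ℂ} (hΦ : MemLp Φ 2 volume)
    (hort : ∀ g, IsSpectral g → ∫ ξ, conj (freqOp g ξ) * Φ ξ = 0) : Φ =ᵐ[volume] 0 := by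
  have hΦ' : MemLp (fun ξ => Φ (-ξ)) 2 volume :=
    hΦ.comp_measurePreserving (Measure.measurePreserving_neg volume)
  have h1 : ∀ᵐ ξ ∂volume, ξ ∈ Set.Ioi (0 : ℝ) → Φ ξ = 0 :=
    isOpen_Ioi.ae_eq_zero_of_integral_contDiff_smul_eq_zero
      ((hΦ.locallyIntegrable (by norm_num)).locallyIntegrableOn _) fun ψ hψ hc hs => by
        simpa using (integral_halfLine_test_eq_zero hΦ hort hψ hc hs).1
  have h2 : ∀ᵐ ξ ∂volume, ξ ∈ Set.Ioi (0 : ℝ) → Φ (-ξ) = 0 :=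
    isOpen_Ioi.ae_eq_zero_of_integral_contDiff_smul_eq_zero
      ((hΦ'.locallyIntegrable (by norm_num)).locallyIntegrableOn _) fun ψ hψ hc hs => by
        simpa using (integral_halfLine_test_eq_zero hΦ hort hψ hc hs).2
  have h3 : ∀ᵐ ξ ∂volume, -ξ ∈ Set.Ioi (0 : ℝ) → Φ (- -ξ) = 0 :=
    (Measure.measurePreserving_neg (volume : Measure ℝ)).quasiMeasurePreserving.ae h2
  have h4 : ∀ᵐ ξ ∂(volume : Measure ℝ), ξ ≠ 0 := by
    simp [ae_iff, measure_singleton]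
  filter_upwards [h1, h3, h4] with ξ a b c
  rcases lt_or_gt_of_ne c with h | h
  · simpa using b (by simpa using h)
  · exact a h

end SelfSimilar

/-! ### Density of the range for the truncated coefficients. -/

namespace SelfSimilar
open Filter Topology
open scoped ComplexConjugate

theorem linMap_apply {W : ℝ → ℝ} {M : ℝ} (hW : Measurable W) (hb : ∀ x, |W x| ≤ M)
    (g : spectralSpace) :
    linMap W hW hb g = (memLp_linOp g.2 hW.aestronglyMeasurable hb).toLp (linOp W g) := rfl

theorem orthogonal_range_linMap_one (hb : ∀ _ : ℝ, |(1 : ℝ)| ≤ 1) :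
    (LinearMap.range (linMap (fun _ => (1 : ℝ)) measurable_const hb))ᗮ = ⊥ := by
  rw [Submodule.eq_bot_iff]
  intro F hF
  have hFm := Lp.memLp F
  set Fc : Lp ℂ 2 (volume : Measure ℝ) := (memLp_coe hFm).toLp _ with hFc
  have hΦ : (𝓕 Fc : Lp ℂ 2 (volume : Measure ℝ)) =ᵐ[volume] 0 := by
    refine ae_eq_zero_of_orthogonal (Lp.memLp _) fun g hg => ?_
    rw [← integral_mul_synth hFm hg.test_freqOp.toIsHermTest]
    have h1 := (Submodule.mem_orthogonal _ _).1 hF _ ⟨⟨g, hg⟩, rfl⟩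
    rw [linMap_apply, ← Lp.toLp_coeFn F hFm, inner_toLp] at h1
    have h2 : ∫ x, synth (freqOp g) x * F x = 0 := by
      rw [← h1]
      refine integral_congr_ae (ae_of_all _ fun x => ?_)
      simp only [synth_freqOp hg]
    rw [h2, Complex.ofReal_zero]
  have h0 : Fc = 0 := by
    rw [← norm_eq_zero, ← Lp.norm_fourier_eq, norm_eq_zero]
    exact (Lp.eq_zero_iff_ae_eq_zero).2 hΦ
  rw [Lp.eq_zero_iff_ae_eq_zero]
  filter_upwards [(memLp_coe hFm).coeFn_toLp, (Lp.eq_zero_iff_ae_eq_zero).1 h0] with x h1 h2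
  rw [← hFc, h2] at h1
  simpa using h1.symm

/-- The method of continuity along `1 + t (W - 1)`: the perturbation involves only `x v'`, which the
energy estimate controls. The constants may depend on `N`, since only density is wanted. -/
theorem orthogonal_range_linMap {r : ℝ} (hr : |r - 1| ≤ 1 / 32) (N : ℕ)
    {ρ : ℝ → ℝ} (hρm : Measurable ρ) (hρ : ∀ x, |ρ x - 1| ≤ 1 / 10) {M : ℝ}
    (hb : ∀ x, |ρ x * modelWeight r N x| ≤ M) :
    (LinearMap.range (linMap (fun x => ρ x * modelWeight r N x)
      (hρm.mul (measurable_modelWeight r N)) hb))ᗮ = ⊥ := by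
  obtain ⟨m₀, M₀, hm₀, hbd⟩ := exists_modelWeight_bounds hr N
  have hb1 : ∀ _ : ℝ, |(1 : ℝ)| ≤ 1 := fun _ => by simp
  set W : ℝ → ℝ := fun x => ρ x * modelWeight r N x with hWd
  have hWm : Measurable W := hρm.mul (measurable_modelWeight r N)
  set L₀ := linMap (fun _ => (1 : ℝ)) measurable_const hb1 with hL₀
  set L₁ := linMap W hWm hb with hL₁
  have hM0 : 0 ≤ M := (abs_nonneg _).trans (hb 0)
  -- A lower bound for all the interpolated weights `1 + t (w - 1)` with `0 ≤ t ≤ 1`.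
  set m := min m₀ 1 with hmd
  have hm : 0 < m := lt_min hm₀ one_pos
  -- The energy estimate gives `m² ‖x v'‖² ≤ 300 ‖L_t v‖²`, and `300 ≤ 20²`.
  have key := denseRange_of_continuity L₀ (L₁ - L₀) (20 * (M + 1) / m) ?_
    (orthogonal_range_linMap_one hb1)
  · rwa [add_sub_cancel] at key
  intro t ht0 ht1 v
  obtain ⟨g, hg⟩ := v
  have hg' : IsSpectral g := hg
  set wt : ℝ → ℝ := fun x => 1 + t * (modelWeight r N x - 1) with hwt
  have hwm : ∀ x, m ≤ wt x := fun x => by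
    have h1 : m ≤ modelWeight r N x := (min_le_left _ _).trans (hbd x).1
    have h2 : m ≤ 1 := min_le_right _ _
    simp only [hwt]; nlinarith
  have hwpos : ∀ x, 0 < wt x := fun x => hm.trans_le (hwm x)
  have hwM : ∀ x, wt x ≤ max M₀ 1 := fun x => by
    have h1 : modelWeight r N x ≤ max M₀ 1 := (hbd x).2.trans (le_max_left _ _)
    have h2 : 1 ≤ max M₀ 1 := le_max_right _ _
    simp only [hwt]; nlinarith
  have hwd : ∀ x, HasDerivAt wt (t * modelWeight' r N x) x := fun x =>
    (((hasDerivAt_modelWeight r N x).sub_const 1).const_mul t).const_add 1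
  set Wt : ℝ → ℝ := fun x => 1 + t * (W x - 1) with hWt
  have hWtm : Measurable Wt := ((hWm.sub_const 1).const_mul t).const_add 1
  have hwtm : Measurable wt := (((measurable_modelWeight r N).sub_const 1).const_mul t).const_add 1
  -- Slow variation and closeness of the coefficient to the weight both survive the interpolation
  -- with the constant `1`.
  have hE := energy_estimate hg' (ρ := fun x => Wt x / wt x) hwd hm hwm hwM (fun x => by
      have h1 := abs_mul_modelWeight'_le_half hr N x
      have h2 : x * (t * modelWeight' r N x) = t * (x * modelWeight' r N x) := by ring
      rw [h2, abs_mul, abs_of_nonneg ht0]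
      have h3 : t * |x * modelWeight' r N x| ≤ t * (modelWeight r N x / 2) := by gcongr
      simp only [hwt]; linarith) (hWtm.div hwtm) (fun x => by
      have h1 : Wt x / wt x - 1 = t * (ρ x - 1) * modelWeight r N x / wt x := by
        have := (hwpos x).ne'
        field_simp
        simp only [hWt, hwt, hWd]; ring
      have h2 := (hm₀.trans_le (hbd x).1)
      rw [h1, abs_div, abs_mul, abs_mul, abs_of_nonneg ht0, abs_of_pos h2, abs_of_pos (hwpos x),
        div_le_iff₀ (hwpos x)]
      have h3 := hρ x
      have h4 : |ρ x - 1| * modelWeight r N x ≤ 1 / 10 * modelWeight r N x := by gcongr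
      have h5 : t * (|ρ x - 1| * modelWeight r N x) ≤ t * (1 / 10 * modelWeight r N x) := by gcongr
      simp only [hwt]; nlinarith)
  have hWe : (fun x => Wt x / wt x * wt x) = Wt := by
    ext x; rw [div_mul_cancel₀ _ (hwpos x).ne']
  rw [hWe] at hE
  have hWtb : ∀ x, |Wt x| ≤ M + 1 := fun x => by
    have h1 : Wt x = (1 - t) + t * W x := by simp only [hWt]; ring
    have h2 : t * |W x| ≤ 1 * M := by
      have := hb x
      gcongr
    rw [h1]
    refine (abs_add_le _ _).trans ?_
    rw [abs_mul, abs_of_nonneg ht0, abs_of_nonneg (by linarith : 0 ≤ 1 - t)]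
    linarith
  have hLt := memLp_linOp hg' hWtm.aestronglyMeasurable hWtb
  have hd := hg'.memLp_dilation
  have hLteq : L₀ ⟨g, hg⟩ + t • (L₁ - L₀) ⟨g, hg⟩ = hLt.toLp _ := by
    rw [LinearMap.sub_apply, hL₀, hL₁, linMap_apply, linMap_apply, ← MemLp.toLp_sub,
      ← MemLp.toLp_const_smul, ← MemLp.toLp_add]
    refine MemLp.toLp_congr _ _ (ae_of_all _ fun x => ?_)
    simp only [Pi.add_apply, Pi.smul_apply, Pi.sub_apply, linOp, smul_eq_mul, hWt]
    ring
  have hBm : MemLp (fun x => (W x - 1) / 3 * (x * synth (mulD g) x)) 2 volume :=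
    memLp_bdd_mul (M := M + 1) ((hWm.sub_const 1).div_const 3).aestronglyMeasurable (fun x => by
      have h1 : |W x - 1| ≤ |W x| + 1 := by simpa using abs_sub (W x) 1
      have := hb x
      rw [abs_div, abs_of_pos (by norm_num : (0:ℝ) < 3)]
      change |W x| ≤ M at this
      linarith [abs_nonneg (W x - 1)]) hd
  have hBeq : (L₁ - L₀) ⟨g, hg⟩ = hBm.toLp _ := by
    rw [LinearMap.sub_apply, hL₀, hL₁, linMap_apply, linMap_apply, ← MemLp.toLp_sub]
    refine MemLp.toLp_congr _ _ (ae_of_all _ fun x => ?_)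
    simp only [Pi.sub_apply, linOp]
    ring
  rw [hLteq, hBeq]
  refine abs_le_of_sq_le_sq' ?_ (by positivity) |>.2
  rw [mul_pow, norm_toLp_sq, norm_toLp_sq]
  have hi1 : Integrable fun x => linOp Wt g x ^ 2 := hLt.integrable_sq
  have hi2 : Integrable fun x => (x * synth (mulD g) x) ^ 2 := hd.integrable_sq
  have hvn : 0 ≤ ∫ x, wt x * synth g x ^ 2 :=
    integral_nonneg fun x => mul_nonneg (hwpos x).le (sq_nonneg _)
  have s1 : ∫ x, linOp Wt g x ^ 2 / wt x ≤ (∫ x, linOp Wt g x ^ 2) / m := by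
    rw [← integral_div]
    refine integral_mono_of_nonneg (ae_of_all _ fun x => div_nonneg (sq_nonneg _) (hwpos x).le)
      (hi1.div_const m) (ae_of_all _ fun x => ?_)
    exact div_le_div_of_nonneg_left (sq_nonneg _) hm (hwm x)
  have s2 : m * ∫ x, (x * synth (mulD g) x) ^ 2 ≤ ∫ x, wt x * (x * synth (mulD g) x) ^ 2 := by
    rw [← integral_const_mul]
    refine integral_mono (hi2.const_mul m) (integrable_bdd_mul_sq hwtm.aestronglyMeasurable
      (M := max M₀ 1) (fun x => ?_) hd) fun x => ?_
    · rw [abs_of_pos (hwpos x)]; exact hwM x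
    · exact mul_le_mul_of_nonneg_right (hwm x) (sq_nonneg _)
  have s3 : ∫ x, ((W x - 1) / 3 * (x * synth (mulD g) x)) ^ 2 ≤
      (M + 1) ^ 2 * ∫ x, (x * synth (mulD g) x) ^ 2 := by
    rw [← integral_const_mul]
    refine integral_mono hBm.integrable_sq (hi2.const_mul _) fun x => ?_
    simp only [mul_pow]
    refine mul_le_mul_of_nonneg_right ?_ (by positivity)
    rw [sq_le_sq, abs_of_pos (by linarith : 0 < M + 1)]
    have h1 : |W x - 1| ≤ |W x| + 1 := by simpa using abs_sub (W x) 1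
    have := hb x
    change |W x| ≤ M at this
    rw [abs_div, abs_of_pos (by norm_num : (0:ℝ) < 3)]
    linarith [abs_nonneg (W x - 1)]
  set I := ∫ x, linOp Wt g x ^ 2
  set J := ∫ x, (x * synth (mulD g) x) ^ 2
  have hI : 0 ≤ I := integral_nonneg fun x => sq_nonneg _
  have s4 : m * J ≤ 300 * (I / m) := by linarith
  have s5 : J ≤ 300 * I / m ^ 2 := by
    rw [le_div_iff₀ (by positivity)]
    have : m * (m * J) ≤ m * (300 * (I / m)) := by gcongr
    have e : m * (300 * (I / m)) = 300 * I := by field_simp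
    nlinarith
  calc _ ≤ (M + 1) ^ 2 * J := s3
    _ ≤ (M + 1) ^ 2 * (300 * I / m ^ 2) := by gcongr
    _ ≤ (M + 1) ^ 2 * (400 * I / m ^ 2) := by gcongr; norm_num
    _ = _ := by ring

/-- The range of the perturbed operator on test functions is dense in `L²`. -/
theorem exists_linOp_approx {r : ℝ} (hr : |r - 1| ≤ 1 / 32) (N : ℕ)
    {ρ : ℝ → ℝ} (hρm : Measurable ρ) (hρ : ∀ x, |ρ x - 1| ≤ 1 / 10) {F : ℝ → ℝ}
    (hF : MemLp F 2 volume) {η : ℝ} (hη : 0 < η) :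
    ∃ g, IsSpectral g ∧ MemLp (linOp (fun x => ρ x * modelWeight r N x) g) 2 volume ∧
      ∫ x, (linOp (fun x => ρ x * modelWeight r N x) g x - F x) ^ 2 ≤ η := by
  obtain ⟨m₀, M₀, hm₀, hbd⟩ := exists_modelWeight_bounds hr N
  have hb : ∀ x, |ρ x * modelWeight r N x| ≤ 2 * M₀ := fun x => by
    have h1 := abs_le.1 (hρ x)
    have h2 := hm₀.trans_le (hbd x).1
    rw [abs_mul, abs_of_pos h2, abs_of_pos (by linarith)]
    have := (hbd x).2
    have h4 : ρ x ≤ 2 := by linarith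
    gcongr
  have hd := orthogonal_range_linMap hr N hρm hρ hb
  rw [← Submodule.topologicalClosure_eq_top_iff] at hd
  have hmem : hF.toLp F ∈ closure ((LinearMap.range (linMap (fun x => ρ x * modelWeight r N x)
      (hρm.mul (measurable_modelWeight r N)) hb) : Set (Lp ℝ 2 (volume : Measure ℝ)))) := by
    rw [← Submodule.topologicalClosure_coe, hd]; trivial
  obtain ⟨y, ⟨⟨g, hg⟩, rfl⟩, hy⟩ := Metric.mem_closure_iff.1 hmem (Real.sqrt η) (Real.sqrt_pos.2 hη)
  have hL : MemLp (linOp (fun x => ρ x * modelWeight r N x) g) 2 volume :=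
    memLp_linOp (show IsSpectral g from hg) (hρm.mul (measurable_modelWeight r N)).aestronglyMeasurable hb
  refine ⟨g, hg, hL, ?_⟩
  rw [dist_comm, dist_eq_norm, linMap_apply, ← MemLp.toLp_sub] at hy
  have := norm_toLp_sq (hL.sub hF)
  simp only [Pi.sub_apply] at this
  rw [← this]
  calc _ ≤ Real.sqrt η ^ 2 := by gcongr
    _ = η := Real.sq_sqrt hη.le

end SelfSimilar

/-! ### Asymptotics of the profile at infinity. -/

namespace SelfSimilar
open Filter Topology

theorem pow_mul_exp_neg_le {ξ : ℝ} (hξ : 0 ≤ ξ) (k : ℕ) :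
    ξ ^ k * Real.exp (-(ξ / 2)) ≤ 4 ^ k * k.factorial * Real.exp (-(ξ / 4)) := by
  have h := Real.pow_div_factorial_le_exp (ξ / 4) (by positivity) k
  rw [div_le_iff₀ (by positivity), div_pow, div_le_iff₀ (by positivity)] at h
  have e : Real.exp (-(ξ / 4)) = Real.exp (ξ / 4) * Real.exp (-(ξ / 2)) := by
    rw [← Real.exp_add]; congr 1; ring
  rw [e]
  nlinarith [Real.exp_pos (-(ξ / 2))]

/-- It follows from `ξ³ ≥ ξ - 2`. The decay rate is the same for all `a ≥ 1/2`, which keeps later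
constants independent of `ε`. -/
theorem exp_neg_mul_cube_le {a ξ : ℝ} (ha : 1 / 2 ≤ a) (hξ : 0 ≤ ξ) :
    Real.exp (-a * ξ ^ 3) ≤ 3 * Real.exp (-(ξ / 2)) := by
  have h1 : -a * ξ ^ 3 ≤ 1 + -(ξ / 2) := by
    have h3 : 0 ≤ ξ ^ 3 := by positivity
    have : ξ - 2 ≤ ξ ^ 3 := by nlinarith [mul_nonneg (sq_nonneg (ξ - 1)) (by linarith : 0 ≤ ξ + 2)]
    nlinarith
  calc _ ≤ Real.exp (1 + -(ξ / 2)) := Real.exp_le_exp.2 h1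
    _ = Real.exp 1 * Real.exp (-(ξ / 2)) := Real.exp_add _ _
    _ ≤ _ := by gcongr; linarith [Real.exp_one_lt_d9]

theorem pow_mul_exp_neg_cube_le {a ξ : ℝ} (ha : 1 / 2 ≤ a) (hξ : 0 ≤ ξ) (k : ℕ) :
    ξ ^ k * Real.exp (-a * ξ ^ 3) ≤ 3 * (4 ^ k * k.factorial) * Real.exp (-(ξ / 4)) := by
  have h1 := pow_mul_exp_neg_le hξ k
  have h2 := mul_le_mul_of_nonneg_left (exp_neg_mul_cube_le ha hξ) (pow_nonneg hξ k)
  linarith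

theorem exp_neg_mul_le {a ξ : ℝ} (ha : 1 / 2 ≤ a) (hξ : 0 ≤ ξ) :
    Real.exp (-a * ξ) ≤ Real.exp (-(ξ / 4)) := Real.exp_le_exp.2 (by nlinarith)

theorem integrableOn_exp_neg_quarter :
    IntegrableOn (fun ξ : ℝ => Real.exp (-(ξ / 4))) (Set.Ioi 0) := by
  have := exp_neg_integrableOn_Ioi 0 (by norm_num : (0 : ℝ) < 1 / 4)
  refine this.congr_fun (fun x _ => ?_) measurableSet_Ioi
  simp only []; congr 1; ring

theorem integral_exp_neg_quarter : ∫ ξ in Set.Ioi (0 : ℝ), Real.exp (-(ξ / 4)) = 4 := by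
  have := integral_exp_mul_Ioi (a := -(1 / 4)) (by norm_num) 0
  norm_num at this
  calc _ = ∫ ξ in Set.Ioi (0 : ℝ), Real.exp (-(1 / 4 * ξ)) := by
        congr 1; ext ξ; congr 1; ring
    _ = 4 := this

/-- The difference of the symbols of the profile and of the Poisson kernel. -/
noncomputable def symbolDiff (a ξ : ℝ) : ℝ := Real.exp (-a * ξ ^ 3) - Real.exp (-a * ξ)

theorem hasDerivAt_symbolDiff (a ξ : ℝ) : HasDerivAt (symbolDiff a)
    (-3 * a * ξ ^ 2 * Real.exp (-a * ξ ^ 3) + a * Real.exp (-a * ξ)) ξ := by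
  have h1 := (((hasDerivAt_pow 3 ξ).const_mul (-a)).exp).fun_sub
    (((hasDerivAt_id' ξ).const_mul (-a)).exp)
  refine h1.congr_deriv ?_
  push_cast; ring

theorem hasDerivAt_deriv_symbolDiff (a ξ : ℝ) : HasDerivAt
    (fun ξ => -3 * a * ξ ^ 2 * Real.exp (-a * ξ ^ 3) + a * Real.exp (-a * ξ))
    ((-6 * a * ξ + 9 * a ^ 2 * ξ ^ 4) * Real.exp (-a * ξ ^ 3) - a ^ 2 * Real.exp (-a * ξ)) ξ := by
  have h1 := (((hasDerivAt_pow 2 ξ).const_mul (-3 * a)).fun_mul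
    (((hasDerivAt_pow 3 ξ).const_mul (-a)).exp)).fun_add
    ((((hasDerivAt_id' ξ).const_mul (-a)).exp).const_mul a)
  refine h1.congr_deriv ?_
  push_cast; ring

theorem abs_symbolDiff_le {a ξ : ℝ} (ha : 1 / 2 ≤ a) (hξ : 0 ≤ ξ) :
    |symbolDiff a ξ| ≤ 4 * Real.exp (-(ξ / 4)) := by
  have h1 := pow_mul_exp_neg_cube_le ha hξ 0
  have h2 := exp_neg_mul_le ha hξ
  norm_num at h1
  rw [← neg_mul] at h1
  rw [symbolDiff, abs_le]
  constructor <;> linarith [Real.exp_pos (-a * ξ ^ 3), Real.exp_pos (-a * ξ), Real.exp_pos (-(ξ / 4))]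

theorem abs_deriv_symbolDiff_le {a ξ : ℝ} (ha : 1 / 2 ≤ a) (ha' : a ≤ 2) (hξ : 0 ≤ ξ) :
    |-3 * a * ξ ^ 2 * Real.exp (-a * ξ ^ 3) + a * Real.exp (-a * ξ)| ≤
      1000 * Real.exp (-(ξ / 4)) := by
  have h1 := pow_mul_exp_neg_cube_le ha hξ 2
  have h2 := exp_neg_mul_le ha hξ
  norm_num [Nat.factorial] at h1
  have hp : 0 ≤ ξ ^ 2 * Real.exp (-a * ξ ^ 3) := by positivity
  have hp2 := Real.exp_pos (-a * ξ)
  rw [← neg_mul] at h1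
  rw [abs_le]
  constructor <;> nlinarith [mul_le_mul_of_nonneg_right ha' hp, mul_nonneg (by linarith : 0 ≤ a) hp,
    mul_le_mul_of_nonneg_right ha' hp2.le, mul_nonneg (by linarith : 0 ≤ a) hp2.le]

theorem abs_deriv2_symbolDiff_le {a ξ : ℝ} (ha : 1 / 2 ≤ a) (ha' : a ≤ 2) (hξ : 0 ≤ ξ) :
    |(-6 * a * ξ + 9 * a ^ 2 * ξ ^ 4) * Real.exp (-a * ξ ^ 3) - a ^ 2 * Real.exp (-a * ξ)| ≤
      1000000 * Real.exp (-(ξ / 4)) := by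
  have h1 := pow_mul_exp_neg_cube_le ha hξ 1
  have h4 := pow_mul_exp_neg_cube_le ha hξ 4
  have h2 := exp_neg_mul_le ha hξ
  norm_num [Nat.factorial] at h1 h4
  rw [← neg_mul] at h1 h4
  have hp1 : 0 ≤ ξ * Real.exp (-a * ξ ^ 3) := by positivity
  have hp4 : 0 ≤ ξ ^ 4 * Real.exp (-a * ξ ^ 3) := by positivity
  have hp2 := Real.exp_pos (-a * ξ)
  have ha2 : a ^ 2 ≤ 4 := by nlinarith
  have e : (-6 * a * ξ + 9 * a ^ 2 * ξ ^ 4) * Real.exp (-a * ξ ^ 3) - a ^ 2 * Real.exp (-a * ξ) =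
    -6 * (a * (ξ * Real.exp (-a * ξ ^ 3))) + 9 * (a ^ 2 * (ξ ^ 4 * Real.exp (-a * ξ ^ 3))) -
      a ^ 2 * Real.exp (-a * ξ) := by ring
  have m1 := mul_le_mul_of_nonneg_right ha' hp1
  have m2 := mul_le_mul_of_nonneg_right ha2 hp4
  have m3 := mul_le_mul_of_nonneg_right ha2 hp2.le
  have n1 := mul_nonneg (by linarith : 0 ≤ a) hp1
  have n2 := mul_nonneg (sq_nonneg a) hp4
  have n3 := mul_nonneg (sq_nonneg a) hp2.le
  rw [e, abs_le]
  constructor <;> linarith [Real.exp_pos (-(ξ / 4))]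

theorem abs_sin_mul_le (y t : ℝ) : |Real.sin y * t| ≤ |t| := by
  rw [abs_mul]; exact mul_le_of_le_one_left (abs_nonneg _) (Real.abs_sin_le_one _)

theorem integrableOn_sin_mul_symbolDiff {a : ℝ} (ha : 1 / 2 ≤ a) (x : ℝ) :
    IntegrableOn (fun ξ => Real.sin (x * ξ) * symbolDiff a ξ) (Set.Ioi 0) := by
  refine (integrableOn_exp_neg_quarter.const_mul 4).mono' (by unfold symbolDiff; fun_prop) ?_
  filter_upwards [ae_restrict_mem measurableSet_Ioi] with ξ hξ
  exact (abs_sin_mul_le _ _).trans (abs_symbolDiff_le ha (le_of_lt hξ))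

/-- Two integrations by parts gain `x⁻²`. At the origin the first boundary term vanishes because
both exponentials equal one, the second because of the sine; the first cancellation is the reason
for subtracting the Poisson symbol. -/
theorem abs_integral_sin_mul_symbolDiff_le {a : ℝ} (ha : 1 / 2 ≤ a) (ha' : a ≤ 2) (x : ℝ) :
    |∫ ξ in Set.Ioi (0 : ℝ), Real.sin (x * ξ) * symbolDiff a ξ| ≤ 5000000 / (1 + x ^ 2) := by
  set h2 : ℝ → ℝ := fun ξ => (-6 * a * ξ + 9 * a ^ 2 * ξ ^ 4) * Real.exp (-a * ξ ^ 3) -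
    a ^ 2 * Real.exp (-a * ξ) with hh2
  set I := ∫ ξ in Set.Ioi (0 : ℝ), Real.sin (x * ξ) * symbolDiff a ξ with hI
  have hi2 : IntegrableOn (fun ξ => Real.sin (x * ξ) * h2 ξ) (Set.Ioi 0) := by
    refine (integrableOn_exp_neg_quarter.const_mul 1000000).mono' (by fun_prop) ?_
    filter_upwards [ae_restrict_mem measurableSet_Ioi] with ξ hξ
    exact (abs_sin_mul_le _ _).trans (abs_deriv2_symbolDiff_le ha ha' (le_of_lt hξ))
  have hi1 := integrableOn_sin_mul_symbolDiff ha x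
  have b1 : |I| ≤ 16 := by
    have := norm_integral_le_of_norm_le (integrableOn_exp_neg_quarter.const_mul 4)
      (f := fun ξ => Real.sin (x * ξ) * symbolDiff a ξ) (by
        filter_upwards [ae_restrict_mem measurableSet_Ioi] with ξ hξ
        exact (abs_sin_mul_le _ _).trans (abs_symbolDiff_le ha (le_of_lt hξ)))
    rw [integral_const_mul, integral_exp_neg_quarter] at this
    norm_num at this
    exact this
  have b2 : |∫ ξ in Set.Ioi (0 : ℝ), Real.sin (x * ξ) * h2 ξ| ≤ 4000000 := by
    have := norm_integral_le_of_norm_le (integrableOn_exp_neg_quarter.const_mul 1000000)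
      (f := fun ξ => Real.sin (x * ξ) * h2 ξ) (by
        filter_upwards [ae_restrict_mem measurableSet_Ioi] with ξ hξ
        exact (abs_sin_mul_le _ _).trans (abs_deriv2_symbolDiff_le ha ha' (le_of_lt hξ)))
    rw [integral_const_mul, integral_exp_neg_quarter] at this
    norm_num at this
    exact this
  -- A single antiderivative that carries out both integrations by parts.
  set Φ : ℝ → ℝ := fun ξ => -x * (Real.cos (x * ξ) * symbolDiff a ξ) + Real.sin (x * ξ) *
    (-3 * a * ξ ^ 2 * Real.exp (-a * ξ ^ 3) + a * Real.exp (-a * ξ)) with hΦ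
  have hd : ∀ ξ, HasDerivAt Φ
      (x ^ 2 * (Real.sin (x * ξ) * symbolDiff a ξ) + Real.sin (x * ξ) * h2 ξ) ξ := fun ξ => by
    have hx : HasDerivAt (fun ξ : ℝ => x * ξ) x ξ := by
      simpa using (hasDerivAt_id' ξ).const_mul x
    have := (((hx.cos).fun_mul (hasDerivAt_symbolDiff a ξ)).const_mul (-x)).fun_add
      ((hx.sin).fun_mul (hasDerivAt_deriv_symbolDiff a ξ))
    refine this.congr_deriv ?_
    simp only [hh2]; ring
  have hlim : Tendsto Φ atTop (𝓝 0) := by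
    have h0 : Tendsto (fun ξ : ℝ => (|x| * 4 + 1000) * Real.exp (-(ξ / 4))) atTop (𝓝 0) := by
      have : Tendsto (fun ξ : ℝ => Real.exp (-(ξ / 4))) atTop (𝓝 0) :=
        Real.tendsto_exp_neg_atTop_nhds_zero.comp (tendsto_id.atTop_div_const (by norm_num))
      simpa using this.const_mul (|x| * 4 + 1000)
    refine squeeze_zero_norm' ?_ h0
    filter_upwards [eventually_ge_atTop 0] with ξ hξ
    have c1 := abs_symbolDiff_le ha hξ
    have c2 := abs_deriv_symbolDiff_le ha ha' hξ
    have c3 : |Real.cos (x * ξ) * symbolDiff a ξ| ≤ 4 * Real.exp (-(ξ / 4)) := by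
      rw [abs_mul]
      exact (mul_le_of_le_one_left (abs_nonneg _) (Real.abs_cos_le_one _)).trans c1
    have c4 := (abs_sin_mul_le (x * ξ) _).trans c2
    rw [Real.norm_eq_abs]
    refine (abs_add_le _ _).trans ?_
    rw [abs_mul, abs_neg]
    have c5 := mul_le_mul_of_nonneg_left c3 (abs_nonneg x)
    linarith
  have key := integral_Ioi_of_hasDerivAt_of_tendsto' (a := 0) (fun ξ _ => hd ξ)
    ((hi1.const_mul (x ^ 2)).add hi2) hlim
  rw [integral_add (hi1.const_mul (x ^ 2)) hi2, integral_const_mul] at key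
  have hΦ0 : Φ 0 = 0 := by simp [hΦ, symbolDiff]
  rw [hΦ0, ← hI, sub_zero] at key
  have b3 : x ^ 2 * |I| ≤ 4000000 := by
    rw [← abs_of_nonneg (sq_nonneg x), ← abs_mul, eq_neg_of_add_eq_zero_left key, abs_neg]
    exact b2
  rw [le_div_iff₀ (by positivity)]
  linarith

theorem integrable_exp_neg_abs_cube {a : ℝ} (ha : 1 / 2 ≤ a) :
    Integrable fun ξ : ℝ => Real.exp (-a * |ξ| ^ 3) := by
  refine (integrable_inv_one_add_sq.const_mul 100).mono' (by fun_prop) (ae_of_all _ fun ξ => ?_)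
  have h0 := pow_mul_exp_neg_cube_le ha (abs_nonneg ξ) 0
  have h2 := pow_mul_exp_neg_cube_le ha (abs_nonneg ξ) 2
  have h3 : Real.exp (-(|ξ| / 4)) ≤ 1 := Real.exp_le_one_iff.2 (by have := abs_nonneg ξ; linarith)
  rw [sq_abs] at h2
  norm_num [Nat.factorial] at h0 h2
  rw [← neg_mul] at h0 h2
  rw [Real.norm_eq_abs, abs_of_pos (Real.exp_pos _), ← div_eq_mul_inv, le_div_iff₀ (by positivity)]
  linarith

/-- The symbol `-i sgn ξ` is odd and `dGHat` is even, so only the sine survives, doubled on the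
half-line. -/
theorem iHdG_eq {a : ℝ} (ha : 1 / 2 ≤ a) (x : ℝ) :
    iHdG a x = 2 / Real.pi * ∫ ξ in Set.Ioi (0 : ℝ), Real.sin (x * ξ) * Real.exp (-a * ξ ^ 3) := by
  have hm : ∀ x : ℝ, Measurable fun ξ : ℝ => Complex.exp (Complex.I * x * ξ) *
      (Complex.I * hilbertSymbol ξ * (dGHat a ξ : ℂ)) := fun x => by
    have := measurable_hilbertSymbol
    unfold dGHat
    fun_prop
  have hi : Integrable fun ξ : ℝ => Complex.exp (Complex.I * x * ξ) *
      (Complex.I * hilbertSymbol ξ * (dGHat a ξ : ℂ)) := by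
    refine ((integrable_exp_neg_abs_cube ha).const_mul (Real.sqrt 2 / Real.sqrt Real.pi)).mono'
      (hm x).aestronglyMeasurable (ae_of_all _ fun ξ => ?_)
    have e : Complex.I * x * ξ = ((x * ξ : ℝ) : ℂ) * Complex.I := by push_cast; ring
    have hd : 0 ≤ dGHat a ξ := by unfold dGHat; positivity
    rw [norm_mul, e, Complex.norm_exp_ofReal_mul_I, one_mul, norm_mul, norm_mul, Complex.norm_I,
      one_mul, Complex.norm_real, Real.norm_eq_abs, abs_of_nonneg hd]
    exact mul_le_of_le_one_left hd (norm_hilbertSymbol_le ξ)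
  have hre : ∀ ξ : ℝ, (Complex.exp (Complex.I * x * ξ) *
      (Complex.I * hilbertSymbol ξ * (dGHat a ξ : ℂ))).re = Real.sqrt 2 / Real.sqrt Real.pi *
        (Real.sin (x * |ξ|) * Real.exp (-a * |ξ| ^ 3)) := fun ξ => by
    have e : Complex.I * x * ξ = ((x * ξ : ℝ) : ℂ) * Complex.I := by push_cast; ring
    have e2 : Complex.I * hilbertSymbol ξ * (dGHat a ξ : ℂ) =
        ((-(Real.sign ξ * dGHat a ξ) : ℝ) : ℂ) * Complex.I := by
      simp only [hilbertSymbol]; push_cast; ring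
    have e3 : Real.sin (x * |ξ|) = Real.sign ξ * Real.sin (x * ξ) := by
      rcases lt_trichotomy ξ 0 with h | h | h
      · rw [abs_of_neg h, Real.sign_of_neg h, mul_neg, Real.sin_neg]; ring
      · simp [h]
      · rw [abs_of_pos h, Real.sign_of_pos h, one_mul]
    rw [e, e2, e3, Complex.exp_mul_I, ← Complex.ofReal_cos, ← Complex.ofReal_sin, dGHat]
    simp only [Complex.mul_re, Complex.add_re, Complex.add_im, Complex.mul_im, Complex.ofReal_re,
      Complex.ofReal_im, Complex.I_re, Complex.I_im]
    ring
  have h2 : (∫ ξ : ℝ, Complex.exp (Complex.I * x * ξ) *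
      (Complex.I * hilbertSymbol ξ * (dGHat a ξ : ℂ))).re = Real.sqrt 2 / Real.sqrt Real.pi *
        (2 * ∫ ξ in Set.Ioi (0 : ℝ), Real.sin (x * ξ) * Real.exp (-a * ξ ^ 3)) := by
    rw [← integral_comp_abs (f := fun ξ => Real.sin (x * ξ) * Real.exp (-a * ξ ^ 3)),
      ← integral_const_mul]
    simp only [← hre]
    exact (Complex.reCLM.integral_comp_comm hi).symm
  rw [iHdG, Complex.re_ofReal_mul, h2, ← mul_assoc, ← mul_assoc]
  congr 1
  rw [Real.sqrt_mul (by norm_num)]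
  have p1 : Real.sqrt Real.pi ≠ 0 := (Real.sqrt_pos.2 Real.pi_pos).ne'
  have p2 := Real.mul_self_sqrt Real.pi_pos.le
  have p3 : Real.sqrt 2 ≠ 0 := by positivity
  field_simp
  rw [sq, p2]

theorem continuous_iHdG {a : ℝ} (ha : 1 / 2 ≤ a) : Continuous (iHdG a) := by
  have e : iHdG a = fun x => 2 / Real.pi *
      ∫ ξ in Set.Ioi (0 : ℝ), Real.sin (x * ξ) * Real.exp (-a * ξ ^ 3) := funext (iHdG_eq ha)
  rw [e]
  refine continuous_const.mul (continuous_of_dominated (fun x => by fun_prop) (fun x => ?_)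
    (integrableOn_exp_neg_quarter.const_mul 3) (ae_of_all _ fun ξ => by fun_prop))
  filter_upwards [ae_restrict_mem measurableSet_Ioi] with ξ hξ
  refine (abs_sin_mul_le _ _).trans ?_
  rw [abs_of_pos (Real.exp_pos _)]
  simpa using pow_mul_exp_neg_cube_le ha (le_of_lt hξ) 0

/-- The remainder of the Poisson approximation of the profile. -/
noncomputable def profileRem (a y : ℝ) : ℝ := iHdG a y - 2 / Real.pi * (y / (a ^ 2 + y ^ 2))

theorem abs_profileRem_le {a : ℝ} (ha : 1 / 2 ≤ a) (ha' : a ≤ 2) (x : ℝ) :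
    |profileRem a x| ≤ 5000000 * (1 + x ^ 2)⁻¹ := by
  have h0 : 0 < a := by linarith
  have e : profileRem a x =
      2 / Real.pi * ∫ ξ in Set.Ioi (0 : ℝ), Real.sin (x * ξ) * symbolDiff a ξ := by
    have h1 := integrableOn_sin_mul_symbolDiff ha x
    have h2 := integrableOn_sin_mul_exp_neg h0 x
    rw [profileRem, iHdG_eq ha, ← integral_sin_mul_exp_neg h0, ← mul_sub]
    congr 1
    rw [sub_eq_iff_eq_add, ← integral_add h1 h2]
    congr 1; ext ξ; simp only [symbolDiff]; ring
  have h1 := abs_integral_sin_mul_symbolDiff_le ha ha' x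
  have hpi : |2 / Real.pi| ≤ 1 := by
    rw [abs_of_pos (by positivity), div_le_one Real.pi_pos]; linarith [Real.pi_gt_three]
  rw [e, abs_mul, ← div_eq_mul_inv]
  exact (mul_le_of_le_one_left (abs_nonneg _) hpi).trans h1

theorem continuous_profileRem {a : ℝ} (ha : 1 / 2 ≤ a) : Continuous (profileRem a) := by
  refine (continuous_iHdG ha).sub (continuous_const.mul (continuous_id.div (by fun_prop) fun x => ?_))
  have : 0 < a := by linarith
  positivity

theorem integrable_profileRem {a : ℝ} (ha : 1 / 2 ≤ a) (ha' : a ≤ 2) :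
    Integrable (profileRem a) :=
  (integrable_inv_one_add_sq.const_mul 5000000).mono' (continuous_profileRem ha).aestronglyMeasurable
    (ae_of_all _ fun x => abs_profileRem_le ha ha' x)

/-- The bound is uniform in `a` and `x`, so `V` changes the logarithm of the weight only by `O(ε)`.
-/
theorem abs_profileV_le {a : ℝ} (ha : 1 / 2 ≤ a) (ha' : a ≤ 2) (x : ℝ) :
    |profileV a x| ≤ 20000000 := by
  rw [profileV, abs_neg]
  calc |∫ y in Set.Ioi x, profileRem a y| ≤ ∫ y in Set.Ioi x, |profileRem a y| :=
        abs_integral_le_integral_abs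
    _ ≤ ∫ y, |profileRem a y| :=
        setIntegral_le_integral (integrable_profileRem ha ha').abs (ae_of_all _ fun _ => abs_nonneg _)
    _ ≤ ∫ y, 5000000 * (1 + y ^ 2)⁻¹ :=
        integral_mono (integrable_profileRem ha ha').abs (integrable_inv_one_add_sq.const_mul _)
          fun y => abs_profileRem_le ha ha' y
    _ = 5000000 * Real.pi := by rw [integral_const_mul, integral_univ_inv_one_add_sq]
    _ ≤ _ := by linarith [Real.pi_lt_four]

theorem hasDerivAt_profileV {a : ℝ} (ha : 1 / 2 ≤ a) (ha' : a ≤ 2) (x : ℝ) :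
    HasDerivAt (profileV a) (profileRem a x) x := by
  have hi := integrable_profileRem ha ha'
  have e : profileV a = fun x => (∫ y in (0 : ℝ)..x, profileRem a y) -
      ∫ y in Set.Ioi (0 : ℝ), profileRem a y := by
    ext x
    rw [← intervalIntegral.integral_Ioi_sub_Ioi' hi.integrableOn hi.integrableOn]
    simp only [profileV, profileRem]; ring
  rw [e]
  exact ((continuous_profileRem ha).integral_hasStrictDerivAt 0 x).hasDerivAt.sub_const _

end SelfSimilar

/-! ### Quantitative properties of the weight for small `ε`. -/

namespace SelfSimilar
open Filter Topology

/-- The factor by which the weight grows when `1 + x²` is multiplied by `4`. -/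
noncomputable def growth (ε : ℝ) : ℝ := Real.exp (3 * ε / Real.pi * Real.log 4)

/-- The quantitative properties of the weight that hold for small `ε`. -/
structure GoodWeight (ε : ℝ) : Prop where
  a_near : |aExp ε - 1| ≤ 1 / 10
  growth_near : |growth ε - 1| ≤ 1 / 200
  dyadic : ∀ (x : ℝ) (j : ℕ), 4 ^ j ≤ 1 + x ^ 2 → 1 + x ^ 2 < 4 ^ (j + 1) →
    |weight ε x / aExp ε - growth ε ^ j| ≤ 1 / 32 * growth ε ^ j
  hasDerivAt : ∀ x, HasDerivAt (weight ε) (3 * ε * iHdG (aExp ε) x * weight ε x) x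
  deriv_small : ∀ x, |x * (3 * ε * iHdG (aExp ε) x)| ≤ 1 / 2
  continuous_iHdG : Continuous (iHdG (aExp ε))

theorem weight_pos (ε x : ℝ) : 0 < weight ε x := Real.exp_pos _

/-- The factor `1 / ε` in the additive constant cancels against `3 ε`. At `ε = 0` division by zero
returns `0`, in agreement with `log 1 = 0`. -/
theorem weight_eq (ε x : ℝ) : weight ε x = Real.exp (3 * ε / Real.pi *
    Real.log (aExp ε ^ 2 + x ^ 2) + 3 * Real.log (aExp ε) + 3 * ε * profileV (aExp ε) x) := by
  rw [weight, iHG]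
  congr 1
  rcases eq_or_ne ε 0 with rfl | h
  · simp [aExp]
  · rw [aExp]; field_simp

/-- On the shell `4ʲ ≤ 1 + x² < 4ʲ⁺¹` the logarithm of `w / a` differs from that of `growth ε ^ j`
by at most `10⁸ |ε|`, mostly owing to the bound for `V`; this fixes the admissible size of `ε`. -/
theorem goodWeight {ε : ℝ} (hε : |ε| ≤ 1 / 10 ^ 10) : GoodWeight ε := by
  have hpi := Real.pi_gt_three
  have hpi0 := Real.pi_pos
  have hsub : aExp ε - 1 = ε * (2 / Real.pi) := by rw [aExp]; ring
  have h2pi : 2 / Real.pi ≤ 1 := by rw [div_le_one hpi0]; linarith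
  have h3pi : 3 / Real.pi ≤ 1 := by rw [div_le_one hpi0]; linarith
  have ha1 : |aExp ε - 1| ≤ |ε| := by
    rw [hsub, abs_mul, abs_of_pos (by positivity : 0 < 2 / Real.pi)]
    exact mul_le_of_le_one_right (abs_nonneg _) h2pi
  set a := aExp ε with haD
  have ha := abs_le.1 (ha1.trans hε)
  norm_num at ha hε
  have hal : 1 / 2 ≤ a := by linarith
  have hau : a ≤ 2 := by linarith
  have ha0 : 0 < a := by linarith
  have hs : |3 * ε / Real.pi| ≤ |ε| := by
    have : 3 * ε / Real.pi = ε * (3 / Real.pi) := by ring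
    rw [this, abs_mul, abs_of_pos (by positivity : 0 < 3 / Real.pi)]
    exact mul_le_of_le_one_right (abs_nonneg _) h3pi
  set s := 3 * ε / Real.pi with hsD
  have hl2 : Real.log 2 ≤ 1 := by linarith [Real.log_two_lt_d9]
  have hl2p : 0 < Real.log 2 := Real.log_pos (by norm_num)
  have hl4 : Real.log 4 = 2 * Real.log 2 := by
    rw [show (4 : ℝ) = 2 ^ 2 by norm_num, Real.log_pow]; norm_num
  have hloga : |Real.log a| ≤ 2 * |ε| := by
    have e1 := Real.log_le_sub_one_of_pos ha0
    have e2 := Real.one_sub_inv_le_log_of_pos ha0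
    have e3 := abs_le.1 ha1
    have e4 : 1 - a⁻¹ = (a - 1) / a := by field_simp
    rw [e4] at e2
    have e5 : -(2 * |ε|) ≤ (a - 1) / a := by
      rw [le_div_iff₀ ha0]
      nlinarith [abs_nonneg ε]
    rw [abs_le]; constructor <;> linarith [abs_nonneg ε]
  have hV := fun x => abs_profileV_le hal hau x
  refine ⟨by linarith, ?_, fun x j h1 h2 => ?_, fun x => ?_, fun x => ?_, continuous_iHdG hal⟩
  · have h1 : |s * Real.log 4| ≤ 2 * |ε| := by
      rw [abs_mul, hl4, abs_of_pos (by linarith : 0 < 2 * Real.log 2)]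
      nlinarith [abs_nonneg s, abs_nonneg ε]
    have := Real.abs_exp_sub_one_le (x := s * Real.log 4) (by linarith)
    rw [growth]; linarith
  · have hr0 : 0 < growth ε ^ j := pow_pos (Real.exp_pos _) j
    -- Division by `a` leaves `2 log a` of the constant `3 log a`.
    set t := s * (Real.log (a ^ 2 + x ^ 2) - j * Real.log 4) + 2 * Real.log a +
      3 * ε * profileV a x with ht
    have hW : weight ε x / a = growth ε ^ j * Real.exp t := by
      have hla : a = Real.exp (Real.log a) := (Real.exp_log ha0).symm
      have hg : growth ε ^ j = Real.exp (j * (s * Real.log 4)) := by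
        rw [growth, ← Real.exp_nat_mul]
      rw [weight_eq, ← haD, ← hsD, hg, ← Real.exp_add, div_eq_iff ha0.ne']
      calc _ = Real.exp (j * (s * Real.log 4) + t + Real.log a) := by congr 1; rw [ht]; ring
        _ = _ := by rw [Real.exp_add _ (Real.log a), ← hla]
    -- On the shell, `a² + x²` lies between `4ʲ / 2` and `8 · 4ʲ`.
    have hlog : |Real.log (a ^ 2 + x ^ 2) - j * Real.log 4| ≤ 3 := by
      have u1 : Real.log (a ^ 2 + x ^ 2) ≤ Real.log (2 * 4 ^ (j + 1)) :=
        Real.log_le_log (by positivity) (by nlinarith)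
      have u2 : Real.log (4 ^ j / 2) ≤ Real.log (a ^ 2 + x ^ 2) :=
        Real.log_le_log (by positivity) (by nlinarith)
      rw [Real.log_mul (by norm_num) (by positivity), Real.log_pow] at u1
      rw [Real.log_div (by positivity) (by norm_num), Real.log_pow] at u2
      push_cast at u1
      rw [abs_le]; constructor <;> linarith
    have htb : |t| ≤ 10 ^ 8 * |ε| := by
      have b1 : |s * (Real.log (a ^ 2 + x ^ 2) - j * Real.log 4)| ≤ |ε| * 3 := by
        rw [abs_mul]; gcongr
      have b2 : |2 * Real.log a| ≤ 4 * |ε| := by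
        rw [abs_mul, abs_of_pos (by norm_num : (0:ℝ) < 2)]; linarith
      have b3 : |3 * ε * profileV a x| ≤ 3 * |ε| * 20000000 := by
        rw [abs_mul, abs_mul, abs_of_pos (by norm_num : (0:ℝ) < 3)]
        gcongr; exact hV x
      have := (abs_add_le (s * (Real.log (a ^ 2 + x ^ 2) - j * Real.log 4) + 2 * Real.log a)
        (3 * ε * profileV a x)).trans (add_le_add_left (abs_add_le _ _) _)
      rw [ht]; linarith [abs_nonneg ε]
    have he := Real.abs_exp_sub_one_le (x := t) (by linarith)
    have e : growth ε ^ j * Real.exp t - growth ε ^ j = (Real.exp t - 1) * growth ε ^ j := by ring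
    rw [hW, e, abs_mul, abs_of_pos hr0]
    gcongr
    linarith
  · have hq : 0 < a ^ 2 + x ^ 2 := by positivity
    have hx2 : HasDerivAt (fun x : ℝ => a ^ 2 + x ^ 2) (2 * x) x := by
      simpa using (hasDerivAt_pow 2 x).const_add (a ^ 2)
    have hd := (((hx2.log hq.ne').const_mul s).add_const (3 * Real.log a)).fun_add
      ((hasDerivAt_profileV hal hau x).const_mul (3 * ε))
    have hfun : weight ε = fun x => Real.exp (s * Real.log (a ^ 2 + x ^ 2) + 3 * Real.log a +
      3 * ε * profileV a x) := funext (weight_eq ε)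
    rw [hfun]
    refine hd.exp.congr_deriv ?_
    -- The derivative of the logarithm cancels the Poisson part subtracted in the remainder, leaving
    -- `iHdG`.
    simp only [profileRem, hsD]
    field_simp
    ring
  -- After multiplication by `x` the remainder, of size `(1 + x²)⁻¹`, and the Poisson part are both
  -- bounded.
  · have h1 := abs_profileRem_le hal hau x
    have e : iHdG a x = profileRem a x + 2 / Real.pi * (x / (a ^ 2 + x ^ 2)) := by
      rw [profileRem]; ring
    have h2 : |x * profileRem a x| ≤ 5000000 := by
      rw [abs_mul]
      have hx : |x| * (1 + x ^ 2)⁻¹ ≤ 1 := by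
        rw [← div_eq_mul_inv, div_le_one (by positivity)]
        nlinarith [sq_nonneg (|x| - 1), sq_abs x]
      nlinarith [abs_nonneg x]
    have h3 : |x * (2 / Real.pi * (x / (a ^ 2 + x ^ 2)))| ≤ 1 := by
      have e3 : x * (2 / Real.pi * (x / (a ^ 2 + x ^ 2))) =
        2 / Real.pi * (x ^ 2 / (a ^ 2 + x ^ 2)) := by ring
      have h4 : x ^ 2 / (a ^ 2 + x ^ 2) ≤ 1 := by
        rw [div_le_one (by positivity)]; nlinarith
      rw [e3, abs_of_nonneg (by positivity)]
      exact mul_le_one₀ h2pi (by positivity) h4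
    have h5 : |x * iHdG a x| ≤ 5000001 := by
      rw [e, mul_add]
      exact (abs_add_le _ _).trans (by linarith)
    have e6 : x * (3 * ε * iHdG a x) = 3 * (ε * (x * iHdG a x)) := by ring
    rw [e6, abs_mul, abs_mul, abs_of_pos (by norm_num : (0:ℝ) < 3)]
    have : |ε| * |x * iHdG a x| ≤ 1 / 10000000000 * 5000001 := by gcongr
    linarith

section
variable {ε : ℝ}

theorem GoodWeight.growth_pos (_h : GoodWeight ε) : 0 < growth ε := Real.exp_pos _

theorem GoodWeight.growth_near' (h : GoodWeight ε) : |growth ε - 1| ≤ 1 / 32 :=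
  h.growth_near.trans (by norm_num)

theorem GoodWeight.a_mem (h : GoodWeight ε) : 9 / 10 ≤ aExp ε ∧ aExp ε ≤ 11 / 10 := by
  have := abs_le.1 h.a_near
  constructor <;> linarith

theorem GoodWeight.continuous (h : GoodWeight ε) : Continuous (weight ε) :=
  continuous_iff_continuousAt.2 fun x => (h.hasDerivAt x).continuousAt

/-- Below the cut-off scale the weight is close to its dyadic model. -/
theorem GoodWeight.near_modelWeight (h : GoodWeight ε) {N : ℕ} {x : ℝ}
    (hx : 1 + x ^ 2 < 4 ^ (N + 1)) :
    |weight ε x / aExp ε - modelWeight (growth ε) N x| ≤ 1 / 10 * modelWeight (growth ε) N x := by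
  obtain ⟨j, h1, h2⟩ := exists_dyadic x
  have hj : j ≤ N := by
    by_contra hc
    have : (4 : ℝ) ^ (N + 1) ≤ 4 ^ j := pow_le_pow_right₀ (by norm_num) (by omega)
    linarith
  have hg := h.growth_near
  have hg' := abs_le.1 hg
  have hm := abs_modelWeight_sub_le (r := growth ε) (N := N) (by linarith) (by linarith) h1 h2
  rw [min_eq_left hj] at hm
  have hd := h.dyadic x j h1 h2
  have hp : 0 < growth ε ^ j := pow_pos h.growth_pos j
  have h3 : 6 * |growth ε - 1| * growth ε ^ j ≤ 6 * (1 / 200) * growth ε ^ j := by gcongr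
  have hm' := abs_le.1 (hm.trans h3)
  have hd' := abs_le.1 hd
  rw [abs_le]; constructor <;> linarith

/-- For decaying weights this holds at all scales: beyond the cut-off the model levels off while `w`
continues to decrease. It lets the norm with `1 / w` control the one with the inverse model weight.
-/
theorem GoodWeight.le_modelWeight_of_le_one (h : GoodWeight ε) (h1 : growth ε ≤ 1) (N : ℕ) (x : ℝ) :
    weight ε x / aExp ε ≤ 2 * modelWeight (growth ε) N x := by
  obtain ⟨j, hj1, hj2⟩ := exists_dyadic x
  have hg := h.growth_near
  have hg' := abs_le.1 hg
  have hm := abs_modelWeight_sub_le (r := growth ε) (N := N) (by linarith) (by linarith) hj1 hj2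
  have hd := abs_le.1 (h.dyadic x j hj1 hj2)
  have hp : growth ε ^ j ≤ growth ε ^ (min j N) :=
    pow_le_pow_of_le_one h.growth_pos.le h1 (min_le_left _ _)
  have hp0 : 0 < growth ε ^ j := pow_pos h.growth_pos _
  have h3 : 6 * |growth ε - 1| * growth ε ^ (min j N) ≤ 6 * (1 / 200) * growth ε ^ (min j N) := by
    have := pow_pos h.growth_pos (min j N)
    gcongr
  have hm' := abs_le.1 (hm.trans h3)
  linarith

/-- The growth factor exceeds `4^{-1/4} = 1/√2`. This lower bound is the source of the exponent
`1/8` in the final estimates. -/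
theorem GoodWeight.le_weight (h : GoodWeight ε) (x : ℝ) :
    1 / 2 * (1 + x ^ 2) ^ (-(1 / 4) : ℝ) ≤ weight ε x := by
  obtain ⟨j, hj1, hj2⟩ := exists_dyadic x
  have hg' := abs_le.1 h.growth_near
  have hd := abs_le.1 (h.dyadic x j hj1 hj2)
  obtain ⟨ha, ha'⟩ := h.a_mem
  have h1 : (1 + x ^ 2) ^ (-(1 / 4) : ℝ) ≤ growth ε ^ j := by
    calc (1 + x ^ 2) ^ (-(1 / 4) : ℝ) ≤ ((4 : ℝ) ^ j) ^ (-(1 / 4) : ℝ) :=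
          Real.rpow_le_rpow_of_nonpos (by positivity) hj1 (by norm_num)
      _ = ((4 : ℝ) ^ (-(1 / 4) : ℝ)) ^ j := by
          rw [← Real.rpow_natCast, ← Real.rpow_natCast, ← Real.rpow_mul (by norm_num),
            ← Real.rpow_mul (by norm_num), mul_comm]
      _ ≤ growth ε ^ j := by
          refine pow_le_pow_left₀ (by positivity) ?_ j
          have e : (4 : ℝ) ^ (-(1 / 4) : ℝ) = (2 : ℝ) ^ (-(1 / 2) : ℝ) := by
            rw [show (4 : ℝ) = 2 ^ (2 : ℝ) by norm_num, ← Real.rpow_mul (by norm_num)]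
            norm_num
          rw [e, Real.rpow_neg (by norm_num), ← Real.sqrt_eq_rpow]
          have : (1.25 : ℝ) ≤ Real.sqrt 2 := Real.le_sqrt_of_sq_le (by norm_num)
          calc (Real.sqrt 2)⁻¹ ≤ (1.25 : ℝ)⁻¹ := inv_anti₀ (by norm_num) this
            _ ≤ _ := by norm_num; linarith
  have hp : 0 < growth ε ^ j := pow_pos h.growth_pos _
  have h2 : 31 / 32 * growth ε ^ j ≤ weight ε x / aExp ε := by linarith
  rw [le_div_iff₀ (by linarith)] at h2
  nlinarith

end

end SelfSimilar

/-! ### The Hilbert transform as a bounded operator, and weak limits in `L²`. -/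

namespace SelfSimilar
open Filter Topology
open scoped ComplexConjugate

/-- Multiplication by the symbol of the Hilbert transform. -/
noncomputable def symbolCLM :
    Lp ℂ 2 (volume : Measure ℝ) →L[ℂ] Lp ℂ 2 (volume : Measure ℝ) :=
  LinearMap.mkContinuous
    { toFun := fun f => (memLp_hilbertSymbol_mul (Lp.memLp f)).toLp _
      map_add' := fun f g => by
        rw [← MemLp.toLp_add]
        refine MemLp.toLp_congr _ _ ?_
        filter_upwards [Lp.coeFn_add f g] with ξ h
        simp only [h, Pi.add_apply]; ring
      map_smul' := fun c f => by
        rw [RingHom.id_apply, ← MemLp.toLp_const_smul]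
        refine MemLp.toLp_congr _ _ ?_
        filter_upwards [Lp.coeFn_smul c f] with ξ h
        simp only [h, Pi.smul_apply, smul_eq_mul]; ring } 1 (fun f => by
      rw [one_mul]
      refine Lp.norm_le_norm_of_ae_le ?_
      filter_upwards [(memLp_hilbertSymbol_mul (Lp.memLp f)).coeFn_toLp] with ξ h
      simp only [LinearMap.coe_mk, AddHom.coe_mk]
      rw [h, norm_mul]
      exact mul_le_of_le_one_left (norm_nonneg _) (norm_hilbertSymbol_le ξ))

/-- The Hilbert transform as a bounded operator. -/
noncomputable def hilbertCLM :
    Lp ℂ 2 (volume : Measure ℝ) →L[ℂ] Lp ℂ 2 (volume : Measure ℝ) :=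
  (((Lp.fourierTransformₗᵢ ℝ ℂ).symm.toContinuousLinearEquiv :
      Lp ℂ 2 (volume : Measure ℝ) →L[ℂ] Lp ℂ 2 (volume : Measure ℝ)).comp symbolCLM).comp
    ((Lp.fourierTransformₗᵢ ℝ ℂ).toContinuousLinearEquiv :
      Lp ℂ 2 (volume : Measure ℝ) →L[ℂ] Lp ℂ 2 (volume : Measure ℝ))

theorem hilbertCLM_apply (f : Lp ℂ 2 (volume : Measure ℝ)) : hilbertCLM f = hilbertL2 f := rfl

theorem fourier_hilbertCLM (f : Lp ℂ 2 (volume : Measure ℝ)) :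
    (𝓕 (hilbertCLM f) : Lp ℂ 2 (volume : Measure ℝ)) =ᵐ[volume]
      fun ξ => hilbertSymbol ξ * (𝓕 f : Lp ℂ 2 (volume : Measure ℝ)) ξ := by
  rw [hilbertCLM_apply, hilbertL2, FourierTransform.fourier_fourierInv_eq]
  exact (memLp_hilbertSymbol_mul (Lp.memLp (𝓕 f))).coeFn_toLp

/-- The inclusion of real into complex square integrable functions. -/
noncomputable def coeCLM : Lp ℝ 2 (volume : Measure ℝ) →L[ℝ] Lp ℂ 2 (volume : Measure ℝ) :=
  Complex.ofRealCLM.compLpL 2 volume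

theorem coeCLM_ae (f : Lp ℝ 2 (volume : Measure ℝ)) :
    coeCLM f =ᵐ[volume] fun x => ((f x : ℝ) : ℂ) :=
  Complex.ofRealCLM.coeFn_compLpL f

theorem coeCLM_toLp {f : ℝ → ℝ} (hf : MemLp f 2 volume) :
    coeCLM (hf.toLp f) = (memLp_coe hf).toLp _ := by
  refine Lp.ext ?_
  filter_upwards [coeCLM_ae (hf.toLp f), hf.coeFn_toLp, (memLp_coe hf).coeFn_toLp] with x h1 h2 h3
  rw [h1, h2, h3]

/-- `i ℍ` on real functions. -/
noncomputable def iHilbert : Lp ℝ 2 (volume : Measure ℝ) →L[ℝ] Lp ℂ 2 (volume : Measure ℝ) :=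
  Complex.I • (hilbertCLM.restrictScalars ℝ).comp coeCLM

theorem iHilbert_apply (f : Lp ℝ 2 (volume : Measure ℝ)) :
    iHilbert f = Complex.I • hilbertCLM (coeCLM f) := rfl

theorem I_mul_hilbert_ae {f : ℝ → ℝ} (hf : MemLp f 2 volume) :
    (fun x => Complex.I * hilbert (fun y => (f y : ℂ)) x) =ᵐ[volume] iHilbert (hf.toLp f) := by
  rw [iHilbert_apply, coeCLM_toLp, hilbertCLM_apply, hilbert, dif_pos (memLp_coe hf)]
  filter_upwards [Lp.coeFn_smul Complex.I (hilbertL2 ((memLp_coe hf).toLp _))] with x hx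
  rw [hx]; rfl

theorem fourier_iHilbert (f : Lp ℝ 2 (volume : Measure ℝ)) :
    (𝓕 (iHilbert f) : Lp ℂ 2 (volume : Measure ℝ)) =ᵐ[volume]
      fun ξ => Complex.I * (hilbertSymbol ξ * (𝓕 (coeCLM f) : Lp ℂ 2 (volume : Measure ℝ)) ξ) := by
  rw [iHilbert_apply, FourierTransform.fourier_smul]
  filter_upwards [Lp.coeFn_smul Complex.I (𝓕 (hilbertCLM (coeCLM f)) : Lp ℂ 2 (volume : Measure ℝ)),
    fourier_hilbertCLM (coeCLM f)] with ξ h1 h2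
  rw [h1, Pi.smul_apply, smul_eq_mul, h2]

theorem fourier_coeCLM_synth {h : ℝ → ℂ} (hh : IsHermTest h) :
    (𝓕 (coeCLM (hh.memLp_synth.toLp _)) : Lp ℂ 2 (volume : Measure ℝ)) =ᵐ[volume] h := by
  have e : coeCLM (hh.memLp_synth.toLp _) = (𝓕⁻ hh.schwartz).toLp 2 := by
    refine Lp.ext ?_
    filter_upwards [coeCLM_ae (hh.memLp_synth.toLp _), hh.memLp_synth.coeFn_toLp,
      (𝓕⁻ hh.schwartz).coeFn_toLp 2 volume] with x h1 h2 h3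
    rw [h1, h2, h3, hh.fourierInv_schwartz]
  rw [e, SchwartzMap.toLp_fourier_eq, FourierTransform.fourier_fourierInv_eq]
  filter_upwards [hh.schwartz.coeFn_toLp 2 volume] with x hx
  rw [hx, hh.coe_schwartz]

/-- On the frequency side, `i · (-sgn ξ) · (2πiξ)³ = -|2πξ|³`. -/
theorem iHilbert_third {g : ℝ → ℂ} (h : IsSpectral g) :
    iHilbert (h.test_mulD.test_mulD.test_mulD.memLp_synth.toLp _) =
      -coeCLM (h.test_mulA.memLp_synth.toLp _) := by
  have hinj : Function.Injective fun f : Lp ℂ 2 (volume : Measure ℝ) =>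
      (𝓕 f : Lp ℂ 2 (volume : Measure ℝ)) := (Lp.fourierTransformₗᵢ ℝ ℂ).injective
  apply hinj
  simp only [FourierTransform.fourier_neg]
  refine Lp.ext ?_
  filter_upwards [fourier_iHilbert (h.test_mulD.test_mulD.test_mulD.memLp_synth.toLp _),
    fourier_coeCLM_synth h.test_mulD.test_mulD.test_mulD.toIsHermTest,
    fourier_coeCLM_synth h.test_mulA.toIsHermTest,
    Lp.coeFn_neg (𝓕 (coeCLM (h.test_mulA.memLp_synth.toLp _)) : Lp ℂ 2 (volume : Measure ℝ))]
    with ξ h1 h2 h3 h4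
  rw [h1, h2, h4, Pi.neg_apply, h3]
  simp only [mulD, mulA, symD, symA, hilbertSymbol]
  have e : ((|2 * Real.pi * ξ| ^ 3 : ℝ) : ℂ) =
      ((Real.sign ξ : ℝ) : ℂ) * (2 * Real.pi * ξ) ^ 3 := by
    have : |2 * Real.pi * ξ| ^ 3 = Real.sign ξ * (2 * Real.pi * ξ) ^ 3 := by
      have hp := Real.pi_pos
      rw [abs_mul, abs_of_pos (by positivity : 0 < 2 * Real.pi)]
      rcases lt_trichotomy ξ 0 with h | h | h
      · rw [abs_of_neg h, Real.sign_of_neg h]; ring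
      · simp [h]
      · rw [abs_of_pos h, Real.sign_of_pos h]; ring
    rw [this]; push_cast; ring
  rw [e]
  have hI : Complex.I ^ 4 = 1 := Complex.I_pow_four
  linear_combination (-(Real.sign ξ : ℂ) * (2 * Real.pi * ξ) ^ 3 * g ξ) * hI

/-- Bounded sequences in `L²` have weak limits along the hyperfilter. -/
theorem exists_weak_limit {f : ℕ → ℝ → ℝ} (hf : ∀ n, MemLp (f n) 2 volume) {b : ℕ → ℝ} {B : ℝ}
    (hb : ∀ n, ∫ x, f n x ^ 2 ≤ b n) (hB : Tendsto b atTop (𝓝 B)) :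
    ∃ h : ℝ → ℝ, ∃ hh : MemLp h 2 volume, ∫ x, h x ^ 2 ≤ B ∧
      (∀ ℓ : Lp ℝ 2 (volume : Measure ℝ) →L[ℝ] ℝ,
        Tendsto (fun n => ℓ ((hf n).toLp _)) (hyperfilter ℕ) (𝓝 (ℓ (hh.toLp h)))) ∧
      ∀ φ : ℝ → ℝ, MemLp φ 2 volume →
        Tendsto (fun n => ∫ x, f n x * φ x) (hyperfilter ℕ) (𝓝 (∫ x, h x * φ x)) := by
  obtain ⟨R, hR⟩ := hB.bddAbove_range
  have hR0 : 0 ≤ R := (integral_nonneg fun x => sq_nonneg (f 0 x)).trans ((hb 0).trans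
    (hR ⟨0, rfl⟩))
  set F : ℕ → Lp ℝ 2 (volume : Measure ℝ) := fun n => (hf n).toLp _ with hF
  have hFn : ∀ n, ‖F n‖ ^ 2 ≤ b n := fun n => by rw [norm_toLp_sq]; exact hb n
  have hFR : ∀ n, ‖F n‖ ≤ Real.sqrt R := fun n =>
    Real.le_sqrt_of_sq_le ((hFn n).trans (hR ⟨n, rfl⟩))
  let D := InnerProductSpace.toDual ℝ (Lp ℝ 2 (volume : Measure ℝ))
  set G : ℕ → WeakDual ℝ (Lp ℝ 2 (volume : Measure ℝ)) :=
    fun n => StrongDual.toWeakDual (D (F n)) with hG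
  -- Banach–Alaoglu through the Riesz isometry. Along one ultrafilter no subsequence is extracted,
  -- so the limits of different sequences remain compatible.
  have hK := WeakDual.isCompact_closedBall (𝕜 := ℝ) (0 : StrongDual ℝ (Lp ℝ 2 (volume : Measure ℝ)))
    (Real.sqrt R)
  obtain ⟨y, -, hy⟩ := hK.ultrafilter_le_nhds' ((hyperfilter ℕ : Ultrafilter ℕ).map G) (by
    refine Ultrafilter.mem_map.2 (Filter.univ_mem' fun n => ?_)
    simp only [Set.mem_preimage, Metric.mem_closedBall, dist_zero_right]
    change ‖D (F n)‖ ≤ _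
    rw [LinearIsometryEquiv.norm_map]
    exact hFR n)
  set h := D.symm (WeakDual.toStrongDual y) with hh
  have hlim : ∀ z, Tendsto (fun n => inner ℝ (F n) z) (hyperfilter ℕ) (𝓝 (inner ℝ h z)) := by
    intro z
    have h1 : Tendsto G (hyperfilter ℕ) (𝓝 y) := hy
    have h2 := ((WeakDual.eval_continuous z).tendsto y).comp h1
    have e : y z = inner ℝ h z := by
      rw [hh, ← InnerProductSpace.toDual_apply_apply (𝕜 := ℝ)]
      change _ = (D (D.symm _)) z
      rw [LinearIsometryEquiv.apply_symm_apply]; rfl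
    rw [e] at h2
    exact h2
  -- Weak lower semicontinuity, from `⟨Fₙ, h⟩ ≤ (‖Fₙ‖² + ‖h‖²) / 2`.
  have hnorm : ‖h‖ ^ 2 ≤ B := by
    have h1 := hlim h
    rw [real_inner_self_eq_norm_sq] at h1
    have h2 : Tendsto (fun n => (b n + ‖h‖ ^ 2) / 2) (hyperfilter ℕ : Filter ℕ)
        (𝓝 ((B + ‖h‖ ^ 2) / 2)) :=
      ((hB.add_const _).div_const 2).mono_left Nat.hyperfilter_le_atTop
    have h3 := le_of_tendsto_of_tendsto' h1 h2 fun n => by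
      have := real_inner_le_norm (F n) h
      nlinarith [hFn n, sq_nonneg (‖F n‖ - ‖h‖)]
    linarith
  have hm := Lp.memLp h
  have he : hm.toLp h = h := Lp.toLp_coeFn h hm
  refine ⟨h, hm, ?_, fun ℓ => ?_, fun φ hφ => ?_⟩
  · rw [← norm_toLp_sq hm, he]; exact hnorm
  · rw [he]
    have e : ∀ z, ℓ z = inner ℝ z (D.symm ℓ) := fun z => by
      rw [real_inner_comm]; exact (InnerProductSpace.toDual_symm_apply).symm
    simp only [e]
    exact hlim _
  · have := hlim (hφ.toLp φ)
    rw [← he, inner_toLp hm hφ] at this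
    refine this.congr fun n => ?_
    rw [hF, inner_toLp]

end SelfSimilar

/-! ### Weak derivatives and truncation of the weight. -/

namespace SelfSimilar
open Filter Topology

theorem IsWeakDeriv.ae_eq {k : ℕ} {v g g' : ℝ → ℝ} (h : IsWeakDeriv k v g)
    (h' : IsWeakDeriv k v g') : g =ᵐ[volume] g' := by
  refine ae_eq_of_integral_contDiff_smul_eq h.2.1 h'.2.1 fun φ hφ hc => ?_
  have h1 := h.2.2 φ hφ hc
  rw [h'.2.2 φ hφ hc] at h1
  have h2 := mul_left_cancel₀ (pow_ne_zero k (by norm_num : (-1 : ℝ) ≠ 0)) h1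
  simp only [smul_eq_mul, mul_comm (φ _)]
  exact h2.symm

theorem HasWeakDeriv.isWeakDeriv {k : ℕ} {v : ℝ → ℝ} (h : HasWeakDeriv k v) :
    IsWeakDeriv k v (weakDeriv k v) := by
  rw [weakDeriv, dif_pos h]
  exact Classical.choose_spec h

theorem IsWeakDeriv.weakDeriv_ae {k : ℕ} {v g : ℝ → ℝ} (h : IsWeakDeriv k v g) :
    weakDeriv k v =ᵐ[volume] g :=
  (HasWeakDeriv.isWeakDeriv ⟨g, h⟩).ae_eq h

theorem locallyIntegrable_continuous_mul {c f : ℝ → ℝ} (hc : Continuous c)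
    (hf : LocallyIntegrable f volume) : LocallyIntegrable (fun x => c x * f x) volume := by
  rw [locallyIntegrable_iff] at hf ⊢
  exact fun K hK => (hf K hK).continuousOn_mul hc.continuousOn hK

theorem memLp_continuous_mul_test {c φ : ℝ → ℝ} (hc : Continuous c) (hφ : Continuous φ)
    (hs : HasCompactSupport φ) : MemLp (fun x => c x * φ x) 2 volume :=
  (hc.mul hφ).memLp_of_hasCompactSupport hs.mul_left

theorem integral_synth_mul_deriv {g : ℝ → ℂ} (h : IsSpectral g) {φ : ℝ → ℝ}
    (hφ : ContDiff ℝ ∞ φ) (hs : HasCompactSupport φ) :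
    ∫ x, synth g x * deriv φ x = -∫ x, synth (mulD g) x * φ x := by
  have hd : Continuous (deriv φ) := hφ.continuous_deriv (by simp)
  have hφc := hφ.continuous
  have c1 := continuous_synth h.toIsHermTest
  have c2 := continuous_synth h.test_mulD.toIsHermTest
  refine integral_mul_deriv_eq_deriv_mul_of_integrable (fun x _ => h.hasDerivAt_synth x)
    (fun x _ => (hφ.differentiable (by simp) x).hasDerivAt) ?_ ?_ ?_
  · exact (c1.mul hd).integrable_of_hasCompactSupport hs.deriv.mul_left
  · exact (c2.mul hφc).integrable_of_hasCompactSupport hs.mul_left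
  · exact (c1.mul hφc).integrable_of_hasCompactSupport hs.mul_left

theorem contDiff_deriv {φ : ℝ → ℝ} (hφ : ContDiff ℝ ∞ φ) : ContDiff ℝ ∞ (deriv φ) :=
  (contDiff_infty_iff_deriv.1 hφ).2

/-- Against a fixed test function the truncated weight eventually coincides with `w / a`, so the
truncation disappears in weak limits. -/
theorem eventually_support_subset {φ : ℝ → ℝ} (hs : HasCompactSupport φ) :
    ∀ᶠ N : ℕ in atTop, ∀ x, φ x ≠ 0 → 1 + x ^ 2 < 4 ^ (N + 1) := by
  obtain ⟨R, hR⟩ := hs.isCompact.isBounded.exists_norm_le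
  have h1 : Tendsto (fun N : ℕ => (4 : ℝ) ^ (N + 1)) atTop atTop :=
    (tendsto_pow_atTop_atTop_of_one_lt (by norm_num)).comp (tendsto_add_atTop_nat 1)
  filter_upwards [h1.eventually_gt_atTop (1 + R ^ 2)] with N hN x hx
  have h2 := hR x (subset_tsupport φ hx)
  rw [Real.norm_eq_abs] at h2
  have : x ^ 2 ≤ R ^ 2 := by rw [← sq_abs]; exact pow_le_pow_left₀ (abs_nonneg _) h2 2
  linarith

/-- The ratio of the truncated weight to its dyadic model. -/
noncomputable def truncRatio (ε : ℝ) (N : ℕ) (x : ℝ) : ℝ :=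
  if 1 + x ^ 2 < 4 ^ (N + 1) then weight ε x / aExp ε / modelWeight (growth ε) N x else 1

/-- The weight `w / a`, frozen beyond a large scale. -/
noncomputable def truncWeight (ε : ℝ) (N : ℕ) (x : ℝ) : ℝ :=
  truncRatio ε N x * modelWeight (growth ε) N x

section
variable {ε : ℝ}

theorem GoodWeight.measurable_truncRatio (h : GoodWeight ε) (N : ℕ) :
    Measurable (truncRatio ε N) :=
  Measurable.ite (measurableSet_lt (by fun_prop) measurable_const)
    ((h.continuous.measurable.div_const _).div (measurable_modelWeight _ N)) measurable_const

theorem GoodWeight.truncRatio_near (h : GoodWeight ε) (N : ℕ) (x : ℝ) :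
    |truncRatio ε N x - 1| ≤ 1 / 10 := by
  unfold truncRatio
  split_ifs with hx
  · have hp := modelWeight_pos h.growth_near' N x
    have := h.near_modelWeight hx
    have e : weight ε x / aExp ε / modelWeight (growth ε) N x - 1 =
      (weight ε x / aExp ε - modelWeight (growth ε) N x) / modelWeight (growth ε) N x := by
      field_simp
    rw [e, abs_div, abs_of_pos hp, div_le_iff₀ hp]
    exact this
  · norm_num

theorem GoodWeight.truncWeight_eq (h : GoodWeight ε) {N : ℕ} {x : ℝ}
    (hx : 1 + x ^ 2 < 4 ^ (N + 1)) : truncWeight ε N x = weight ε x / aExp ε := by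
  rw [truncWeight, truncRatio, if_pos hx, div_mul_cancel₀ _ (modelWeight_pos h.growth_near' N x).ne']

theorem GoodWeight.truncWeight_pos (h : GoodWeight ε) (N : ℕ) (x : ℝ) : 0 < truncWeight ε N x := by
  have := abs_le.1 (h.truncRatio_near N x)
  exact mul_pos (by linarith) (modelWeight_pos h.growth_near' N x)

theorem GoodWeight.truncWeight_le (h : GoodWeight ε) (N : ℕ) (x : ℝ) :
    truncWeight ε N x ≤ 2 * modelWeight (growth ε) N x := by
  have := abs_le.1 (h.truncRatio_near N x)
  exact mul_le_mul_of_nonneg_right (by linarith) (modelWeight_pos h.growth_near' N x).le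

/-- This is where both data norms enter: a growing model weight is at least one, and a decaying one
dominates a multiple of `w`. -/
theorem GoodWeight.inv_modelWeight_le (h : GoodWeight ε) (N : ℕ) (x : ℝ) :
    (modelWeight (growth ε) N x)⁻¹ ≤ 1 + 3 * (weight ε x)⁻¹ := by
  have hp := modelWeight_pos h.growth_near' N x
  have hw := weight_pos ε x
  rcases le_total 1 (growth ε) with h1 | h1
  · have := one_le_modelWeight h1 N x
    have := inv_le_one_of_one_le₀ this
    have : 0 < (weight ε x)⁻¹ := inv_pos.2 hw
    linarith
  · have h2 := h.le_modelWeight_of_le_one h1 N x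
    obtain ⟨ha, ha'⟩ := h.a_mem
    have h3 : weight ε x ≤ 3 * modelWeight (growth ε) N x := by
      rw [div_le_iff₀ (by linarith)] at h2; nlinarith
    have h4 : (modelWeight (growth ε) N x)⁻¹ ≤ 3 * (weight ε x)⁻¹ := by
      rw [← div_eq_mul_inv, le_div_iff₀ hw, ← div_eq_inv_mul, div_le_iff₀ hp]
      exact h3
    linarith

end

end SelfSimilar

/-! ### Existence by weak limits of approximate solutions. -/

namespace SelfSimilar
open Filter Topology

section
variable {ε : ℝ}

theorem integrable_sq_div_weight {F : ℝ → ℝ}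
    (hFw : MemLp (fun x => weight ε x ^ (-(1 / 2) : ℝ) * F x) 2 volume) :
    Integrable fun x => F x ^ 2 / weight ε x := by
  refine hFw.integrable_sq.congr (ae_of_all _ fun x => ?_)
  have hw := weight_pos ε x
  simp only
  rw [mul_pow, ← Real.rpow_natCast (weight ε x ^ (-(1 / 2) : ℝ)), ← Real.rpow_mul hw.le]
  norm_num
  rw [Real.rpow_neg_one]
  field_simp

/-- Approximate solutions of the truncated equations, with uniform bounds. -/
theorem GoodWeight.exists_approx (h : GoodWeight ε) {F : ℝ → ℝ} (hF : MemLp F 2 volume)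
    (hFw : MemLp (fun x => weight ε x ^ (-(1 / 2) : ℝ) * F x) 2 volume) (N : ℕ) :
    ∃ g, IsSpectral g ∧ MemLp (linOp (truncWeight ε N) g) 2 volume ∧
      ∫ x, (linOp (truncWeight ε N) g x - F x) ^ 2 ≤ 1 / ((N : ℝ) + 1) ∧
      (∫ x, modelWeight (growth ε) N x * synth g x ^ 2) +
      (∫ x, modelWeight (growth ε) N x * (x * synth (mulD g) x) ^ 2) +
      (∫ x, synth (mulD g) x ^ 2) + (∫ x, synth (mulA g) x ^ 2) ≤
      10 ^ 9 * ((∫ x, F x ^ 2) + (∫ x, F x ^ 2 / weight ε x) + 1 / ((N : ℝ) + 1)) := by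
  obtain ⟨m, M, hm, hbd⟩ := exists_modelWeight_bounds h.growth_near' N
  have hN : (0 : ℝ) < 1 / ((N : ℝ) + 1) := by positivity
  -- The tolerance contains the lower bound `m` of the model weight, so that the residual is small
  -- in the norm with the inverse weight as well.
  obtain ⟨g, hg, hL, hη⟩ := exists_linOp_approx h.growth_near' N (h.measurable_truncRatio N)
    (h.truncRatio_near N) hF (η := min 1 m * (1 / ((N : ℝ) + 1)))
    (mul_pos (lt_min one_pos hm) hN)
  have hmod := apriori_estimate hg h.growth_near' N (h.measurable_truncRatio N)
    (h.truncRatio_near N) rfl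
  change MemLp (linOp (truncWeight ε N) g) 2 volume at hL
  change ∫ x, (linOp (truncWeight ε N) g x - F x) ^ 2 ≤ _ at hη
  change _ ≤ 10 ^ 8 * ((∫ x, linOp (truncWeight ε N) g x ^ 2) +
    ∫ x, linOp (truncWeight ε N) g x ^ 2 / modelWeight (growth ε) N x) at hmod
  set L := linOp (truncWeight ε N) g with hLd
  set δ := 1 / ((N : ℝ) + 1)
  have hη1 : ∫ x, (L x - F x) ^ 2 ≤ δ :=
    hη.trans (mul_le_of_le_one_left hN.le (min_le_left _ _))
  have hη2 : (∫ x, (L x - F x) ^ 2) / m ≤ δ := by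
    rw [div_le_iff₀ hm, mul_comm]
    exact hη.trans (mul_le_mul_of_nonneg_right (min_le_right _ _) hN.le)
  have iLF : Integrable fun x => (L x - F x) ^ 2 := (hL.sub hF).integrable_sq
  have iF : Integrable fun x => F x ^ 2 := hF.integrable_sq
  have iFw := integrable_sq_div_weight hFw
  have hpos := fun x => modelWeight_pos h.growth_near' N x
  have e1 : ∫ x, L x ^ 2 ≤ 2 * (∫ x, F x ^ 2) + 2 * ∫ x, (L x - F x) ^ 2 := by
    rw [← integral_const_mul, ← integral_const_mul, ← integral_add (iF.const_mul 2) (iLF.const_mul 2)]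
    refine integral_mono hL.integrable_sq ((iF.const_mul 2).add (iLF.const_mul 2)) fun x => ?_
    nlinarith [sq_nonneg (L x - 2 * F x)]
  have e2 : ∫ x, L x ^ 2 / modelWeight (growth ε) N x ≤
      2 * (∫ x, F x ^ 2) + 6 * (∫ x, F x ^ 2 / weight ε x) + 2 * ((∫ x, (L x - F x) ^ 2) / m) := by
    have i3 : Integrable fun x => 2 * F x ^ 2 + 6 * (F x ^ 2 / weight ε x) :=
      (iF.const_mul 2).add (iFw.const_mul 6)
    have i4 : Integrable fun x => 2 * ((L x - F x) ^ 2 / m) := (iLF.div_const m).const_mul 2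
    rw [← integral_div, ← integral_const_mul, ← integral_const_mul, ← integral_const_mul,
      ← integral_add (iF.const_mul 2) (iFw.const_mul 6), ← integral_add i3 i4]
    refine integral_mono_of_nonneg
      (ae_of_all _ fun x => div_nonneg (sq_nonneg _) (hpos x).le) (i3.add i4)
      (ae_of_all _ fun x => ?_)
    have q1 : L x ^ 2 ≤ 2 * F x ^ 2 + 2 * (L x - F x) ^ 2 := by nlinarith [sq_nonneg (L x - 2 * F x)]
    have q2 := h.inv_modelWeight_le N x
    have q3 : (modelWeight (growth ε) N x)⁻¹ ≤ m⁻¹ := inv_anti₀ hm (hbd x).1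
    have q0 : 0 < (modelWeight (growth ε) N x)⁻¹ := inv_pos.2 (hpos x)
    simp only [div_eq_mul_inv]
    calc L x ^ 2 * (modelWeight (growth ε) N x)⁻¹
        ≤ (2 * F x ^ 2 + 2 * (L x - F x) ^ 2) * (modelWeight (growth ε) N x)⁻¹ := by gcongr
      _ = 2 * (F x ^ 2 * (modelWeight (growth ε) N x)⁻¹) +
          2 * ((L x - F x) ^ 2 * (modelWeight (growth ε) N x)⁻¹) := by ring
      _ ≤ 2 * (F x ^ 2 * (1 + 3 * (weight ε x)⁻¹)) + 2 * ((L x - F x) ^ 2 * m⁻¹) := by gcongr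
      _ = _ := by ring
  have n1 : 0 ≤ ∫ x, F x ^ 2 := integral_nonneg fun x => sq_nonneg _
  have n2 : 0 ≤ ∫ x, F x ^ 2 / weight ε x :=
    integral_nonneg fun x => div_nonneg (sq_nonneg _) (weight_pos ε x).le
  refine ⟨g, hg, hL, hη1, hmod.trans ?_⟩
  linarith

/-- The approximate solutions need not be bounded in `L²` when the weight decays. Weak limits are
therefore taken after multiplication by the root of the truncated weight, and `v` is recovered by
dividing by `√(w / a)`. -/
theorem GoodWeight.exists_solution (h : GoodWeight ε) {F : ℝ → ℝ} (hF : MemLp F 2 volume)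
    (hFw : MemLp (fun x => weight ε x ^ (-(1 / 2) : ℝ) * F x) 2 volume) :
    ∃ v u k : ℝ → ℝ, IsWeakDeriv 1 v u ∧ IsWeakDeriv 3 v k ∧
      MemL2w ε v ∧ MemL2w ε (fun x => x * u x) ∧ MemLp u 2 volume ∧ MemLp k 2 volume ∧
      (∀ᵐ x ∂(volume : Measure ℝ), Complex.I * hilbert (fun y => (k y : ℂ)) x
        + ((weight ε x * (x / (3 * aExp ε)) * u x : ℝ) : ℂ) = (F x : ℂ)) ∧
      (∫ x, (weight ε x ^ (1 / 2 : ℝ) * v x) ^ 2 ≤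
        10 ^ 10 * ((∫ x, F x ^ 2) + ∫ x, F x ^ 2 / weight ε x)) ∧
      (∫ x, (weight ε x ^ (1 / 2 : ℝ) * (x * u x)) ^ 2 ≤
        10 ^ 10 * ((∫ x, F x ^ 2) + ∫ x, F x ^ 2 / weight ε x)) ∧
      (∫ x, u x ^ 2 ≤ 10 ^ 10 * ((∫ x, F x ^ 2) + ∫ x, F x ^ 2 / weight ε x)) ∧
      (∫ x, k x ^ 2 ≤ 10 ^ 10 * ((∫ x, F x ^ 2) + ∫ x, F x ^ 2 / weight ε x)) := by
  choose g hg hL hη hmod using h.exists_approx hF hFw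
  set D := (∫ x, F x ^ 2) + ∫ x, F x ^ 2 / weight ε x with hD
  have hD0 : 0 ≤ D := add_nonneg (integral_nonneg fun x => sq_nonneg _)
    (integral_nonneg fun x => div_nonneg (sq_nonneg _) (weight_pos ε x).le)
  set W : ℝ → ℝ := fun x => weight ε x / aExp ε with hW
  obtain ⟨ha, ha'⟩ := h.a_mem
  have ha0 : 0 < aExp ε := by linarith
  have hWpos : ∀ x, 0 < W x := fun x => div_pos (weight_pos ε x) ha0
  have hWc : Continuous W := h.continuous.div_const _
  have hsW : Continuous fun x => Real.sqrt (W x) := hWc.sqrt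
  have hsWi : Continuous fun x => (Real.sqrt (W x))⁻¹ :=
    hsW.inv₀ fun x => (Real.sqrt_pos.2 (hWpos x)).ne'
  have hlim0 : Tendsto (fun N : ℕ => 1 / ((N : ℝ) + 1)) atTop (𝓝 0) :=
    tendsto_one_div_add_atTop_nhds_zero_nat
  have hlim : Tendsto (fun N : ℕ => 10 ^ 9 * (D + 1 / ((N : ℝ) + 1))) atTop (𝓝 (10 ^ 9 * D)) := by
    simpa using (hlim0.const_add D).const_mul (10 ^ 9)
  have hlim2 : Tendsto (fun N : ℕ => 2 * (10 ^ 9 * (D + 1 / ((N : ℝ) + 1)))) atTop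
      (𝓝 (2 * (10 ^ 9 * D))) := hlim.const_mul 2
  have hwn : ∀ N x, 0 ≤ modelWeight (growth ε) N x := fun N x =>
    (modelWeight_pos h.growth_near' N x).le
  have n1 : ∀ N, 0 ≤ ∫ x, modelWeight (growth ε) N x * synth (g N) x ^ 2 := fun N =>
    integral_nonneg fun x => mul_nonneg (hwn N x) (sq_nonneg _)
  have n2 : ∀ N, 0 ≤ ∫ x, modelWeight (growth ε) N x * (x * synth (mulD (g N)) x) ^ 2 := fun N =>
    integral_nonneg fun x => mul_nonneg (hwn N x) (sq_nonneg _)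
  have n3 : ∀ N, 0 ≤ ∫ x, synth (mulD (g N)) x ^ 2 := fun N => integral_nonneg fun x => sq_nonneg _
  have n4 : ∀ N, 0 ≤ ∫ x, synth (mulA (g N)) x ^ 2 := fun N => integral_nonneg fun x => sq_nonneg _
  have hTm : ∀ N, Measurable (truncWeight ε N) := fun N =>
    (h.measurable_truncRatio N).mul (measurable_modelWeight _ N)
  have hroot : ∀ N (p : ℝ → ℝ), MemLp p 2 volume →
      MemLp (fun x => Real.sqrt (truncWeight ε N x) * p x) 2 volume ∧
      ∫ x, (Real.sqrt (truncWeight ε N x) * p x) ^ 2 ≤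
        2 * ∫ x, modelWeight (growth ε) N x * p x ^ 2 := fun N p hp => by
    obtain ⟨m, M, hm, hbd⟩ := exists_modelWeight_bounds h.growth_near' N
    have hM : MemLp (fun x => Real.sqrt (truncWeight ε N x) * p x) 2 volume :=
      memLp_bdd_mul (M := Real.sqrt (2 * M)) (hTm N).sqrt.aestronglyMeasurable (fun x => by
        rw [abs_of_nonneg (Real.sqrt_nonneg _)]
        exact Real.sqrt_le_sqrt ((h.truncWeight_le N x).trans (by linarith [(hbd x).2]))) hp
    refine ⟨hM, ?_⟩
    rw [← integral_const_mul]
    refine integral_mono hM.integrable_sq ((integrable_bdd_mul_sq (M := M)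
      (measurable_modelWeight _ N).aestronglyMeasurable (fun x => by
        rw [abs_of_nonneg (hwn N x)]; exact (hbd x).2) hp).const_mul 2) fun x => ?_
    simp only
    rw [mul_pow, Real.sq_sqrt (h.truncWeight_pos N x).le, ← mul_assoc]
    exact mul_le_mul_of_nonneg_right (h.truncWeight_le N x) (sq_nonneg _)
  obtain ⟨p, hp, hpb, -, hpl⟩ := exists_weak_limit
    (fun N => (hroot N _ (hg N).memLp_synth).1)
    (b := fun N : ℕ => 2 * (10 ^ 9 * (D + 1 / ((N : ℝ) + 1))))
    (fun N => (hroot N _ (hg N).memLp_synth).2.trans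
      (by linarith [hmod N, n1 N, n2 N, n3 N, n4 N])) hlim2
  obtain ⟨q, hq, hqb, -, hql⟩ := exists_weak_limit
    (fun N => (hroot N _ (hg N).memLp_dilation).1)
    (b := fun N : ℕ => 2 * (10 ^ 9 * (D + 1 / ((N : ℝ) + 1))))
    (fun N => (hroot N _ (hg N).memLp_dilation).2.trans
      (by linarith [hmod N, n1 N, n2 N, n3 N, n4 N])) hlim2
  obtain ⟨u, hu, hub, -, hul⟩ := exists_weak_limit (fun N => (hg N).test_mulD.memLp_synth)
    (b := fun N : ℕ => 10 ^ 9 * (D + 1 / ((N : ℝ) + 1)))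
    (fun N => by linarith [hmod N, n1 N, n2 N, n3 N, n4 N]) hlim
  obtain ⟨k, hk, hkb, hkL, hkl⟩ := exists_weak_limit
    (fun N => (hg N).test_mulD.test_mulD.test_mulD.memLp_synth)
    (b := fun N : ℕ => 10 ^ 9 * (D + 1 / ((N : ℝ) + 1)))
    (fun N => (integral_third_sq (hg N)).le.trans
      (by linarith [hmod N, n1 N, n2 N, n3 N, n4 N])) hlim
  obtain ⟨z, hz, -, hzL, hzl⟩ := exists_weak_limit (fun N => (hg N).test_mulA.memLp_synth)
    (b := fun N : ℕ => 10 ^ 9 * (D + 1 / ((N : ℝ) + 1)))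
    (fun N => by linarith [hmod N, n1 N, n2 N, n3 N, n4 N]) hlim
  obtain ⟨e, he, heb, -, hel⟩ := exists_weak_limit (fun N => (hL N).sub hF)
    (b := fun N : ℕ => 1 / ((N : ℝ) + 1)) (fun N => hη N) hlim0
  -- The norms of the residuals tend to zero, hence so does that of their weak limit.
  have he0 : e =ᵐ[volume] 0 := by
    have h1 := (integral_eq_zero_iff_of_nonneg (fun x => sq_nonneg (e x)) he.integrable_sq).1
      (le_antisymm heb (integral_nonneg fun x => sq_nonneg _))
    filter_upwards [h1] with x hx
    simpa using hx
  have hU : (hyperfilter ℕ : Filter ℕ) ≤ atTop := Nat.hyperfilter_le_atTop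
  set v : ℝ → ℝ := fun x => (Real.sqrt (W x))⁻¹ * p x with hv
  have hvl : ∀ φ : ℝ → ℝ, Continuous φ → HasCompactSupport φ →
      Tendsto (fun N => ∫ x, synth (g N) x * φ x) (hyperfilter ℕ) (𝓝 (∫ x, v x * φ x)) := by
    intro φ hφ hs
    have h1 := hpl _ (memLp_continuous_mul_test hsWi hφ hs)
    have e1 : ∫ x, v x * φ x = ∫ x, p x * ((Real.sqrt (W x))⁻¹ * φ x) := by
      congr 1; ext x; simp only [hv]; ring
    rw [e1]
    refine h1.congr' (hU ?_)
    filter_upwards [eventually_support_subset hs] with N hN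
    congr 1; ext x
    rcases eq_or_ne (φ x) 0 with h0 | h0
    · simp [h0]
    · rw [h.truncWeight_eq (hN x h0)]
      have : Real.sqrt (weight ε x / aExp ε) ≠ 0 := (Real.sqrt_pos.2 (hWpos x)).ne'
      simp only [hW]
      field_simp
  have hvloc : LocallyIntegrable v volume :=
    locallyIntegrable_continuous_mul hsWi (hp.locallyIntegrable (by norm_num))
  -- Tested against a fixed `φ`, multiplication by `√W x` can be moved onto `φ`, which identifies
  -- this limit through that of the derivatives.
  have hqe : q =ᵐ[volume] fun x => Real.sqrt (W x) * (x * u x) := by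
    have hloc : LocallyIntegrable (fun x => Real.sqrt (W x) * (x * u x)) volume :=
      locallyIntegrable_continuous_mul hsW
        (locallyIntegrable_continuous_mul continuous_id (hu.locallyIntegrable (by norm_num)))
    refine ae_eq_of_integral_contDiff_smul_eq (hq.locallyIntegrable (by norm_num)) hloc
      fun φ hφ hs => ?_
    have h1 := hql φ (hφ.continuous.memLp_of_hasCompactSupport hs)
    have h2 := hul _ (memLp_continuous_mul_test (hsW.mul continuous_id) hφ.continuous hs)
    have h3 := tendsto_nhds_unique h1 (h2.congr' (hU (by
      filter_upwards [eventually_support_subset hs] with N hN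
      congr 1; ext x
      rcases eq_or_ne (φ x) 0 with h0 | h0
      · simp [h0]
      · rw [h.truncWeight_eq (hN x h0)]
        simp only [hW, Pi.mul_apply, id]
        ring)))
    simp only [smul_eq_mul]
    calc ∫ x, φ x * q x = ∫ x, q x * φ x := by congr 1; ext x; ring
      _ = _ := h3
      _ = _ := by congr 1; ext x; simp only [Pi.mul_apply, id]; ring
  have heq : F =ᵐ[volume] fun x => -z x + W x * (x * u x) / 3 := by
    have hloc : LocallyIntegrable (fun x => W x * (x * u x)) volume :=
      locallyIntegrable_continuous_mul hWc
        (locallyIntegrable_continuous_mul continuous_id (hu.locallyIntegrable (by norm_num)))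
    have hloc' : LocallyIntegrable (fun x => 1 / 3 * (W x * (x * u x))) volume :=
      locallyIntegrable_continuous_mul continuous_const hloc
    have hzloc := hz.locallyIntegrable (by norm_num)
    have hloc2 : LocallyIntegrable (fun x => -z x + W x * (x * u x) / 3) volume := by
      refine (hzloc.neg.add hloc').congr (ae_of_all _ fun x => ?_)
      simp only [Pi.add_apply, Pi.neg_apply]; ring
    refine ae_eq_of_integral_contDiff_smul_eq (hF.locallyIntegrable (by norm_num)) hloc2
      fun φ hφ hs => ?_
    have hφ2 : MemLp φ 2 volume := hφ.continuous.memLp_of_hasCompactSupport hs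
    have hψ2 : MemLp (fun x => W x * (x / 3) * φ x) 2 volume :=
      memLp_continuous_mul_test (hWc.mul (continuous_id.div_const 3)) hφ.continuous hs
    have h1 := hel φ hφ2
    have h2 := hzl φ hφ2
    have h3 := hul _ hψ2
    have h4 := tendsto_nhds_unique h1 ((((h2.neg).add h3).sub_const (∫ x, F x * φ x)).congr' (hU (by
      filter_upwards [eventually_support_subset hs] with N hN
      have i1 : Integrable fun x => synth (mulA (g N)) x * φ x :=
        (hg N).test_mulA.memLp_synth.integrable_mul hφ2
      have i2 : Integrable fun x => synth (mulD (g N)) x * (W x * (x / 3) * φ x) :=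
        (hg N).test_mulD.memLp_synth.integrable_mul hψ2
      have i3 : Integrable fun x => F x * φ x := hF.integrable_mul hφ2
      rw [← integral_neg, ← integral_add i1.fun_neg i2, ← integral_sub (i1.fun_neg.fun_add i2) i3]
      congr 1; ext x
      rcases eq_or_ne (φ x) 0 with h0 | h0
      · simp [h0]
      · simp only [Pi.sub_apply, linOp, h.truncWeight_eq (hN x h0), hW]
        ring)))
    have h5 : ∫ x, e x * φ x = 0 := by
      rw [← integral_zero ℝ ℝ (μ := volume)]
      refine integral_congr_ae ?_
      filter_upwards [he0] with x hx
      simp [hx]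
    have i1 : Integrable fun x => z x * φ x := hz.integrable_mul hφ2
    have i2 : Integrable fun x => u x * (W x * (x / 3) * φ x) := hu.integrable_mul hψ2
    have e6 : ∫ x, φ x * (-z x + W x * (x * u x) / 3) =
        -(∫ x, z x * φ x) + ∫ x, u x * (W x * (x / 3) * φ x) := by
      rw [← integral_neg, ← integral_add i1.fun_neg i2]
      congr 1; ext x
      ring
    simp only [smul_eq_mul]
    rw [e6]
    have e7 : ∫ x, φ x * F x = ∫ x, F x * φ x := by congr 1; ext x; ring
    rw [e7]
    linarith
  -- The approximations satisfy this relation exactly. Pairing it with the defect `y` of the limit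
  -- is weakly continuous and yields `‖y‖² = 0`.
  have hH : iHilbert (hk.toLp k) = -coeCLM (hz.toLp z) := by
    rw [← sub_eq_zero, sub_neg_eq_add]
    set y := iHilbert (hk.toLp k) + coeCLM (hz.toLp z) with hy
    let ℓ : Lp ℂ 2 (volume : Measure ℝ) →L[ℝ] ℝ :=
      Complex.reCLM.comp ((innerSL ℂ y).restrictScalars ℝ)
    have h1 := (hkL (ℓ.comp iHilbert)).add (hzL (ℓ.comp coeCLM))
    have h2 : ℓ y = 0 := by
      rw [hy, map_add]
      refine tendsto_nhds_unique h1 (tendsto_const_nhds.congr fun N => ?_)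
      change 0 = ℓ (iHilbert _) + ℓ (coeCLM _)
      rw [iHilbert_third (hg N), map_neg, neg_add_cancel]
    have h3 : ℓ y = ‖y‖ ^ 2 := by
      change (inner ℂ y y).re = _
      rw [inner_self_eq_norm_sq_to_K]
      norm_cast
    rw [h3] at h2
    simpa using h2
  have hwd : ∀ φ : ℝ → ℝ, ContDiff ℝ ∞ φ → HasCompactSupport φ →
      ∀ N, ∫ x, synth (g N) x * iteratedDeriv 1 φ x = (-1) ^ 1 * ∫ x, synth (mulD (g N)) x * φ x :=
    fun φ hφ hs N => by
      rw [iteratedDeriv_one, integral_synth_mul_deriv (hg N) hφ hs]; ring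
  have hwd3 : ∀ φ : ℝ → ℝ, ContDiff ℝ ∞ φ → HasCompactSupport φ →
      ∀ N, ∫ x, synth (g N) x * iteratedDeriv 3 φ x =
        (-1) ^ 3 * ∫ x, synth (mulD (mulD (mulD (g N)))) x * φ x :=
    fun φ hφ hs N => by
      rw [iteratedDeriv_succ, iteratedDeriv_succ, iteratedDeriv_one,
        integral_synth_mul_deriv (hg N) (contDiff_deriv (contDiff_deriv hφ)) hs.deriv.deriv,
        integral_synth_mul_deriv (hg N).test_mulD (contDiff_deriv hφ) hs.deriv,
        integral_synth_mul_deriv (hg N).test_mulD.test_mulD hφ hs]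
      ring
  have hcs : ∀ (j : ℕ) (φ : ℝ → ℝ), ContDiff ℝ ∞ φ → HasCompactSupport φ →
      Continuous (iteratedDeriv j φ) ∧ HasCompactSupport (iteratedDeriv j φ) := by
    intro j φ hφ hs
    refine ⟨hφ.continuous_iteratedDeriv j (by exact_mod_cast le_top), ?_⟩
    induction j with
    | zero => simpa using hs
    | succ j ih => rw [iteratedDeriv_succ]; exact ih.deriv
  have hweak : ∀ (j : ℕ) (s : ℕ → ℝ → ℝ) (t : ℝ → ℝ), MemLp t 2 volume →
      (∀ φ : ℝ → ℝ, MemLp φ 2 volume →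
        Tendsto (fun n => ∫ x, s n x * φ x) (hyperfilter ℕ) (𝓝 (∫ x, t x * φ x))) →
      (∀ φ : ℝ → ℝ, ContDiff ℝ ∞ φ → HasCompactSupport φ →
        ∀ N, ∫ x, synth (g N) x * iteratedDeriv j φ x = (-1) ^ j * ∫ x, s N x * φ x) →
      IsWeakDeriv j v t := by
    intro j s t ht hst hibp
    refine ⟨hvloc, ht.locallyIntegrable (by norm_num), fun φ hφ hs => ?_⟩
    obtain ⟨c1, c2⟩ := hcs j φ hφ hs
    refine tendsto_nhds_unique (hvl _ c1 c2) ?_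
    simp only [hibp φ hφ hs]
    exact (hst φ (hφ.continuous.memLp_of_hasCompactSupport hs)).const_mul _
  have hrw : ∀ x, weight ε x ^ (1 / 2 : ℝ) = Real.sqrt (aExp ε) * Real.sqrt (W x) := fun x => by
    rw [← Real.sqrt_eq_rpow, ← Real.sqrt_mul ha0.le]
    simp only [hW]
    rw [mul_div_cancel₀ _ ha0.ne']
  have ev : (fun x => weight ε x ^ (1 / 2 : ℝ) * v x) = fun x => Real.sqrt (aExp ε) * p x := by
    ext x
    have : Real.sqrt (W x) ≠ 0 := (Real.sqrt_pos.2 (hWpos x)).ne'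
    rw [hrw]; simp only [hv]; field_simp
  have eu : (fun x => weight ε x ^ (1 / 2 : ℝ) * (x * u x)) =ᵐ[volume]
      fun x => Real.sqrt (aExp ε) * q x := by
    filter_upwards [hqe] with x hx
    rw [hrw, hx]; ring
  refine ⟨v, u, k, hweak 1 _ u hu hul hwd, hweak 3 _ k hk hkl hwd3,
    ?_, ?_, hu, hk, ?_, ?_, ?_, by linarith, by linarith⟩
  · rw [MemL2w, ev]; exact hp.const_mul _
  · rw [MemL2w]; exact (memLp_congr_ae eu).2 (hq.const_mul _)
  · have h1 := I_mul_hilbert_ae hk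
    rw [hH] at h1
    filter_upwards [h1, heq, Lp.coeFn_neg (coeCLM (hz.toLp z)), coeCLM_ae (hz.toLp z),
      hz.coeFn_toLp] with x h1 h2 h3 h4 h5
    rw [h1, h3, Pi.neg_apply, h4, h5, h2]
    simp only [hW]
    push_cast
    have : ((aExp ε : ℝ) : ℂ) ≠ 0 := by exact_mod_cast ha0.ne'
    field_simp
  · have e1 : ∫ x, (weight ε x ^ (1 / 2 : ℝ) * v x) ^ 2 = aExp ε * ∫ x, p x ^ 2 := by
      rw [← integral_const_mul]
      congr 1; ext x
      rw [congrFun ev x, mul_pow, Real.sq_sqrt ha0.le]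
    have : 0 ≤ ∫ x, p x ^ 2 := integral_nonneg fun x => sq_nonneg _
    rw [e1]; nlinarith
  · have e1 : ∫ x, (weight ε x ^ (1 / 2 : ℝ) * (x * u x)) ^ 2 = aExp ε * ∫ x, q x ^ 2 := by
      rw [← integral_const_mul]
      refine integral_congr_ae ?_
      filter_upwards [eu] with x hx
      rw [hx, mul_pow, Real.sq_sqrt ha0.le]
    have : 0 ≤ ∫ x, q x ^ 2 := integral_nonneg fun x => sq_nonneg _
    rw [e1]; nlinarith

end

end SelfSimilar

/-! ### Du Bois-Reymond lemmas and regular representatives. -/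

namespace SelfSimilar
open Filter Topology

theorem intervalIntegrable_of_locallyIntegrable {k : ℝ → ℝ} (hk : LocallyIntegrable k volume)
    (a b : ℝ) : IntervalIntegrable k volume a b :=
  intervalIntegrable_iff.2
    ((hk.integrableOn_isCompact isCompact_uIcc).mono_set Set.uIoc_subset_uIcc)

/-- Integration by parts of a primitive of a locally integrable function. -/
theorem integral_primitive_mul_deriv {k : ℝ → ℝ} (hk : LocallyIntegrable k volume) (c : ℝ)
    {ψ : ℝ → ℝ} (hψ : ContDiff ℝ 1 ψ) (hs : HasCompactSupport ψ) :
    ∫ x, (c + ∫ y in (0 : ℝ)..x, k y) * deriv ψ x = -∫ x, k x * ψ x := by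
  obtain ⟨R, hR⟩ := hs.isCompact.isBounded.exists_norm_le
  have hψ0 : ∀ x, x ∉ Set.Ioo (-(|R| + 1)) (|R| + 1) → x ∉ tsupport ψ := fun x hx hx' => by
    have := abs_le.1 ((hR x hx').trans (le_abs_self R))
    exact hx ⟨by linarith, by linarith⟩
  set b := |R| + 1 with hb
  have hb0 : 0 < b := by positivity
  have hfb : ψ b = 0 := image_eq_zero_of_notMem_tsupport (hψ0 b (by simp))
  have hfb' : ψ (-b) = 0 := image_eq_zero_of_notMem_tsupport (hψ0 (-b) (by simp))
  have hac : AbsolutelyContinuousOnInterval (fun x => c + ∫ y in (0 : ℝ)..x, k y) (-b) b := by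
    have h1 : AbsolutelyContinuousOnInterval (fun _ : ℝ => c) (-b) b :=
      (contDiff_const.contDiffOn : ContDiffOn ℝ 1 (fun _ : ℝ => c) _).absolutelyContinuousOnInterval
    exact h1.add ((intervalIntegrable_of_locallyIntegrable hk _ _).absolutelyContinuousOnInterval_intervalIntegral
      (by rw [Set.uIcc_of_le (by linarith)]; constructor <;> linarith))
  have hac' : AbsolutelyContinuousOnInterval ψ (-b) b :=
    hψ.contDiffOn.absolutelyContinuousOnInterval
  have key := hac.integral_mul_deriv_eq_deriv_mul hac'
  rw [hfb, hfb', mul_zero, mul_zero, sub_zero, zero_sub] at key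
  have e1 : ∫ x in (-b)..b, (c + ∫ y in (0 : ℝ)..x, k y) * deriv ψ x =
      ∫ x, (c + ∫ y in (0 : ℝ)..x, k y) * deriv ψ x := by
    refine intervalIntegral.integral_eq_integral_of_support_subset fun x hx => ?_
    by_contra hc
    refine hx ?_
    have : x ∉ tsupport (deriv ψ) := fun h => hψ0 x (fun h' => hc ⟨h'.1, h'.2.le⟩)
      (tsupport_deriv_subset (f := ψ) h)
    simp [image_eq_zero_of_notMem_tsupport this]
  have e2 : ∫ x in (-b)..b, deriv (fun x => c + ∫ y in (0 : ℝ)..x, k y) x * ψ x =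
      ∫ x in (-b)..b, k x * ψ x := by
    refine intervalIntegral.integral_congr_ae ?_
    filter_upwards [_root_.LocallyIntegrable.ae_hasDerivAt_integral hk] with x hx _
    rw [((hx 0).const_add c).deriv]
  have e3 : ∫ x in (-b)..b, k x * ψ x = ∫ x, k x * ψ x := by
    refine intervalIntegral.integral_eq_integral_of_support_subset fun x hx => ?_
    by_contra hc
    refine hx ?_
    simp [image_eq_zero_of_notMem_tsupport (hψ0 x fun h' => hc ⟨h'.1, h'.2.le⟩)]
  rw [← e1, key, e2, e3]

theorem integrable_mul_test {d φ : ℝ → ℝ} (hd : LocallyIntegrable d volume) (hφ : Continuous φ)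
    (hs : HasCompactSupport φ) : Integrable fun x => d x * φ x := by
  simpa only [smul_eq_mul, mul_comm] using! hd.integrable_smul_left_of_hasCompactSupport hφ hs

/-- The lemma of du Bois-Reymond. -/
theorem ae_eq_const_of_integral_mul_deriv {d : ℝ → ℝ} (hd : LocallyIntegrable d volume)
    (h : ∀ ψ : ℝ → ℝ, ContDiff ℝ ∞ ψ → HasCompactSupport ψ → ∫ x, d x * deriv ψ x = 0) :
    ∃ c : ℝ, d =ᵐ[volume] fun _ => c := by
  set η := unitBump 0 with hη
  have hηs : ContDiff ℝ ∞ η := contDiff_unitBump 0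
  have hηc : HasCompactSupport η := hasCompactSupport_unitBump 0
  refine ⟨∫ x, d x * η x, ae_eq_of_integral_contDiff_smul_eq hd
    (locallyIntegrable_const _) fun q hq hqc => ?_⟩
  have hqi : Integrable q := hq.continuous.integrable_of_hasCompactSupport hqc
  have hηi : Integrable η := hηs.continuous.integrable_of_hasCompactSupport hηc
  obtain ⟨θ, hθ, hθc, hθd, -⟩ := exists_primitive
    (q := fun x => q x - (∫ y, q y) * η x) (hq.sub (contDiff_const.mul hηs))
    (hqc.sub hηc.mul_left) (by
      rw [integral_sub hqi (hηi.const_mul _), integral_const_mul, hη, integral_unitBump]; ring)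
  have h1 := h θ hθ hθc
  have e : ∫ x, d x * deriv θ x = (∫ x, d x * q x) - (∫ y, q y) * ∫ x, d x * η x := by
    rw [← integral_const_mul, ← integral_sub (integrable_mul_test hd hq.continuous hqc)
      ((integrable_mul_test hd hηs.continuous hηc).const_mul _)]
    congr 1; ext x
    rw [(hθd x).deriv]; ring
  rw [e] at h1
  simp only [smul_eq_mul]
  rw [integral_mul_const]
  have e2 : ∫ x, q x * d x = ∫ x, d x * q x := by congr 1; ext x; ring
  rw [e2]; linarith

/-- Second derivatives of test functions are the `ψ'` with `ψ` of mean zero. Correcting the mean of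
a general `ψ` by a bump shows that `d + c x` is orthogonal to all `ψ'`, which reduces to the
constant case. -/
theorem ae_eq_affine_of_integral_mul_deriv_deriv {d : ℝ → ℝ} (hd : LocallyIntegrable d volume)
    (h : ∀ φ : ℝ → ℝ, ContDiff ℝ ∞ φ → HasCompactSupport φ → ∫ x, d x * deriv (deriv φ) x = 0) :
    ∃ α β : ℝ, d =ᵐ[volume] fun x => α + β * x := by
  set η := unitBump 0 with hη
  have hηs : ContDiff ℝ ∞ η := contDiff_unitBump 0
  have hηc : HasCompactSupport η := hasCompactSupport_unitBump 0
  set c := ∫ x, d x * deriv η x with hc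
  have hloc : LocallyIntegrable (fun x => d x + c * x) volume :=
    hd.add (continuous_const.mul continuous_id).locallyIntegrable
  obtain ⟨α, hα⟩ := ae_eq_const_of_integral_mul_deriv hloc fun ψ hψ hψc => by
    have hψi : Integrable ψ := hψ.continuous.integrable_of_hasCompactSupport hψc
    have hηi : Integrable η := hηs.continuous.integrable_of_hasCompactSupport hηc
    obtain ⟨θ, hθ, hθc, hθd, -⟩ := exists_primitive
      (q := fun x => ψ x - (∫ y, ψ y) * η x) (hψ.sub (contDiff_const.mul hηs))
      (hψc.sub hηc.mul_left) (by
        rw [integral_sub hψi (hηi.const_mul _), integral_const_mul, hη, integral_unitBump]; ring)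
    have h1 := h θ hθ hθc
    have e0 : deriv (deriv θ) = fun x => deriv ψ x - (∫ y, ψ y) * deriv η x := by
      have : deriv θ = fun x => ψ x - (∫ y, ψ y) * η x := funext fun x => (hθd x).deriv
      rw [this]
      ext x
      exact ((hψ.differentiable (by simp) x).hasDerivAt.fun_sub
        ((hηs.differentiable (by simp) x).hasDerivAt.const_mul _)).deriv
    have i1 := integrable_mul_test hd (contDiff_deriv hψ).continuous hψc.deriv
    have i2 := integrable_mul_test hd (contDiff_deriv hηs).continuous hηc.deriv
    have e : ∫ x, d x * deriv (deriv θ) x = (∫ x, d x * deriv ψ x) - (∫ y, ψ y) * c := by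
      rw [hc, ← integral_const_mul, ← integral_sub i1 (i2.const_mul _)]
      congr 1; ext x
      rw [e0]; ring
    have e1 : ∫ x, x * deriv ψ x = -∫ x, ψ x := by
      have := integral_primitive_mul_deriv (k := fun _ => (1 : ℝ)) (locallyIntegrable_const _) 0
        (hψ.of_le (by simp)) hψc
      simpa using this
    have i3 : Integrable fun x => x * deriv ψ x :=
      (continuous_id.mul (contDiff_deriv hψ).continuous).integrable_of_hasCompactSupport
        hψc.deriv.mul_left
    have e2 : ∫ x, (d x + c * x) * deriv ψ x =
        (∫ x, d x * deriv ψ x) + c * ∫ x, x * deriv ψ x := by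
      rw [← integral_const_mul, ← integral_add i1 (i3.const_mul _)]
      congr 1; ext x; ring
    rw [e] at h1
    rw [e2, e1]; linarith
  refine ⟨α, -c, ?_⟩
  filter_upwards [hα] with x hx
  linarith

/-- A twice continuously differentiable representative, its second derivative being a primitive of
the weak third derivative. -/
structure IsRegularRep (v u k v₀ v₁ v₂ : ℝ → ℝ) : Prop where
  ae_eq : v =ᵐ[volume] v₀
  ae_eq_deriv : u =ᵐ[volume] v₁
  hasDerivAt : ∀ x, HasDerivAt v₀ (v₁ x) x
  hasDerivAt' : ∀ x, HasDerivAt v₁ (v₂ x) x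
  continuous : Continuous v₂
  ibp : ∀ ψ : ℝ → ℝ, ContDiff ℝ 1 ψ → HasCompactSupport ψ →
    ∫ x, v₂ x * deriv ψ x = -∫ x, k x * ψ x

/-- The second derivative is not among the data: the first weak derivative differs from the double
primitive of the third by an affine function, and this produces it. -/
theorem exists_regularRep {v u k : ℝ → ℝ} (h1 : IsWeakDeriv 1 v u) (h3 : IsWeakDeriv 3 v k) :
    ∃ v₀ v₁ v₂, IsRegularRep v u k v₀ v₁ v₂ := by
  have hk := h3.2.1
  set K₂ : ℝ → ℝ := fun x => 0 + ∫ y in (0 : ℝ)..x, k y with hK₂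
  have hK₂c : Continuous K₂ := continuous_const.add
    (intervalIntegral.continuous_primitive (intervalIntegrable_of_locallyIntegrable hk) 0)
  set K₁ : ℝ → ℝ := fun x => 0 + ∫ y in (0 : ℝ)..x, K₂ y with hK₁
  have hK₁d : ∀ x, HasDerivAt K₁ (K₂ x) x := fun x =>
    (hK₂c.integral_hasStrictDerivAt 0 x).hasDerivAt.const_add 0
  have hK₁c : Continuous K₁ := continuous_iff_continuousAt.2 fun x => (hK₁d x).continuousAt
  obtain ⟨α, β, hαβ⟩ := ae_eq_affine_of_integral_mul_deriv_deriv (d := fun x => u x - K₁ x)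
    (h1.2.1.sub hK₁c.locallyIntegrable) fun φ hφ hs => by
      have a1 := h1.2.2 (deriv (deriv φ)) (contDiff_deriv (contDiff_deriv hφ)) hs.deriv.deriv
      have a3 := h3.2.2 φ hφ hs
      have a4 : iteratedDeriv 3 φ = deriv (deriv (deriv φ)) := by
        rw [iteratedDeriv_succ, iteratedDeriv_succ, iteratedDeriv_one]
      rw [iteratedDeriv_one] at a1
      rw [a4, a1] at a3
      have b1 := integral_primitive_mul_deriv hK₂c.locallyIntegrable 0
        ((contDiff_deriv hφ).of_le (by simp)) hs.deriv
      have b2 := integral_primitive_mul_deriv hk 0 (hφ.of_le (by simp)) hs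
      have i1 := integrable_mul_test h1.2.1 (contDiff_deriv (contDiff_deriv hφ)).continuous
        hs.deriv.deriv
      have i2 := integrable_mul_test hK₁c.locallyIntegrable
        (contDiff_deriv (contDiff_deriv hφ)).continuous hs.deriv.deriv
      simp only [sub_mul]
      rw [integral_sub i1 i2]
      change ∫ x, K₁ x * deriv (deriv φ) x = -∫ x, K₂ x * deriv φ x at b1
      change ∫ x, K₂ x * deriv φ x = -∫ x, k x * φ x at b2
      rw [b1, b2]
      linarith
  set v₁ : ℝ → ℝ := fun x => K₁ x + (α + β * x) with hv₁
  set v₂ : ℝ → ℝ := fun x => β + ∫ y in (0 : ℝ)..x, k y with hv₂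
  have hv₁d : ∀ x, HasDerivAt v₁ (v₂ x) x := fun x => by
    have := (hK₁d x).fun_add (((hasDerivAt_id' x).const_mul β).const_add α)
    refine this.congr_deriv ?_
    simp only [hK₂, hv₂]; ring
  have hv₁c : Continuous v₁ := continuous_iff_continuousAt.2 fun x => (hv₁d x).continuousAt
  have huv : u =ᵐ[volume] v₁ := by
    filter_upwards [hαβ] with x hx
    simp only [hv₁]; linarith
  set P : ℝ → ℝ := fun x => 0 + ∫ y in (0 : ℝ)..x, v₁ y with hP
  have hPd : ∀ x, HasDerivAt P (v₁ x) x := fun x =>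
    (hv₁c.integral_hasStrictDerivAt 0 x).hasDerivAt.const_add 0
  have hPc : Continuous P := continuous_iff_continuousAt.2 fun x => (hPd x).continuousAt
  obtain ⟨γ, hγ⟩ := ae_eq_const_of_integral_mul_deriv (d := fun x => v x - P x)
    (h1.1.sub hPc.locallyIntegrable) fun φ hφ hs => by
      have a1 := h1.2.2 φ hφ hs
      rw [iteratedDeriv_one] at a1
      have b1 := integral_primitive_mul_deriv hv₁c.locallyIntegrable 0 (hφ.of_le (by simp)) hs
      change ∫ x, P x * deriv φ x = -∫ x, v₁ x * φ x at b1
      have i1 := integrable_mul_test h1.1 (contDiff_deriv hφ).continuous hs.deriv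
      have i2 := integrable_mul_test hPc.locallyIntegrable (contDiff_deriv hφ).continuous hs.deriv
      simp only [sub_mul]
      rw [integral_sub i1 i2, a1, b1]
      have e : ∫ x, u x * φ x = ∫ x, v₁ x * φ x := integral_congr_ae (by
        filter_upwards [huv] with x hx
        rw [hx])
      rw [e]; ring
  refine ⟨fun x => P x + γ, v₁, v₂, ?_, huv, fun x => (hPd x).add_const γ, hv₁d,
    continuous_const.add
      (intervalIntegral.continuous_primitive (intervalIntegrable_of_locallyIntegrable hk) 0),
    fun ψ hψ hs => integral_primitive_mul_deriv hk β hψ hs⟩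
  filter_upwards [hγ] with x hx
  linarith

section
variable {v u k v₀ v₁ v₂ : ℝ → ℝ}

theorem IsRegularRep.continuous₁ (h : IsRegularRep v u k v₀ v₁ v₂) : Continuous v₁ :=
  continuous_iff_continuousAt.2 fun x => (h.hasDerivAt' x).continuousAt

theorem IsRegularRep.continuous₀ (h : IsRegularRep v u k v₀ v₁ v₂) : Continuous v₀ :=
  continuous_iff_continuousAt.2 fun x => (h.hasDerivAt x).continuousAt

theorem IsRegularRep.contDiff₁ (h : IsRegularRep v u k v₀ v₁ v₂) : ContDiff ℝ 1 v₁ := by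
  rw [contDiff_one_iff_deriv]
  exact ⟨fun x => (h.hasDerivAt' x).differentiableAt, by
    rw [funext fun x => (h.hasDerivAt' x).deriv]; exact h.continuous⟩

/-- Integration by parts of a continuously differentiable function. -/
theorem integral_mul_deriv_of_hasDerivAt {p p' ψ : ℝ → ℝ} (hp : ∀ x, HasDerivAt p (p' x) x)
    (hp' : Continuous p') (hψ : ContDiff ℝ 1 ψ) (hs : HasCompactSupport ψ) :
    ∫ x, p x * deriv ψ x = -∫ x, p' x * ψ x := by
  have hc : Continuous p := continuous_iff_continuousAt.2 fun x => (hp x).continuousAt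
  have hd : Continuous (deriv ψ) := hψ.continuous_deriv le_rfl
  have hψc := hψ.continuous
  refine integral_mul_deriv_eq_deriv_mul_of_integrable (fun x _ => hp x)
    (fun x _ => (hψ.differentiable (by simp) x).hasDerivAt) ?_ ?_ ?_
  · exact (hc.mul hd).integrable_of_hasCompactSupport hs.deriv.mul_left
  · exact (hp'.mul hψc).integrable_of_hasCompactSupport hs.mul_left
  · exact (hc.mul hψc).integrable_of_hasCompactSupport hs.mul_left

theorem IsRegularRep.isWeakDeriv_two (h : IsRegularRep v u k v₀ v₁ v₂) : IsWeakDeriv 2 v v₂ := by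
  refine ⟨h.continuous₀.locallyIntegrable.congr h.ae_eq.symm, h.continuous.locallyIntegrable,
    fun φ hφ hs => ?_⟩
  rw [iteratedDeriv_succ, iteratedDeriv_one]
  have e : ∫ x, v x * deriv (deriv φ) x = ∫ x, v₀ x * deriv (deriv φ) x := integral_congr_ae (by
    filter_upwards [h.ae_eq] with x hx
    rw [hx])
  rw [e, integral_mul_deriv_of_hasDerivAt h.hasDerivAt h.continuous₁
      ((contDiff_deriv hφ).of_le (by simp)) hs.deriv,
    integral_mul_deriv_of_hasDerivAt h.hasDerivAt' h.continuous (hφ.of_le (by simp)) hs]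
  ring

end

end SelfSimilar

/-! ### Cut-offs, the weighted bound for the second derivative and the weighted uniform bound. -/

namespace SelfSimilar
open Filter Topology

/-- A smooth cut-off at scale `R`. -/
noncomputable def cutoff (R x : ℝ) : ℝ :=
  (⟨1, 2, by norm_num, by norm_num⟩ : ContDiffBump (0 : ℝ)) (x / R)

theorem contDiff_cutoff (R : ℝ) : ContDiff ℝ ∞ (cutoff R) :=
  (ContDiffBump.contDiff _).comp (contDiff_id.div_const R)

theorem cutoff_nonneg (R x : ℝ) : 0 ≤ cutoff R x := ContDiffBump.nonneg _

theorem cutoff_le_one (R x : ℝ) : cutoff R x ≤ 1 := ContDiffBump.le_one _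

theorem cutoff_eq_one {R x : ℝ} (hR : 0 < R) (hx : |x| ≤ R) : cutoff R x = 1 := by
  refine ContDiffBump.one_of_mem_closedBall _ ?_
  rw [mem_closedBall_zero_iff, Real.norm_eq_abs, abs_div, abs_of_pos hR]
  exact (div_le_one hR).2 hx

theorem cutoff_eq_zero {R x : ℝ} (hR : 0 < R) (hx : 2 * R ≤ |x|) : cutoff R x = 0 := by
  refine ContDiffBump.zero_of_le_dist _ ?_
  rw [dist_zero_right, Real.norm_eq_abs, abs_div, abs_of_pos hR, le_div_iff₀ hR]
  exact hx

theorem hasCompactSupport_cutoff {R : ℝ} (hR : 0 < R) : HasCompactSupport (cutoff R) := by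
  refine HasCompactSupport.of_support_subset_isCompact
    (isCompact_Icc (a := -(2 * R)) (b := 2 * R)) fun x hx => ?_
  by_contra hc
  refine hx (cutoff_eq_zero hR ?_)
  by_contra h
  have := abs_lt.1 (not_le.1 h)
  exact hc ⟨this.1.le, this.2.le⟩

theorem deriv_cutoff_eq_zero {R x : ℝ} (hR : 0 < R) (hx : |x| < R) : deriv (cutoff R) x = 0 := by
  have : cutoff R =ᶠ[𝓝 x] fun _ => 1 := by
    filter_upwards [(isOpen_lt continuous_abs continuous_const).mem_nhds hx] with y hy
    exact cutoff_eq_one hR (le_of_lt hy)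
  rw [this.deriv_eq, deriv_const]

theorem deriv_cutoff_eq_zero' {R x : ℝ} (hR : 0 < R) (hx : 2 * R < |x|) :
    deriv (cutoff R) x = 0 := by
  have : cutoff R =ᶠ[𝓝 x] fun _ => 0 := by
    filter_upwards [(isOpen_lt continuous_const continuous_abs).mem_nhds hx] with y hy
    exact cutoff_eq_zero hR (le_of_lt hy)
  rw [this.deriv_eq, deriv_const]

theorem exists_deriv_cutoff_bound :
    ∃ M : ℝ, 0 ≤ M ∧ ∀ R : ℝ, 0 < R → ∀ x, |deriv (cutoff R) x| ≤ M / R := by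
  have hc : Continuous (deriv (cutoff 1)) := (contDiff_deriv (contDiff_cutoff 1)).continuous
  obtain ⟨M, hM⟩ := hc.bounded_above_of_compact_support (hasCompactSupport_cutoff one_pos).deriv
  refine ⟨M, (norm_nonneg _).trans (hM 0), fun R hR x => ?_⟩
  have h1 : cutoff R = fun x => cutoff 1 (x / R) := by
    ext x; simp [cutoff]
  have h2 : HasDerivAt (cutoff R) (deriv (cutoff 1) (x / R) * (1 / R)) x := by
    have h3 : HasDerivAt (cutoff 1) (deriv (cutoff 1) (x / R)) (x / R) :=
      ((contDiff_cutoff 1).differentiable (by simp) (x / R)).hasDerivAt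
    have h4 := HasDerivAt.comp x h3 ((hasDerivAt_id' x).div_const R)
    rw [h1]; exact h4
  rw [h2.deriv, abs_mul, abs_of_pos (by positivity : 0 < 1 / R), mul_one_div]
  have := hM (x / R)
  rw [Real.norm_eq_abs] at this
  gcongr

/-- `(1 + x²)^{1/4}`. -/
noncomputable def bracket (x : ℝ) : ℝ := (1 + x ^ 2) ^ (1 / 4 : ℝ)

theorem bracket_pos (x : ℝ) : 0 < bracket x := by unfold bracket; positivity

theorem bracket_pow_four (x : ℝ) : bracket x ^ 4 = 1 + x ^ 2 := by
  have h : (0 : ℝ) ≤ 1 + x ^ 2 := by positivity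
  rw [bracket, ← Real.rpow_natCast, ← Real.rpow_mul h]; norm_num

theorem one_le_bracket (x : ℝ) : 1 ≤ bracket x :=
  Real.one_le_rpow (by nlinarith [sq_nonneg x]) (by norm_num)

theorem abs_le_bracket_sq (x : ℝ) : |x| ≤ bracket x ^ 2 := by
  refine abs_le_of_sq_le_sq ?_ (by positivity)
  rw [← pow_mul, bracket_pow_four]; linarith

theorem contDiff_bracket : ContDiff ℝ 1 bracket :=
  (contDiff_const.add (contDiff_id.pow 2)).rpow_const_of_ne fun x => by
    simp only [id]; positivity

theorem hasDerivAt_bracket (x : ℝ) : HasDerivAt bracket (x / (2 * bracket x ^ 3)) x := by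
  have hd : HasDerivAt bracket (deriv bracket x) x :=
    (contDiff_bracket.differentiable (by simp) x).hasDerivAt
  have h4 := hd.fun_pow 4
  have h4' : HasDerivAt (fun x => bracket x ^ 4) (2 * x) x := by
    simp only [bracket_pow_four]
    simpa using (hasDerivAt_pow 2 x).const_add 1
  have e := h4.unique h4'
  have hb := bracket_pos x
  refine hd.congr_deriv ?_
  rw [eq_div_iff (by positivity)]
  norm_num at e
  linarith

theorem abs_deriv_bracket_le (x : ℝ) : |x / (2 * bracket x ^ 3)| ≤ 1 / (2 * bracket x) := by
  have hb := bracket_pos x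
  rw [abs_div, abs_of_pos (by positivity : 0 < 2 * bracket x ^ 3),
    div_le_div_iff₀ (by positivity) (by positivity)]
  have := mul_le_mul_of_nonneg_right (abs_le_bracket_sq x) (by positivity : 0 ≤ 2 * bracket x)
  nlinarith

section
variable {ε : ℝ} {v u k v₀ v₁ v₂ : ℝ → ℝ}

theorem GoodWeight.one_le_weight_mul (h : GoodWeight ε) (x : ℝ) :
    1 ≤ 2 * weight ε x * bracket x := by
  have h1 := h.le_weight x
  have hb := bracket_pos x
  rw [Real.rpow_neg (by positivity), ← bracket] at h1
  have := mul_le_mul_of_nonneg_right h1 hb.le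
  rw [mul_assoc, inv_mul_cancel₀ hb.ne'] at this
  linarith

/-- Since `w` is at least `1 / (2 bracket)`, the unweighted and the dilation norms together control
`bracket³ v'²`; this margin drives both regularity estimates. -/
theorem GoodWeight.bracket_cube_le (h : GoodWeight ε) (x : ℝ) :
    bracket x ^ 3 ≤ 2 * (1 + x ^ 2 * weight ε x) := by
  have h1 := h.one_le_weight_mul x
  have hb := one_le_bracket x
  have h4 := bracket_pow_four x
  have hx : x ^ 2 = bracket x ^ 4 - 1 := by linarith
  have hw := weight_pos ε x
  set s := bracket x
  have h2 : 1 / (2 * s) ≤ weight ε x := by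
    rw [div_le_iff₀ (by positivity)]; linarith
  have h3 : x ^ 2 * (1 / (2 * s)) ≤ x ^ 2 * weight ε x := by gcongr
  have e : x ^ 2 * (1 / (2 * s)) = s ^ 3 / 2 - 1 / (2 * s) := by
    rw [hx]; field_simp
  have h5 : 1 / (2 * s) ≤ 1 := by
    rw [div_le_one (by positivity)]; linarith
  linarith

/-- Here `a`, `b`, `κ` stand for the first three derivatives of `v`, `c` for the cut-off and `s` for
`bracket`. The first group on the right is `v'' ψ' + v''' ψ` with `ψ = c² s v'`, whose integral
vanishes. -/
theorem second_deriv_pointwise {c c' s s' a b κ w x M : ℝ} (hs : 1 ≤ s)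
    (hs3 : s ^ 3 ≤ 2 * (1 + x ^ 2 * w)) (hc0 : 0 ≤ c) (hc1 : c ≤ 1) (hd' : |s'| ≤ s)
    (hχ1 : |c'| ≤ M) :
    c ^ 2 * (s * b ^ 2) ≤
      (b * ((2 * c * c' * s + c ^ 2 * s') * a + c ^ 2 * s * b) + κ * (c ^ 2 * s * a)) +
      (1 / 2 * (c ^ 2 * (s * b ^ 2)) + (8 * M ^ 2 + 4) * (a ^ 2 + w * (x * a) ^ 2 + κ ^ 2)) := by
  have hs0 : 0 < s := by linarith
  have q1 : -(b * (2 * c * c' * s) * a) ≤ 1 / 4 * (c ^ 2 * (s * b ^ 2)) + 4 * M ^ 2 * (s * a ^ 2) := by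
    have hc'2 : c' ^ 2 ≤ M ^ 2 := by rw [← sq_abs]; exact pow_le_pow_left₀ (abs_nonneg _) hχ1 2
    have : 0 ≤ s * (1 / 2 * (c * b) + 2 * (c' * a)) ^ 2 := by positivity
    have h3 : c' ^ 2 * (s * a ^ 2) ≤ M ^ 2 * (s * a ^ 2) := by gcongr
    nlinarith
  have q2 : -(b * (c ^ 2 * s') * a) ≤ 1 / 4 * (c ^ 2 * (s * b ^ 2)) + s * a ^ 2 := by
    have t1 : -(b * (c ^ 2 * s') * a) ≤ c ^ 2 * (|s'| * (|b| * |a|)) := by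
      have : -(b * (c ^ 2 * s') * a) = c ^ 2 * -(s' * (b * a)) := by ring
      rw [this]
      refine mul_le_mul_of_nonneg_left ?_ (sq_nonneg _)
      rw [← abs_mul, ← abs_mul]; exact neg_le_abs _
    have t2 : c ^ 2 * (|s'| * (|b| * |a|)) ≤ c ^ 2 * (s * (|b| * |a|)) := by gcongr
    have t3 : |b| * |a| ≤ 1 / 4 * b ^ 2 + a ^ 2 := by
      nlinarith [sq_nonneg (1 / 2 * |b| - |a|), sq_abs a, sq_abs b]
    have t4 : c ^ 2 * (s * (|b| * |a|)) ≤ c ^ 2 * (s * (1 / 4 * b ^ 2 + a ^ 2)) := by gcongr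
    have t5 : c ^ 2 * (s * a ^ 2) ≤ 1 * (s * a ^ 2) := by
      have : c ^ 2 ≤ 1 := pow_le_one₀ hc0 hc1
      gcongr
    nlinarith
  have q3 : -(κ * (c ^ 2 * s * a)) ≤ κ ^ 2 + s ^ 2 * a ^ 2 := by
    have t1 : (c ^ 2 * s * a) ^ 2 ≤ s ^ 2 * a ^ 2 := by
      have : c ^ 4 ≤ 1 := pow_le_one₀ hc0 hc1
      have : c ^ 4 * (s ^ 2 * a ^ 2) ≤ 1 * (s ^ 2 * a ^ 2) := by gcongr
      nlinarith
    nlinarith [sq_nonneg (κ + c ^ 2 * s * a), sq_nonneg κ, sq_nonneg (c ^ 2 * s * a)]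
  have hs2 : s ≤ s ^ 3 := by nlinarith [sq_nonneg s]
  have hs2' : s ^ 2 ≤ s ^ 3 := by nlinarith [sq_nonneg s]
  have r1 : s * a ^ 2 ≤ 2 * (a ^ 2 + w * (x * a) ^ 2) := by
    have := mul_le_mul_of_nonneg_right (hs2.trans hs3) (sq_nonneg a)
    linarith
  have r2 : s ^ 2 * a ^ 2 ≤ 2 * (a ^ 2 + w * (x * a) ^ 2) := by
    have := mul_le_mul_of_nonneg_right (hs2'.trans hs3) (sq_nonneg a)
    linarith
  have r3 : 4 * M ^ 2 * (s * a ^ 2) ≤ 4 * M ^ 2 * (2 * (a ^ 2 + w * (x * a) ^ 2)) := by gcongr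
  have r4 : 0 ≤ (8 * M ^ 2 + 3) * κ ^ 2 := by positivity
  linarith

/-- The weighted estimate of the second derivative. -/
theorem exists_second_deriv_bound : ∃ C : ℝ, 0 ≤ C ∧ ∀ {ε : ℝ} {v u k v₀ v₁ v₂ : ℝ → ℝ},
    GoodWeight ε → IsRegularRep v u k v₀ v₁ v₂ → MemLp v₁ 2 volume → MemLp k 2 volume →
    Integrable (fun x => weight ε x * (x * v₁ x) ^ 2) →
    Integrable (fun x => bracket x * v₂ x ^ 2) ∧
    ∫ x, bracket x * v₂ x ^ 2 ≤
      C * ((∫ x, v₁ x ^ 2) + (∫ x, weight ε x * (x * v₁ x) ^ 2) + ∫ x, k x ^ 2) := by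
  obtain ⟨M, hM0, hM⟩ := exists_deriv_cutoff_bound
  refine ⟨16 * M ^ 2 + 8, by positivity, fun {ε v u k v₀ v₁ v₂} h hr h1 hk hw => ?_⟩
  set Q := (∫ x, v₁ x ^ 2) + (∫ x, weight ε x * (x * v₁ x) ^ 2) + ∫ x, k x ^ 2 with hQ
  have hn1 : 0 ≤ ∫ x, v₁ x ^ 2 := integral_nonneg fun x => sq_nonneg _
  have hn2 : 0 ≤ ∫ x, weight ε x * (x * v₁ x) ^ 2 :=
    integral_nonneg fun x => mul_nonneg (weight_pos ε x).le (sq_nonneg _)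
  have hn3 : 0 ≤ ∫ x, k x ^ 2 := integral_nonneg fun x => sq_nonneg _
  have i1 : Integrable fun x => v₁ x ^ 2 := h1.integrable_sq
  have i3 : Integrable fun x => k x ^ 2 := hk.integrable_sq
  have cb : Continuous bracket := contDiff_bracket.continuous
  have hcont : Continuous fun x => bracket x * v₂ x ^ 2 := cb.mul (hr.continuous.pow 2)
  have key : ∀ R : ℝ, 1 ≤ R → ∫ x, cutoff R x ^ 2 * (bracket x * v₂ x ^ 2) ≤
      (16 * M ^ 2 + 8) * Q := by
    intro R hR
    have hR0 : 0 < R := by linarith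
    set χ := cutoff R with hχ
    have hχs : ContDiff ℝ ∞ χ := contDiff_cutoff R
    have hχc : HasCompactSupport χ := hasCompactSupport_cutoff hR0
    have hχd : ∀ x, HasDerivAt χ (deriv χ x) x := fun x =>
      (hχs.differentiable (by simp) x).hasDerivAt
    have hχb : ∀ x, |deriv χ x| ≤ M := fun x => (hM R hR0 x).trans (div_le_self hM0 hR)
    have cχ := hχs.continuous
    have cχ' : Continuous (deriv χ) := (contDiff_deriv hχs).continuous
    -- The square of the cut-off keeps one factor `χ` beside `χ'`, so that the commutator term is
    -- absorbed by `χ² v''²`.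
    set ψ : ℝ → ℝ := fun x => χ x ^ 2 * bracket x * v₁ x with hψ
    have hψs : ContDiff ℝ 1 ψ :=
      (((hχs.of_le (by simp)).pow 2).mul contDiff_bracket).mul hr.contDiff₁
    have hψc : HasCompactSupport ψ := by
      have : ψ = fun x => χ x * (χ x * bracket x * v₁ x) := by ext x; simp only [hψ]; ring
      rw [this]; exact hχc.mul_right
    have hψd : ∀ x, deriv ψ x = (2 * χ x * deriv χ x * bracket x +
        χ x ^ 2 * (x / (2 * bracket x ^ 3))) * v₁ x + χ x ^ 2 * bracket x * v₂ x := fun x => by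
      have := ((((hχd x).fun_pow 2).fun_mul (hasDerivAt_bracket x)).fun_mul (hr.hasDerivAt' x)).deriv
      rw [this]; push_cast; ring
    have cψ' : Continuous (deriv ψ) := hψs.continuous_deriv le_rfl
    have hibp := hr.ibp ψ hψs hψc
    set G : ℝ → ℝ := fun x => (8 * M ^ 2 + 4) * (v₁ x ^ 2 + weight ε x * (x * v₁ x) ^ 2 + k x ^ 2)
      with hG
    have iG : Integrable G := ((i1.add hw).add i3).const_mul _
    have iA : Integrable fun x => χ x ^ 2 * (bracket x * v₂ x ^ 2) := by
      refine ((cχ.pow 2).mul hcont).integrable_of_hasCompactSupport ?_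
      have : (fun x => χ x ^ 2) * (fun x => bracket x * v₂ x ^ 2) =
          fun x => χ x * (χ x * (bracket x * v₂ x ^ 2)) := by
        ext x; simp only [Pi.mul_apply]; ring
      exact this ▸ hχc.mul_right
    have iB : Integrable fun x => v₂ x * deriv ψ x :=
      (hr.continuous.mul cψ').integrable_of_hasCompactSupport hψc.deriv.mul_left
    have iK : Integrable fun x => k x * ψ x :=
      hk.integrable_mul (q := 2) (hψs.continuous.memLp_of_hasCompactSupport hψc)
    have hpt : ∀ x, χ x ^ 2 * (bracket x * v₂ x ^ 2) ≤
        (v₂ x * deriv ψ x + k x * ψ x) + (1 / 2 * (χ x ^ 2 * (bracket x * v₂ x ^ 2)) + G x) := by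
      intro x
      have hs := one_le_bracket x
      have hs3 := h.bracket_cube_le x
      have hc0 := cutoff_nonneg R x
      have hc1 := cutoff_le_one R x
      have hd := abs_deriv_bracket_le x
      have hd' : |x / (2 * bracket x ^ 3)| ≤ bracket x := hd.trans (by
        rw [div_le_iff₀ (by positivity)]; nlinarith)
      have hχ1 := hχb x
      rw [hψd]
      simp only [hψ, hG]
      exact second_deriv_pointwise hs hs3 hc0 hc1 hd' hχ1
    have hmono := integral_mono iA ((iB.add iK).add ((iA.const_mul (1 / 2)).add iG)) hpt
    have e1 : ∫ x, ((v₂ x * deriv ψ x + k x * ψ x) +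
        (1 / 2 * (χ x ^ 2 * (bracket x * v₂ x ^ 2)) + G x)) =
        1 / 2 * (∫ x, χ x ^ 2 * (bracket x * v₂ x ^ 2)) + ∫ x, G x := by
      rw [integral_add (iB.fun_add iK) ((iA.const_mul (1 / 2)).fun_add iG), integral_add iB iK,
        integral_add (iA.const_mul (1 / 2)) iG, integral_const_mul, hibp]
      ring
    have e2 : ∫ x, G x = (8 * M ^ 2 + 4) * Q := by
      rw [hG, integral_const_mul, integral_add (i1.fun_add hw) i3, integral_add i1 hw]
    change ∫ x, χ x ^ 2 * (bracket x * v₂ x ^ 2) ≤ ∫ x, ((v₂ x * deriv ψ x + k x * ψ x) +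
        (1 / 2 * (χ x ^ 2 * (bracket x * v₂ x ^ 2)) + G x)) at hmono
    rw [e1, e2] at hmono
    linarith
  -- The uniform bound on growing intervals yields integrability as well as the estimate.
  have hcov : AECover (volume : Measure ℝ) atTop fun n : ℕ => Set.Icc (-((n : ℝ) + 1)) (n + 1) :=
    aecover_Icc (tendsto_neg_atTop_atBot.comp (tendsto_atTop_add_const_right _ _
      tendsto_natCast_atTop_atTop)) (tendsto_atTop_add_const_right _ _ tendsto_natCast_atTop_atTop)
  have hset : ∀ n : ℕ, ∫ x in Set.Icc (-((n : ℝ) + 1)) (n + 1), bracket x * v₂ x ^ 2 ≤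
      (16 * M ^ 2 + 8) * Q := by
    intro n
    have hn : (0 : ℝ) < n + 1 := by positivity
    refine le_trans ?_ (key (n + 1) (by linarith [(Nat.cast_nonneg n : (0 : ℝ) ≤ n)]))
    have iA : Integrable fun x => cutoff (n + 1) x ^ 2 * (bracket x * v₂ x ^ 2) := by
      refine (((contDiff_cutoff _).continuous.pow 2).mul hcont).integrable_of_hasCompactSupport ?_
      have : (fun x => cutoff (n + 1) x ^ 2) * (fun x => bracket x * v₂ x ^ 2) =
          fun x => cutoff (n + 1) x * (cutoff (n + 1) x * (bracket x * v₂ x ^ 2)) := by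
        ext x; simp only [Pi.mul_apply]; ring
      exact this ▸ (hasCompactSupport_cutoff hn).mul_right
    calc _ = ∫ x in Set.Icc (-((n : ℝ) + 1)) (n + 1),
          cutoff (n + 1) x ^ 2 * (bracket x * v₂ x ^ 2) := by
          refine setIntegral_congr_fun measurableSet_Icc fun x hx => ?_
          simp only [cutoff_eq_one hn (abs_le.2 hx), one_pow, one_mul]
      _ ≤ _ := setIntegral_le_integral iA (ae_of_all _ fun x =>
          mul_nonneg (sq_nonneg _) (mul_nonneg (bracket_pos x).le (sq_nonneg _)))
  have hint : Integrable fun x => bracket x * v₂ x ^ 2 :=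
    hcov.integrable_of_integral_bounded_of_nonneg_ae _
      (fun n => hcont.continuousOn.integrableOn_compact isCompact_Icc)
      (ae_of_all _ fun x => mul_nonneg (bracket_pos x).le (sq_nonneg _)) (Eventually.of_forall hset)
  exact ⟨hint, le_of_tendsto' (hcov.integral_tendsto_of_countably_generated hint) hset⟩

/-- The weighted uniform bound. -/
theorem GoodWeight.sup_bound (h : GoodWeight ε) (hr : IsRegularRep v u k v₀ v₁ v₂)
    (h0 : Integrable fun x => weight ε x * v₀ x ^ 2) (h1 : Integrable fun x => v₁ x ^ 2)
    (hw : Integrable fun x => weight ε x * (x * v₁ x) ^ 2) (x : ℝ) :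
    bracket x * v₀ x ^ 2 ≤ 6 * ((∫ x, weight ε x * v₀ x ^ 2) + (∫ x, v₁ x ^ 2) +
      ∫ x, weight ε x * (x * v₁ x) ^ 2) := by
  have hn0 : 0 ≤ ∫ x, weight ε x * v₀ x ^ 2 :=
    integral_nonneg fun x => mul_nonneg (weight_pos ε x).le (sq_nonneg _)
  have hn1 : 0 ≤ ∫ x, v₁ x ^ 2 := integral_nonneg fun x => sq_nonneg _
  have hn2 : 0 ≤ ∫ x, weight ε x * (x * v₁ x) ^ 2 :=
    integral_nonneg fun x => mul_nonneg (weight_pos ε x).le (sq_nonneg _)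
  set p : ℝ → ℝ := fun x => bracket x * v₀ x ^ 2 with hp
  set p' : ℝ → ℝ := fun x => x / (2 * bracket x ^ 3) * v₀ x ^ 2 + bracket x * (2 * v₀ x * v₁ x)
    with hp'
  have hpd : ∀ x, HasDerivAt p (p' x) x := fun x => by
    refine ((hasDerivAt_bracket x).fun_mul ((hr.hasDerivAt x).fun_pow 2)).congr_deriv ?_
    simp only [hp']; push_cast; ring
  have cb : Continuous bracket := contDiff_bracket.continuous
  have cp' : Continuous p' := by
    refine ((continuous_id.div (continuous_const.mul (cb.pow 3)) fun x => ?_).mul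
      (hr.continuous₀.pow 2)).add (cb.mul ((continuous_const.mul hr.continuous₀).mul hr.continuous₁))
    exact mul_ne_zero two_ne_zero (pow_ne_zero 3 (bracket_pos x).ne')
  set G : ℝ → ℝ := fun x => 2 * (weight ε x * v₀ x ^ 2) + 4 * v₁ x ^ 2 +
    4 * (weight ε x * (x * v₁ x) ^ 2) with hG
  have iG : Integrable G := ((h0.const_mul 2).add (h1.const_mul 4)).add (hw.const_mul 4)
  have eG : ∫ x, G x = 2 * (∫ x, weight ε x * v₀ x ^ 2) + 4 * (∫ x, v₁ x ^ 2) +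
      4 * ∫ x, weight ε x * (x * v₁ x) ^ 2 := by
    rw [hG, integral_add ((h0.const_mul 2).fun_add (h1.const_mul 4)) (hw.const_mul 4),
      integral_add (h0.const_mul 2) (h1.const_mul 4), integral_const_mul, integral_const_mul,
      integral_const_mul]
  have hbound : ∀ x, |p' x| ≤ G x := fun x => by
    have hs := one_le_bracket x
    have hs3 := h.bracket_cube_le x
    have hw1 := h.one_le_weight_mul x
    have hwp := weight_pos ε x
    have hd := abs_deriv_bracket_le x
    have hdw : |x / (2 * bracket x ^ 3)| ≤ weight ε x := hd.trans (by
      rw [div_le_iff₀ (by positivity)]; linarith)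
    simp only [hp', hG]
    generalize x / (2 * bracket x ^ 3) = s' at *
    generalize bracket x = s at *
    generalize v₀ x = a at *
    generalize v₁ x = b at *
    generalize weight ε x = w at *
    have t1 : |s' * a ^ 2| ≤ w * a ^ 2 := by
      rw [abs_mul, abs_of_nonneg (sq_nonneg a)]; gcongr
    have t2 : |s * (2 * a * b)| ≤ w * a ^ 2 + s ^ 2 / w * b ^ 2 := by
      have e : w * a ^ 2 + s ^ 2 / w * b ^ 2 = (w * |a| - s * |b|) ^ 2 / w + 2 * (s * (|a| * |b|)) := by
        field_simp
        nlinarith [sq_abs a, sq_abs b]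
      have : |s * (2 * a * b)| = 2 * (s * (|a| * |b|)) := by
        rw [abs_mul, abs_mul, abs_mul, abs_of_pos (by linarith : 0 < s)]; norm_num; ring
      rw [this, e]
      have : 0 ≤ (w * |a| - s * |b|) ^ 2 / w := by positivity
      linarith
    -- Splitting the product with weight `w` costs `1 / w ≤ 2 s`; the resulting `s³ v'²` is exactly
    -- what `bracket_cube_le` controls.
    have t3 : s ^ 2 / w ≤ 2 * s ^ 3 := by
      rw [div_le_iff₀ hwp]
      nlinarith [mul_le_mul_of_nonneg_left hw1 (sq_nonneg s)]
    have t4 : s ^ 2 / w * b ^ 2 ≤ 4 * (1 + x ^ 2 * w) * b ^ 2 :=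
      mul_le_mul_of_nonneg_right (by linarith) (sq_nonneg b)
    refine (abs_add_le _ _).trans ?_
    linarith
  -- The oscillation of `p` is bounded by the integral of `G`, so it suffices to control the mean of
  -- `p` over a unit interval.
  have hdiff : ∀ y, p x - ∫ x, G x ≤ p y := fun y => by
    have e := intervalIntegral.integral_eq_sub_of_hasDerivAt (a := y) (b := x)
      (fun z _ => hpd z) (cp'.intervalIntegrable y x)
    have b1 : ‖∫ z in y..x, p' z‖ ≤ ∫ z in Set.uIoc y x, ‖p' z‖ :=
      intervalIntegral.norm_integral_le_integral_norm_uIoc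
    have b2 : ∫ z in Set.uIoc y x, ‖p' z‖ ≤ ∫ z in Set.uIoc y x, G z :=
      setIntegral_mono ((cp'.norm.intervalIntegrable y x).def') iG.integrableOn hbound
    have b3 : ∫ z in Set.uIoc y x, G z ≤ ∫ z, G z :=
      setIntegral_le_integral iG (ae_of_all _ fun z => (abs_nonneg _).trans (hbound z))
    rw [e] at b1
    have := (le_abs_self _).trans (b1.trans (b2.trans b3))
    linarith
  have hloc : ∀ y ∈ Set.Icc (0 : ℝ) 1, p y ≤ 4 * (weight ε y * v₀ y ^ 2) := fun y hy => by
    have hs := one_le_bracket y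
    have hw1 := h.one_le_weight_mul y
    have hwp := weight_pos ε y
    have h4 := bracket_pow_four y
    have hy2 : y ^ 2 ≤ 1 := by nlinarith [hy.1, hy.2]
    have hs2 : bracket y ^ 2 ≤ 2 := by nlinarith [sq_nonneg (bracket y ^ 2)]
    have : bracket y ≤ 4 * weight ε y := by
      have := mul_le_mul_of_nonneg_left hw1 (by linarith : 0 ≤ bracket y)
      nlinarith
    calc p y = bracket y * v₀ y ^ 2 := rfl
      _ ≤ 4 * weight ε y * v₀ y ^ 2 := by gcongr
      _ = _ := by ring
  have hfin : p x - ∫ x, G x ≤ 4 * ∫ x, weight ε x * v₀ x ^ 2 := by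
    have e : ∫ _ in Set.Icc (0 : ℝ) 1, (p x - ∫ x, G x) = p x - ∫ x, G x := by simp
    rw [← e, ← integral_const_mul]
    refine (setIntegral_mono_on (integrableOn_const (by simp)) (h0.const_mul 4).integrableOn
      measurableSet_Icc fun y hy => (hdiff y).trans (hloc y hy)).trans ?_
    exact setIntegral_le_integral (h0.const_mul 4) (ae_of_all _ fun z =>
      mul_nonneg (by norm_num) (mul_nonneg (weight_pos ε z).le (sq_nonneg _)))
  change p x ≤ _
  rw [eG] at hfin
  linarith

end

end SelfSimilar

/-! ### Frequency side of square integrable functions with a square integrable weak derivative. -/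

namespace SelfSimilar
open Filter Topology
open scoped ComplexConjugate

/-- A function orthogonal to all frequency side test functions vanishes. -/
theorem ae_eq_zero_of_spectral_orthogonal {Φ : ℝ → ℂ} (hΦ : LocallyIntegrable Φ volume)
    (hort : ∀ g, IsSpectral g → ∫ ξ, conj (g ξ) * Φ ξ = 0) : Φ =ᵐ[volume] 0 := by
  have key : ∀ q : ℝ → ℝ, ContDiff ℝ ∞ q → HasCompactSupport q → tsupport q ⊆ Set.Ioi 0 →
      ∫ ξ, (q ξ : ℂ) * Φ ξ = 0 ∧ ∫ ξ, (q (-ξ) : ℂ) * Φ ξ = 0 := by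
    intro q hq hc hs
    have hqn : ContDiff ℝ ∞ fun ξ => q (-ξ) := hq.comp contDiff_neg
    have hcn : HasCompactSupport fun ξ => q (-ξ) := by
      simpa using! hc.comp_homeomorph (Homeomorph.neg ℝ)
    have hz : ∀ᶠ ξ in 𝓝 (0 : ℝ), q ξ = 0 :=
      notMem_tsupport_iff_eventuallyEq.1 fun h => lt_irrefl (0 : ℝ) (hs h)
    have hzn : ∀ᶠ ξ in 𝓝 (0 : ℝ), q (-ξ) = 0 := by
      have : Tendsto (fun ξ : ℝ => -ξ) (𝓝 0) (𝓝 0) := by simpa using tendsto_neg (0 : ℝ)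
      exact this.eventually hz
    have hi : ∀ p : ℝ → ℝ, ContDiff ℝ ∞ p → HasCompactSupport p →
        Integrable fun ξ => (p ξ : ℂ) * Φ ξ := fun p hp hpc => by
      have := hΦ.integrable_smul_left_of_hasCompactSupport
        (g := fun ξ => (p ξ : ℂ)) (Complex.continuous_ofReal.comp hp.continuous)
        (hpc.comp_left Complex.ofReal_zero)
      simpa only [smul_eq_mul] using this
    have i1 := hi q hq hc
    have i2 := hi _ hqn hcn
    have main : ∀ c : ℂ, conj c * (∫ ξ, (q ξ : ℂ) * Φ ξ) + c * ∫ ξ, (q (-ξ) : ℂ) * Φ ξ = 0 := by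
      intro c
      have h1 := hort (fun ξ => c * (q ξ : ℂ) + conj c * (q (-ξ) : ℂ)) ⟨⟨?_, ?_, ?_⟩, ?_⟩
      · rw [← integral_const_mul, ← integral_const_mul,
          ← integral_add (i1.const_mul _) (i2.const_mul _), ← h1]
        congr 1; ext ξ
        simp only [map_add, map_mul, Complex.conj_conj, Complex.conj_ofReal]
        ring
      · exact (contDiff_const.mul (Complex.ofRealCLM.contDiff.comp hq)).add
          (contDiff_const.mul (Complex.ofRealCLM.contDiff.comp hqn))
      · exact (HasCompactSupport.mul_left (hc.comp_left Complex.ofReal_zero)).add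
          (HasCompactSupport.mul_left (hcn.comp_left Complex.ofReal_zero))
      · intro ξ
        simp only [map_add, map_mul, Complex.conj_conj, Complex.conj_ofReal, neg_neg]
        ring
      · filter_upwards [hz, hzn] with ξ a b
        simp [a, b]
    have m1 := main 1
    have m2 := main Complex.I
    simp only [map_one, one_mul, Complex.conj_I] at m1 m2
    set A := ∫ ξ, (q ξ : ℂ) * Φ ξ
    set B := ∫ ξ, (q (-ξ) : ℂ) * Φ ξ
    have m3 : B - A = 0 := by
      have : Complex.I * (B - A) = 0 := by linear_combination m2
      exact (mul_eq_zero.1 this).resolve_left Complex.I_ne_zero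
    constructor
    · linear_combination (1 / 2 : ℂ) * m1 - (1 / 2 : ℂ) * m3
    · linear_combination (1 / 2 : ℂ) * m1 + (1 / 2 : ℂ) * m3
  have h1 : ∀ᵐ ξ ∂volume, ξ ∈ Set.Ioi (0 : ℝ) → Φ ξ = 0 :=
    isOpen_Ioi.ae_eq_zero_of_integral_contDiff_smul_eq_zero (hΦ.locallyIntegrableOn _)
      fun q hq hc hs => by simpa using (key q hq hc hs).1
  have hΦn : LocallyIntegrable (fun ξ => Φ (-ξ)) volume := by
    rw [locallyIntegrable_iff] at hΦ ⊢
    intro K hK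
    have h1 := hΦ (-K) hK.neg
    have h2 := (Measure.measurePreserving_neg (volume : Measure ℝ)).integrableOn_comp_preimage
      (Homeomorph.neg ℝ).measurableEmbedding (f := Φ) (s := -K)
    have h3 : (fun x : ℝ => -x) ⁻¹' (-K) = K := by ext x; simp
    have h4 := h2.2 h1
    change IntegrableOn _ ((fun x : ℝ => -x) ⁻¹' (-K)) volume at h4
    rw [h3] at h4
    exact h4
  have h2 : ∀ᵐ ξ ∂volume, ξ ∈ Set.Ioi (0 : ℝ) → Φ (-ξ) = 0 :=
    isOpen_Ioi.ae_eq_zero_of_integral_contDiff_smul_eq_zero (hΦn.locallyIntegrableOn _)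
      fun q hq hc hs => by
        have := (key q hq hc hs).2
        rw [← integral_neg_eq_self (fun ξ => (q (-ξ) : ℂ) * Φ ξ)] at this
        simpa using this
  have h3 : ∀ᵐ ξ ∂volume, -ξ ∈ Set.Ioi (0 : ℝ) → Φ (- -ξ) = 0 :=
    (Measure.measurePreserving_neg (volume : Measure ℝ)).quasiMeasurePreserving.ae h2
  have h4 : ∀ᵐ ξ ∂(volume : Measure ℝ), ξ ≠ 0 := by
    simp [ae_iff, measure_singleton]
  filter_upwards [h1, h3, h4] with ξ a b c
  rcases lt_or_gt_of_ne c with h | h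
  · simpa using b (by simpa using h)
  · exact a h

/-- A square integrable function with a square integrable weak derivative. -/
structure IsL2Pair (F F' : ℝ → ℝ) : Prop where
  memLp : MemLp F 2 volume
  memLp' : MemLp F' 2 volume
  ibp : ∀ ψ : ℝ → ℝ, ContDiff ℝ 1 ψ → HasCompactSupport ψ →
    ∫ x, F x * deriv ψ x = -∫ x, F' x * ψ x

theorem eventually_lt_nat_add_one (x : ℝ) : ∀ᶠ n : ℕ in atTop, |x| < (n : ℝ) + 1 := by
  filter_upwards [tendsto_natCast_atTop_atTop.eventually_gt_atTop |x|] with n hn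
  linarith

theorem tendsto_cutoff (x : ℝ) : Tendsto (fun n : ℕ => cutoff ((n : ℝ) + 1) x) atTop (𝓝 1) := by
  refine tendsto_const_nhds.congr' ?_
  filter_upwards [eventually_lt_nat_add_one x] with n hn
  rw [cutoff_eq_one (by positivity) hn.le]

theorem tendsto_deriv_cutoff (x : ℝ) :
    Tendsto (fun n : ℕ => deriv (cutoff ((n : ℝ) + 1)) x) atTop (𝓝 0) := by
  refine tendsto_const_nhds.congr' ?_
  filter_upwards [eventually_lt_nat_add_one x] with n hn
  rw [deriv_cutoff_eq_zero (by positivity) hn]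

theorem IsL2Pair.integral_mul {F F' ψ ψ' : ℝ → ℝ} (h : IsL2Pair F F')
    (hd : ∀ x, HasDerivAt ψ (ψ' x) x) (hc : Continuous ψ') (hψ : MemLp ψ 2 volume)
    (hψ' : MemLp ψ' 2 volume) : ∫ x, F x * ψ' x = -∫ x, F' x * ψ x := by
  obtain ⟨M, hM0, hM⟩ := exists_deriv_cutoff_bound
  have hψs : ContDiff ℝ 1 ψ := by
    rw [contDiff_one_iff_deriv]
    exact ⟨fun x => (hd x).differentiableAt, by rwa [funext fun x => (hd x).deriv]⟩
  have hm := h.memLp.1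
  have hm' := h.memLp'.1
  have hcut := fun n : ℕ => (contDiff_cutoff ((n : ℝ) + 1)).continuous
  have hcut' := fun n : ℕ => (contDiff_deriv (contDiff_cutoff ((n : ℝ) + 1))).continuous
  have hM' : ∀ (n : ℕ) x, |deriv (cutoff ((n : ℝ) + 1)) x| ≤ M := fun n x =>
    (hM _ (by positivity) x).trans
      (div_le_self hM0 (by linarith [(Nat.cast_nonneg n : (0 : ℝ) ≤ n)]))
  have habs : ∀ (n : ℕ) x, |cutoff ((n : ℝ) + 1) x| ≤ 1 := fun n x => by
    rw [abs_of_nonneg (cutoff_nonneg _ _)]; exact cutoff_le_one _ _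
  have b1 : Integrable fun x => |F x * ψ' x| := (h.memLp.integrable_mul hψ').abs
  have b2 : Integrable fun x => M * |F x * ψ x| := (h.memLp.integrable_mul hψ).abs.const_mul M
  have b3 : Integrable fun x => |F' x * ψ x| := (h.memLp'.integrable_mul hψ).abs
  have l1 : Tendsto (fun n : ℕ => ∫ x, cutoff ((n : ℝ) + 1) x * (F x * ψ' x)) atTop
      (𝓝 (∫ x, F x * ψ' x)) := by
    refine tendsto_integral_of_dominated_convergence _ (fun n =>
      (hcut n).aestronglyMeasurable.mul (hm.mul hψ'.1)) b1 (fun n => ae_of_all _ fun x => ?_)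
      (ae_of_all _ fun x => by simpa using (tendsto_cutoff x).mul_const (F x * ψ' x))
    rw [Real.norm_eq_abs, abs_mul]
    exact mul_le_of_le_one_left (abs_nonneg _) (habs n x)
  have l2 : Tendsto (fun n : ℕ => ∫ x, deriv (cutoff ((n : ℝ) + 1)) x * (F x * ψ x)) atTop
      (𝓝 (∫ _ : ℝ, (0 : ℝ))) := by
    refine tendsto_integral_of_dominated_convergence _ (fun n =>
      (hcut' n).aestronglyMeasurable.mul (hm.mul hψ.1)) b2 (fun n => ae_of_all _ fun x => ?_)
      (ae_of_all _ fun x => by simpa using (tendsto_deriv_cutoff x).mul_const (F x * ψ x))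
    rw [Real.norm_eq_abs, abs_mul]
    exact mul_le_mul_of_nonneg_right (hM' n x) (abs_nonneg _)
  have l3 : Tendsto (fun n : ℕ => ∫ x, cutoff ((n : ℝ) + 1) x * (F' x * ψ x)) atTop
      (𝓝 (∫ x, F' x * ψ x)) := by
    refine tendsto_integral_of_dominated_convergence _ (fun n =>
      (hcut n).aestronglyMeasurable.mul (hm'.mul hψ.1)) b3 (fun n => ae_of_all _ fun x => ?_)
      (ae_of_all _ fun x => by simpa using (tendsto_cutoff x).mul_const (F' x * ψ x))
    rw [Real.norm_eq_abs, abs_mul]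
    exact mul_le_of_le_one_left (abs_nonneg _) (habs n x)
  have hn : ∀ n : ℕ, (∫ x, deriv (cutoff ((n : ℝ) + 1)) x * (F x * ψ x)) +
      ∫ x, cutoff ((n : ℝ) + 1) x * (F x * ψ' x) =
      -∫ x, cutoff ((n : ℝ) + 1) x * (F' x * ψ x) := fun n => by
    have hcs := contDiff_cutoff ((n : ℝ) + 1)
    have key := h.ibp (fun x => cutoff ((n : ℝ) + 1) x * ψ x) ((hcs.of_le (by simp)).mul hψs)
      (hasCompactSupport_cutoff (by positivity)).mul_right
    have e : ∀ x, deriv (fun x => cutoff ((n : ℝ) + 1) x * ψ x) x =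
        deriv (cutoff ((n : ℝ) + 1)) x * ψ x + cutoff ((n : ℝ) + 1) x * ψ' x := fun x =>
      ((hcs.differentiable (by simp) x).hasDerivAt.fun_mul (hd x)).deriv
    simp only [e] at key
    have i1 : Integrable fun x => deriv (cutoff ((n : ℝ) + 1)) x * (F x * ψ x) :=
      integrable_bdd_mul_mul (hcut' n).aestronglyMeasurable (hM' n) h.memLp hψ
    have i2 : Integrable fun x => cutoff ((n : ℝ) + 1) x * (F x * ψ' x) :=
      integrable_bdd_mul_mul (hcut n).aestronglyMeasurable (habs n) h.memLp hψ'
    rw [← integral_add i1 i2]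
    calc _ = ∫ x, F x * (deriv (cutoff ((n : ℝ) + 1)) x * ψ x + cutoff ((n : ℝ) + 1) x * ψ' x) := by
          congr 1; ext x; ring
      _ = _ := key
      _ = _ := by congr 2; ext x; ring
  have := tendsto_nhds_unique ((l2.add l1).congr hn) l3.neg
  simpa using this

theorem conj_symD (ξ : ℝ) : conj (symD ξ) = -symD ξ := by
  simp [symD, map_ofNat]

/-- Pairing with the test functions `synth g` suffices, because locally integrable functions are
determined by their pairings with `IsSpectral` functions. -/
theorem IsL2Pair.fourier {F F' : ℝ → ℝ} (h : IsL2Pair F F') :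
    (𝓕 (coeCLM (h.memLp'.toLp F')) : Lp ℂ 2 (volume : Measure ℝ)) =ᵐ[volume]
      fun ξ => symD ξ * (𝓕 (coeCLM (h.memLp.toLp F)) : Lp ℂ 2 (volume : Measure ℝ)) ξ := by
  rw [coeCLM_toLp, coeCLM_toLp]
  set Φ : Lp ℂ 2 (volume : Measure ℝ) := 𝓕 ((memLp_coe h.memLp).toLp _) with hΦ
  set Φ' : Lp ℂ 2 (volume : Measure ℝ) := 𝓕 ((memLp_coe h.memLp').toLp _) with hΦ'
  have c1 : Continuous symD := by unfold symD; fun_prop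
  have l1 : LocallyIntegrable Φ volume := (Lp.memLp Φ).locallyIntegrable (by norm_num)
  have l2 : LocallyIntegrable Φ' volume := (Lp.memLp Φ').locallyIntegrable (by norm_num)
  have l3 : LocallyIntegrable (fun ξ => symD ξ * Φ ξ) volume := by
    rw [locallyIntegrable_iff] at l1 ⊢
    exact fun K hK => (l1 K hK).continuousOn_mul c1.continuousOn hK
  have hz := ae_eq_zero_of_spectral_orthogonal (Φ := fun ξ => Φ' ξ - symD ξ * Φ ξ) (l2.sub l3)
    fun g hg => by
      have h1 := h.integral_mul (ψ := synth g) (ψ' := synth (mulD g))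
        (fun x => hg.hasDerivAt_synth x) (continuous_synth hg.test_mulD.toIsHermTest)
        hg.memLp_synth hg.test_mulD.memLp_synth
      have h2 := integral_mul_synth h.memLp hg.test_mulD.toIsHermTest
      have h3 := integral_mul_synth h.memLp' hg.toIsHermTest
      have i1 : Integrable fun ξ => conj (g ξ) * Φ' ξ :=
        ((Lp.memLp Φ').integrable_mul (hg.memLp.star)).congr (ae_of_all _ fun ξ => by
          simp [mul_comm])
      have i2 : Integrable fun ξ => conj (mulD g ξ) * Φ ξ :=
        ((Lp.memLp Φ).integrable_mul (hg.test_mulD.memLp.star)).congr (ae_of_all _ fun ξ => by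
          simp [mul_comm])
      have e : ∫ ξ, conj (g ξ) * (Φ' ξ - symD ξ * Φ ξ) =
          (∫ ξ, conj (g ξ) * Φ' ξ) + ∫ ξ, conj (mulD g ξ) * Φ ξ := by
        rw [← integral_add i1 i2]
        congr 1; ext ξ
        simp only [mulD, map_mul, conj_symD]
        ring
      rw [e, ← h2, ← h3]
      norm_cast
      have e1 : ∫ x, synth (mulD g) x * F x = ∫ x, F x * synth (mulD g) x := by
        congr 1; ext x; ring
      have e2 : ∫ x, synth g x * F' x = ∫ x, F' x * synth g x := by congr 1; ext x; ring
      rw [e1, e2, h1]; ring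
  filter_upwards [hz] with ξ hξ
  exact sub_eq_zero.1 hξ

/-- The symbol of the derivative commutes with that of the Hilbert transform and is purely
imaginary. -/
theorem inner_iHilbert_deriv {F F' φ φ' : ℝ → ℝ} (h : IsL2Pair F F') (hφ : IsL2Pair φ φ') :
    inner ℂ (coeCLM (hφ.memLp.toLp φ)) (iHilbert (h.memLp'.toLp F')) =
      -inner ℂ (coeCLM (hφ.memLp'.toLp φ')) (iHilbert (h.memLp.toLp F)) := by
  rw [← Lp.inner_fourier_eq, ← Lp.inner_fourier_eq (coeCLM (hφ.memLp'.toLp φ')), L2.inner_def,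
    L2.inner_def, ← integral_neg]
  refine integral_congr_ae ?_
  filter_upwards [fourier_iHilbert (h.memLp'.toLp F'), fourier_iHilbert (h.memLp.toLp F),
    h.fourier, hφ.fourier] with ξ h1 h2 h3 h4
  rw [h1, h2, h3, h4, RCLike.inner_apply, RCLike.inner_apply, map_mul, conj_symD]
  ring

/-- The symbol of `i ℍ ∂ₓ` is `i · (-sgn ξ) · 2πiξ = 2π|ξ|`. -/
theorem re_inner_iHilbert_nonneg {F F' : ℝ → ℝ} (h : IsL2Pair F F') :
    0 ≤ (inner ℂ (coeCLM (h.memLp.toLp F)) (iHilbert (h.memLp'.toLp F'))).re := by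
  rw [← Lp.inner_fourier_eq, L2.inner_def]
  have hi := L2.integrable_inner (𝕜 := ℂ) (𝓕 (coeCLM (h.memLp.toLp F)))
    (𝓕 (iHilbert (h.memLp'.toLp F')))
  have e := Complex.reCLM.integral_comp_comm hi
  change _ = Complex.re _ at e
  rw [← e]
  refine integral_nonneg_of_ae ?_
  filter_upwards [fourier_iHilbert (h.memLp'.toLp F'), h.fourier] with ξ h1 h3
  rw [h1, h3, RCLike.inner_apply]
  set z := (𝓕 (coeCLM (h.memLp.toLp F)) : Lp ℂ 2 (volume : Measure ℝ)) ξ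
  have hs : 0 ≤ Real.sign ξ * ξ := by
    rcases lt_trichotomy ξ 0 with h | h | h
    · rw [Real.sign_of_neg h]; linarith
    · simp [h]
    · rw [Real.sign_of_pos h]; linarith
  have e2 : Complex.I * (hilbertSymbol ξ * (symD ξ * z)) * conj z =
      ((2 * Real.pi * (Real.sign ξ * ξ) * Complex.normSq z : ℝ) : ℂ) := by
    have hI : Complex.I * Complex.I = -1 := Complex.I_mul_I
    have hn : z * conj z = (Complex.normSq z : ℂ) := Complex.mul_conj z
    push_cast
    simp only [hilbertSymbol, symD]
    linear_combination (-(Real.sign ξ : ℂ) * 2 * Real.pi * ξ * z * conj z) * hI +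
      (2 * Real.pi * (Real.sign ξ : ℂ) * ξ) * hn
  rw [e2]
  simp only [Pi.zero_apply, Complex.reCLM_apply, Complex.ofReal_re]
  have := Complex.normSq_nonneg z
  have := Real.pi_pos
  positivity

end SelfSimilar

/-! ### Uniqueness. -/

namespace SelfSimilar
open Filter Topology
open scoped ComplexConjugate

section
variable {ε : ℝ} {v u k v₀ v₁ v₂ : ℝ → ℝ}

theorem IsRegularRep.memLp_second (hr : IsRegularRep v u k v₀ v₁ v₂)
    (hi : Integrable fun x => bracket x * v₂ x ^ 2) : MemLp v₂ 2 volume := by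
  rw [memLp_two_iff_integrable_sq hr.continuous.aestronglyMeasurable]
  refine hi.mono' (hr.continuous.pow 2).aestronglyMeasurable (ae_of_all _ fun x => ?_)
  rw [Real.norm_eq_abs, abs_of_nonneg (sq_nonneg _)]
  exact le_mul_of_one_le_left (sq_nonneg _) (one_le_bracket x)

/-- The weight decays more slowly than `R⁻²`, so `χ' v` is dominated by `w^{1/2} v`. The cut-off
error thus vanishes in the limit even though `v` itself need not lie in `L²`. -/
theorem sq_deriv_cutoff_le (h : GoodWeight ε) {M : ℝ}
    (hM : ∀ R : ℝ, 0 < R → ∀ x, |deriv (cutoff R) x| ≤ M / R) {R : ℝ} (hR : 1 ≤ R) (x : ℝ) :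
    deriv (cutoff R) x ^ 2 ≤ 4 * M ^ 2 * weight ε x := by
  have hR0 : 0 < R := by linarith
  have hw := weight_pos ε x
  rcases le_or_gt |x| (2 * R) with hx | hx
  · have h1 := h.one_le_weight_mul x
    have hs1 := one_le_bracket x
    have h4 := bracket_pow_four x
    have hx2 : x ^ 2 ≤ 4 * R ^ 2 := by
      rw [← sq_abs]; nlinarith [abs_nonneg x]
    have hs : bracket x ≤ 2 * R := by
      refine le_of_pow_le_pow_left₀ (n := 4) (by norm_num) (by positivity) ?_
      rw [h4]
      nlinarith [mul_le_mul hR hR (by norm_num) (by linarith), sq_nonneg (R ^ 2 - 1)]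
    have h2 : 1 ≤ 4 * R ^ 2 * weight ε x := by
      have : weight ε x * bracket x ≤ weight ε x * (2 * R) := by gcongr
      nlinarith
    have h3 : deriv (cutoff R) x ^ 2 ≤ (M / R) ^ 2 := by
      rw [← sq_abs]; exact pow_le_pow_left₀ (abs_nonneg _) (hM R hR0 x) 2
    refine h3.trans ?_
    rw [div_pow, div_le_iff₀ (by positivity)]
    nlinarith [mul_le_mul_of_nonneg_left h2 (sq_nonneg M)]
  · rw [deriv_cutoff_eq_zero' hR0 hx, zero_pow two_ne_zero]
    positivity

/-- Makes the term where the derivative falls on the cut-off in the transport part dominated by `w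
v²`. -/
theorem abs_mul_deriv_cutoff_le {M : ℝ} (hM0 : 0 ≤ M)
    (hM : ∀ R : ℝ, 0 < R → ∀ x, |deriv (cutoff R) x| ≤ M / R) {R : ℝ} (hR : 0 < R) (x : ℝ) :
    |x * deriv (cutoff R) x| ≤ 2 * M := by
  rcases le_or_gt |x| (2 * R) with hx | hx
  · rw [abs_mul]
    calc |x| * |deriv (cutoff R) x| ≤ 2 * R * (M / R) := by
          gcongr; exact hM R hR x
      _ = 2 * M := by field_simp
  · rw [deriv_cutoff_eq_zero' hR hx]
    simpa using hM0

/-- Uniqueness for the homogeneous equation. -/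
theorem GoodWeight.eq_zero_of_homogeneous (h : GoodWeight ε) (hr : IsRegularRep v u k v₀ v₁ v₂)
    (h0 : Integrable fun x => weight ε x * v₀ x ^ 2) (h1 : MemLp v₁ 2 volume)
    (hw : Integrable fun x => weight ε x * (x * v₁ x) ^ 2) (hk : MemLp k 2 volume)
    (heq : iHilbert (hk.toLp k) =ᵐ[volume]
      fun x => ((-(weight ε x * (x / (3 * aExp ε)) * v₁ x) : ℝ) : ℂ)) :
    v₀ =ᵐ[volume] 0 := by
  obtain ⟨ha, -⟩ := h.a_mem
  have ha0 : 0 < aExp ε := by linarith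
  obtain ⟨C, -, hC⟩ := exists_second_deriv_bound
  have h2 : MemLp v₂ 2 volume := hr.memLp_second (hC h hr h1 hk hw).1
  obtain ⟨M, hM0, hM⟩ := exists_deriv_cutoff_bound
  have hpair1 : IsL2Pair v₁ v₂ := ⟨h1, h2, fun ψ hψ hs =>
    integral_mul_deriv_of_hasDerivAt hr.hasDerivAt' hr.continuous hψ hs⟩
  have hpair2 : IsL2Pair v₂ k := ⟨h2, hk, hr.ibp⟩
  set b : ℝ → ℝ := fun x => weight ε x * (x / (3 * aExp ε)) with hb
  set b' : ℝ → ℝ := fun x => 3 * ε * iHdG (aExp ε) x * weight ε x * (x / (3 * aExp ε)) +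
    weight ε x * (1 / (3 * aExp ε)) with hb'
  have hbd : ∀ x, HasDerivAt b (b' x) x := fun x =>
    (h.hasDerivAt x).fun_mul ((hasDerivAt_id' x).div_const _)
  have cw := h.continuous
  have cb' : Continuous b' := by
    have := h.continuous_iHdG
    exact (((continuous_const.mul this).mul cw).mul (continuous_id.div_const _)).add
      (cw.mul continuous_const)
  have cb : Continuous b := cw.mul (continuous_id.div_const _)
  have hbs : ContDiff ℝ 1 b := by
    rw [contDiff_one_iff_deriv]
    exact ⟨fun x => (hbd x).differentiableAt, by rwa [funext fun x => (hbd x).deriv]⟩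
  have hb'e : ∀ x, b' x = weight ε x * (1 + x * (3 * ε * iHdG (aExp ε) x)) / (3 * aExp ε) :=
    fun x => by simp only [hb']; field_simp; ring
  -- Slow variation of the weight makes `b'` at least a multiple of `w`; strict positivity is what
  -- forces the solution to vanish.
  have hb'l : ∀ x, weight ε x / (6 * aExp ε) ≤ b' x := fun x => by
    have := abs_le.1 (h.deriv_small x)
    have hp := weight_pos ε x
    rw [hb'e, div_le_div_iff₀ (by positivity) (by positivity)]
    have : weight ε x * 1 ≤ weight ε x * (2 * (1 + x * (3 * ε * iHdG (aExp ε) x))) := by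
      gcongr; linarith
    nlinarith
  have hb'u : ∀ x, |b' x| ≤ weight ε x := fun x => by
    have := abs_le.1 (h.deriv_small x)
    have hp := weight_pos ε x
    rw [hb'e, abs_of_nonneg (by have : 0 ≤ 1 + x * (3 * ε * iHdG (aExp ε) x) := by linarith
                                positivity), div_le_iff₀ (by positivity)]
    have : weight ε x * (1 + x * (3 * ε * iHdG (aExp ε) x)) ≤ weight ε x * (3 * aExp ε) := by
      gcongr; linarith
    linarith
  -- the pairing with `i ℍ v₂` as an integral
  let ℓ : Lp ℝ 2 (volume : Measure ℝ) →L[ℝ] ℝ :=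
    Complex.reCLM.comp (((innerSL ℂ (iHilbert (h2.toLp v₂))).restrictScalars ℝ).comp coeCLM)
  set y := (InnerProductSpace.toDual ℝ (Lp ℝ 2 (volume : Measure ℝ))).symm ℓ with hy
  have hym := Lp.memLp y
  have hℓ : ∀ {f : ℝ → ℝ} (hf : MemLp f 2 volume),
      (inner ℂ (coeCLM (hf.toLp f)) (iHilbert (h2.toLp v₂))).re = ∫ x, y x * f x := by
    intro f hf
    have e1 : ℓ (hf.toLp f) = (inner ℂ (coeCLM (hf.toLp f)) (iHilbert (h2.toLp v₂))).re := by
      change (inner ℂ (iHilbert (h2.toLp v₂)) (coeCLM (hf.toLp f))).re = _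
      rw [← inner_conj_symm, Complex.conj_re]
    rw [← e1, ← inner_toLp hym hf, Lp.toLp_coeFn y hym, hy]
    exact (InnerProductSpace.toDual_symm_apply).symm
  have hpos : 0 ≤ ∫ x, y x * v₁ x := by
    rw [← hℓ h1]; exact re_inner_iHilbert_nonneg hpair1
  have cut : ∀ n : ℕ, ContDiff ℝ ∞ (cutoff ((n : ℝ) + 1)) := fun n => contDiff_cutoff _
  have hn0 : ∀ n : ℕ, (0 : ℝ) < n + 1 := fun n => by positivity
  have hn1 : ∀ n : ℕ, (1 : ℝ) ≤ n + 1 := fun n => by linarith [(Nat.cast_nonneg n : (0 : ℝ) ≤ n)]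
  have hcd : ∀ (n : ℕ) x, HasDerivAt (cutoff ((n : ℝ) + 1)) (deriv (cutoff ((n : ℝ) + 1)) x) x :=
    fun n x => ((cut n).differentiable (by simp) x).hasDerivAt
  have hcc := fun n : ℕ => (cut n).continuous
  have hcc' := fun n : ℕ => (contDiff_deriv (cut n)).continuous
  -- The equation tested with `χ v`: on one side a derivative is moved from `v'''` to `χ v`, on the
  -- other `v v'` is half the derivative of `v²`.
  have hid : ∀ n : ℕ, -(1 / 2) * (∫ x, (deriv (cutoff ((n : ℝ) + 1)) x * b x +
      cutoff ((n : ℝ) + 1) x * b' x) * v₀ x ^ 2) =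
      ∫ x, y x * (deriv (cutoff ((n : ℝ) + 1)) x * v₀ x + cutoff ((n : ℝ) + 1) x * v₁ x) := by
    intro n
    set χ := cutoff ((n : ℝ) + 1) with hχ
    have hχc : HasCompactSupport χ := hasCompactSupport_cutoff (hn0 n)
    set ψ : ℝ → ℝ := fun x => χ x * v₀ x with hψ
    set ψ' : ℝ → ℝ := fun x => deriv χ x * v₀ x + χ x * v₁ x with hψ'
    have hψd : ∀ x, HasDerivAt ψ (ψ' x) x := fun x => (hcd n x).fun_mul (hr.hasDerivAt x)
    have cψ : Continuous ψ := (hcc n).mul hr.continuous₀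
    have cψ' : Continuous ψ' :=
      ((hcc' n).mul hr.continuous₀).add ((hcc n).mul hr.continuous₁)
    have hψc : HasCompactSupport ψ := hχc.mul_right
    have hψc' : HasCompactSupport ψ' := by
      have := hψc.deriv
      rwa [funext fun x => (hψd x).deriv] at this
    have hp : IsL2Pair ψ ψ' := ⟨cψ.memLp_of_hasCompactSupport hψc,
      cψ'.memLp_of_hasCompactSupport hψc', fun φ hφ hs =>
        integral_mul_deriv_of_hasDerivAt hψd cψ' hφ hs⟩
    have e1 := congrArg Complex.re (inner_iHilbert_deriv hpair2 hp)
    rw [Complex.neg_re, hℓ hp.memLp'] at e1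
    have e2 : inner ℂ (coeCLM (hp.memLp.toLp ψ)) (iHilbert (hk.toLp k)) =
        ((∫ x, -(b x * v₁ x) * ψ x : ℝ) : ℂ) := by
      rw [L2.inner_def, ← integral_complex_ofReal]
      refine integral_congr_ae ?_
      filter_upwards [heq, coeCLM_ae (hp.memLp.toLp ψ), hp.memLp.coeFn_toLp] with x a1 a2 a3
      rw [a1, a2, a3, RCLike.inner_apply, Complex.conj_ofReal]
      simp only [hb]
      push_cast; ring
    rw [e2, Complex.ofReal_re] at e1
    have e3 := integral_mul_deriv_of_hasDerivAt (p := fun x => v₀ x ^ 2)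
      (p' := fun x => 2 * v₀ x * v₁ x) (ψ := fun x => χ x * b x)
      (fun x => ((hr.hasDerivAt x).fun_pow 2).congr_deriv (by push_cast; ring))
      ((continuous_const.mul hr.continuous₀).mul hr.continuous₁)
      (((cut n).of_le (by simp)).mul hbs) hχc.mul_right
    have e4 : ∀ x, deriv (fun x => χ x * b x) x = deriv χ x * b x + χ x * b' x := fun x =>
      ((hcd n x).fun_mul (hbd x)).deriv
    simp only [e4] at e3
    have e5 : ∫ x, (deriv χ x * b x + χ x * b' x) * v₀ x ^ 2 =
        ∫ x, v₀ x ^ 2 * (deriv χ x * b x + χ x * b' x) := by congr 1; ext x; ring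
    have e6 : ∫ x, 2 * v₀ x * v₁ x * (χ x * b x) = -2 * ∫ x, -(b x * v₁ x) * ψ x := by
      rw [← integral_const_mul]
      congr 1; ext x; simp only [hψ]; ring
    rw [e5, e3, e6, e1]
    ring
  have hlimL : Tendsto (fun n : ℕ => ∫ x, (deriv (cutoff ((n : ℝ) + 1)) x * b x +
      cutoff ((n : ℝ) + 1) x * b' x) * v₀ x ^ 2) atTop (𝓝 (∫ x, b' x * v₀ x ^ 2)) := by
    refine tendsto_integral_of_dominated_convergence (fun x => (2 * M + 1) * (weight ε x * v₀ x ^ 2))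
      (fun n => ((((hcc' n).mul cb).add ((hcc n).mul cb')).mul
        (hr.continuous₀.pow 2)).aestronglyMeasurable) (h0.const_mul _)
      (fun n => ae_of_all _ fun x => ?_) (ae_of_all _ fun x => ?_)
    · have hp := weight_pos ε x
      have t1 : |deriv (cutoff ((n : ℝ) + 1)) x * b x| ≤ 2 * M * weight ε x := by
        have e : deriv (cutoff ((n : ℝ) + 1)) x * b x =
            (x * deriv (cutoff ((n : ℝ) + 1)) x) * (weight ε x / (3 * aExp ε)) := by
          simp only [hb]; ring
        rw [e, abs_mul, abs_of_pos (by positivity : 0 < weight ε x / (3 * aExp ε))]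
        have : weight ε x / (3 * aExp ε) ≤ weight ε x :=
          div_le_self hp.le (by linarith)
        exact mul_le_mul (abs_mul_deriv_cutoff_le hM0 hM (hn0 n) x) this (by positivity)
          (by positivity)
      have t2 : |cutoff ((n : ℝ) + 1) x * b' x| ≤ weight ε x := by
        rw [abs_mul, abs_of_nonneg (cutoff_nonneg _ _)]
        exact (mul_le_of_le_one_left (abs_nonneg _) (cutoff_le_one _ _)).trans (hb'u x)
      rw [Real.norm_eq_abs, abs_mul, abs_of_nonneg (sq_nonneg (v₀ x)),
        ← mul_assoc (2 * M + 1)]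
      refine mul_le_mul_of_nonneg_right ((abs_add_le _ _).trans ?_) (sq_nonneg _)
      linarith
    · have := (((tendsto_deriv_cutoff x).mul_const (b x)).add
        ((tendsto_cutoff x).mul_const (b' x))).mul_const (v₀ x ^ 2)
      simpa using this
  have hlimR : Tendsto (fun n : ℕ => ∫ x, y x * (deriv (cutoff ((n : ℝ) + 1)) x * v₀ x +
      cutoff ((n : ℝ) + 1) x * v₁ x)) atTop (𝓝 (∫ x, y x * v₁ x)) := by
    have iy : Integrable fun x => y x ^ 2 := hym.integrable_sq
    have i1 : Integrable fun x => v₁ x ^ 2 := h1.integrable_sq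
    refine tendsto_integral_of_dominated_convergence
      (fun x => (y x ^ 2 + 4 * M ^ 2 * (weight ε x * v₀ x ^ 2)) + (y x ^ 2 + v₁ x ^ 2))
      (fun n => hym.1.mul (((hcc' n).mul hr.continuous₀).add
        ((hcc n).mul hr.continuous₁)).aestronglyMeasurable)
      ((iy.add (h0.const_mul _)).add (iy.add i1))
      (fun n => ae_of_all _ fun x => ?_) (ae_of_all _ fun x => ?_)
    · have t1 := sq_deriv_cutoff_le h hM (hn1 n) x
      have c0 := cutoff_nonneg ((n : ℝ) + 1) x
      have c1 := cutoff_le_one ((n : ℝ) + 1) x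
      have t2 := mul_le_mul_of_nonneg_right t1 (sq_nonneg (v₀ x))
      have t3 : (cutoff ((n : ℝ) + 1) x * v₁ x) ^ 2 ≤ v₁ x ^ 2 := by
        rw [mul_pow]
        exact mul_le_of_le_one_left (sq_nonneg _) (pow_le_one₀ c0 c1)
      rw [Real.norm_eq_abs, mul_add]
      refine (abs_add_le _ _).trans (add_le_add ?_ ?_)
      · rw [abs_le]
        constructor <;> nlinarith [sq_nonneg (y x + deriv (cutoff ((n : ℝ) + 1)) x * v₀ x),
          sq_nonneg (y x - deriv (cutoff ((n : ℝ) + 1)) x * v₀ x)]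
      · rw [abs_le]
        constructor <;> nlinarith [sq_nonneg (y x + cutoff ((n : ℝ) + 1) x * v₁ x),
          sq_nonneg (y x - cutoff ((n : ℝ) + 1) x * v₁ x)]
    · have := (((tendsto_deriv_cutoff x).mul_const (v₀ x)).add
        ((tendsto_cutoff x).mul_const (v₁ x))).const_mul (y x)
      simpa using this
  -- In the limit `-(1/2) ∫ b' v²` equals the form of `|D|` at `v'`, which is nonnegative; both
  -- sides must be zero.
  have hfin := tendsto_nhds_unique ((hlimL.const_mul (-(1 / 2))).congr hid) hlimR
  have ib' : Integrable fun x => b' x * v₀ x ^ 2 := by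
    refine h0.mono' (cb'.mul (hr.continuous₀.pow 2)).aestronglyMeasurable (ae_of_all _ fun x => ?_)
    rw [Real.norm_eq_abs, abs_mul, abs_of_nonneg (sq_nonneg (v₀ x))]
    exact mul_le_mul_of_nonneg_right (hb'u x) (sq_nonneg _)
  have hnn : ∀ x, 0 ≤ b' x * v₀ x ^ 2 := fun x =>
    mul_nonneg ((by have := weight_pos ε x; positivity : (0:ℝ) ≤ weight ε x / (6 * aExp ε)).trans
      (hb'l x)) (sq_nonneg _)
  have hz : ∫ x, b' x * v₀ x ^ 2 = 0 := le_antisymm (by linarith) (integral_nonneg hnn)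
  have hae := (integral_eq_zero_iff_of_nonneg hnn ib').1 hz
  filter_upwards [hae] with x hx
  have hbp : 0 < b' x := lt_of_lt_of_le (by have := weight_pos ε x; positivity) (hb'l x)
  have : v₀ x ^ 2 = 0 := (mul_eq_zero.1 hx).resolve_left hbp.ne'
  simpa using this

end

end SelfSimilar

/-! ### From quadratic bounds to norms, and assembly of the theorem. -/

namespace SelfSimilar
open Filter Topology

theorem eLpNorm_two_eq {f : ℝ → ℝ} (hf : MemLp f 2 volume) :
    eLpNorm f 2 volume = ENNReal.ofReal (Real.sqrt (∫ x, f x ^ 2)) := by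
  rw [← norm_toLp_sq hf, Real.sqrt_sq (norm_nonneg _), Lp.norm_toLp,
    ENNReal.ofReal_toReal hf.2.ne]

theorem IsWeakDeriv.sub {j : ℕ} {v v' g g' : ℝ → ℝ} (h : IsWeakDeriv j v g)
    (h' : IsWeakDeriv j v' g') : IsWeakDeriv j (fun x => v x - v' x) fun x => g x - g' x := by
  refine ⟨h.1.sub h'.1, h.2.1.sub h'.2.1, fun φ hφ hs => ?_⟩
  have hs' : HasCompactSupport (iteratedDeriv j φ) := by
    clear * - hs
    induction j with
    | zero => simpa using hs
    | succ j ih => rw [iteratedDeriv_succ]; exact ih.deriv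
  have hc : Continuous (iteratedDeriv j φ) :=
    hφ.continuous_iteratedDeriv j (by exact_mod_cast le_top)
  simp only [sub_mul]
  rw [integral_sub (integrable_mul_test h.1 hc hs') (integrable_mul_test h'.1 hc hs'),
    integral_sub (integrable_mul_test h.2.1 hφ.continuous hs)
      (integrable_mul_test h'.2.1 hφ.continuous hs), h.2.2 φ hφ hs, h'.2.2 φ hφ hs]
  ring

theorem sq_weight_half_mul (ε x y : ℝ) :
    (weight ε x ^ (1 / 2 : ℝ) * y) ^ 2 = weight ε x * y ^ 2 := by
  rw [mul_pow, ← Real.sqrt_eq_rpow, Real.sq_sqrt (weight_pos ε x).le]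

section
variable {ε : ℝ} {v : ℝ → ℝ}

theorem MemL2w.integrable {f : ℝ → ℝ} (hf : MemL2w ε f) :
    Integrable fun x => weight ε x * f x ^ 2 := by
  simpa only [sq_weight_half_mul] using MemLp.integrable_sq hf

theorem MemL2w.congr {f f' : ℝ → ℝ} (hf : MemL2w ε f) (h : f =ᵐ[volume] f') : MemL2w ε f' := by
  refine (memLp_congr_ae ?_).1 hf
  filter_upwards [h] with x hx
  rw [hx]

theorem normL2w_eq {f : ℝ → ℝ} (hf : MemL2w ε f) :
    normL2w ε f = ENNReal.ofReal (Real.sqrt (∫ x, weight ε x * f x ^ 2)) := by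
  rw [normL2w, eLpNorm_two_eq hf]
  simp only [sq_weight_half_mul]

theorem normX_eq (h : MemX ε v) : normX ε v = ENNReal.ofReal
    (Real.sqrt (∫ x, weight ε x * v x ^ 2) +
      Real.sqrt (∫ x, weight ε x * (x * weakDeriv 1 v x) ^ 2) +
      Real.sqrt (∫ x, weakDeriv 1 v x ^ 2) + Real.sqrt (∫ x, weakDeriv 3 v x ^ 2)) := by
  rw [normX, normL2w_eq h.1, normL2w_eq h.2.2.2, normHdot, normHdot, eLpNorm_two_eq h.2.1.2,
    eLpNorm_two_eq h.2.2.1.2, ENNReal.ofReal_add (by positivity) (by positivity),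
    ENNReal.ofReal_add (by positivity) (by positivity),
    ENNReal.ofReal_add (by positivity) (by positivity)]

theorem MemX.exists_rep (h : MemX ε v) :
    ∃ v₀ v₁ v₂, IsRegularRep v (weakDeriv 1 v) (weakDeriv 3 v) v₀ v₁ v₂ :=
  exists_regularRep h.2.1.1.isWeakDeriv h.2.2.1.1.isWeakDeriv

theorem sqrt_four_le {a b c d y K : ℝ} (ha : 0 ≤ a) (hb : 0 ≤ b) (hc : 0 ≤ c) (hd : 0 ≤ d)
    (hK : 0 ≤ K) (h : y ≤ K * (a + b + c + d)) :
    Real.sqrt y ≤ Real.sqrt K * (Real.sqrt a + Real.sqrt b + Real.sqrt c + Real.sqrt d) := by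
  refine (Real.sqrt_le_sqrt h).trans ?_
  rw [Real.sqrt_mul hK]
  refine mul_le_mul_of_nonneg_left ?_ (Real.sqrt_nonneg _)
  rw [Real.sqrt_le_left (by positivity)]
  nlinarith [Real.sq_sqrt ha, Real.sq_sqrt hb, Real.sq_sqrt hc, Real.sq_sqrt hd,
    mul_nonneg (Real.sqrt_nonneg a) (Real.sqrt_nonneg b),
    mul_nonneg (Real.sqrt_nonneg a) (Real.sqrt_nonneg c),
    mul_nonneg (Real.sqrt_nonneg a) (Real.sqrt_nonneg d),
    mul_nonneg (Real.sqrt_nonneg b) (Real.sqrt_nonneg c),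
    mul_nonneg (Real.sqrt_nonneg b) (Real.sqrt_nonneg d),
    mul_nonneg (Real.sqrt_nonneg c) (Real.sqrt_nonneg d)]

theorem eighth_sq (x : ℝ) : ((1 + x ^ 2) ^ (1 / 8 : ℝ)) ^ 2 = bracket x := by
  have h : (0 : ℝ) ≤ 1 + x ^ 2 := by positivity
  rw [bracket, ← Real.rpow_natCast, ← Real.rpow_mul h]; norm_num

/-- The weighted bounds for the second derivative and in the uniform norm. -/
theorem exists_regularity_bound : ∃ C : ℝ≥0, ∀ {ε : ℝ} {v : ℝ → ℝ}, GoodWeight ε → MemX ε v →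
    HasWeakDeriv 2 v ∧
    eLpNorm (fun x => (1 + x ^ 2) ^ (1 / 8 : ℝ) * weakDeriv 2 v x) 2 volume
      + eLpNorm (fun x => (1 + x ^ 2) ^ (1 / 8 : ℝ) * v x) ∞ volume ≤ C * normX ε v := by
  obtain ⟨C, hC0, hC⟩ := exists_second_deriv_bound
  refine ⟨⟨Real.sqrt C + Real.sqrt 6, by positivity⟩, fun {ε v} h hv => ?_⟩
  obtain ⟨v₀, v₁, v₂, hr⟩ := hv.exists_rep
  have hw2 := hr.isWeakDeriv_two
  refine ⟨⟨v₂, hw2⟩, ?_⟩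
  have hae : (fun x => x * weakDeriv 1 v x) =ᵐ[volume] fun x => x * v₁ x := by
    filter_upwards [hr.ae_eq_deriv] with x hx
    rw [hx]
  have m1 : MemLp v₁ 2 volume := (memLp_congr_ae hr.ae_eq_deriv).1 hv.2.1.2
  have i0 : Integrable fun x => weight ε x * v₀ x ^ 2 := (hv.1.congr hr.ae_eq).integrable
  have iw : Integrable fun x => weight ε x * (x * v₁ x) ^ 2 := (hv.2.2.2.congr hae).integrable
  obtain ⟨hi2, hb2⟩ := hC h hr m1 hv.2.2.1.2 iw
  have hsup := h.sup_bound hr i0 m1.integrable_sq iw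
  have e0 : ∫ x, weight ε x * v x ^ 2 = ∫ x, weight ε x * v₀ x ^ 2 := integral_congr_ae (by
    filter_upwards [hr.ae_eq] with x hx
    rw [hx])
  have e1 : ∫ x, weakDeriv 1 v x ^ 2 = ∫ x, v₁ x ^ 2 := integral_congr_ae (by
    filter_upwards [hr.ae_eq_deriv] with x hx
    rw [hx])
  have e2 : ∫ x, weight ε x * (x * weakDeriv 1 v x) ^ 2 = ∫ x, weight ε x * (x * v₁ x) ^ 2 :=
    integral_congr_ae (by
      filter_upwards [hr.ae_eq_deriv] with x hx
      rw [hx])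
  rw [normX_eq hv, e0, e1, e2]
  have n0 : 0 ≤ ∫ x, weight ε x * v₀ x ^ 2 :=
    integral_nonneg fun x => mul_nonneg (weight_pos ε x).le (sq_nonneg _)
  have n1 : 0 ≤ ∫ x, v₁ x ^ 2 := integral_nonneg fun x => sq_nonneg _
  have n2 : 0 ≤ ∫ x, weight ε x * (x * v₁ x) ^ 2 :=
    integral_nonneg fun x => mul_nonneg (weight_pos ε x).le (sq_nonneg _)
  have n3 : 0 ≤ ∫ x, weakDeriv 3 v x ^ 2 := integral_nonneg fun x => sq_nonneg _
  set S := Real.sqrt (∫ x, weight ε x * v₀ x ^ 2) +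
    Real.sqrt (∫ x, weight ε x * (x * v₁ x) ^ 2) + Real.sqrt (∫ x, v₁ x ^ 2) +
    Real.sqrt (∫ x, weakDeriv 3 v x ^ 2) with hS
  have b1 : eLpNorm (fun x => (1 + x ^ 2) ^ (1 / 8 : ℝ) * weakDeriv 2 v x) 2 volume ≤
      ENNReal.ofReal (Real.sqrt C * S) := by
    have ea : (fun x => (1 + x ^ 2) ^ (1 / 8 : ℝ) * weakDeriv 2 v x) =ᵐ[volume]
        fun x => (1 + x ^ 2) ^ (1 / 8 : ℝ) * v₂ x := by
      filter_upwards [hw2.weakDeriv_ae] with x hx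
      rw [hx]
    have hc : Continuous fun x : ℝ => (1 + x ^ 2) ^ (1 / 8 : ℝ) * v₂ x :=
      ((continuous_const.add (continuous_pow 2)).rpow_const fun x => Or.inr (by norm_num)).mul
        hr.continuous
    have hm : MemLp (fun x => (1 + x ^ 2) ^ (1 / 8 : ℝ) * v₂ x) 2 volume := by
      rw [memLp_two_iff_integrable_sq hc.aestronglyMeasurable]
      simpa only [mul_pow, eighth_sq] using hi2
    rw [eLpNorm_congr_ae ea, eLpNorm_two_eq hm]
    simp only [mul_pow, eighth_sq]
    refine ENNReal.ofReal_le_ofReal (sqrt_four_le n0 n2 n1 n3 hC0 (hb2.trans ?_))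
    exact mul_le_mul_of_nonneg_left (by linarith) hC0
  have b2 : eLpNorm (fun x => (1 + x ^ 2) ^ (1 / 8 : ℝ) * v x) ∞ volume ≤
      ENNReal.ofReal (Real.sqrt 6 * S) := by
    rw [eLpNorm_exponent_top]
    refine eLpNormEssSup_le_of_ae_bound ?_
    filter_upwards [hr.ae_eq] with x hx
    rw [hx, Real.norm_eq_abs, ← Real.sqrt_sq_eq_abs, mul_pow, eighth_sq]
    exact sqrt_four_le n0 n2 n1 n3 (by norm_num) ((hsup x).trans (by linarith))
  have hS0 : 0 ≤ S := by positivity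
  refine (add_le_add b1 b2).trans ?_
  rw [← ENNReal.ofReal_add (by positivity) (by positivity), ← add_mul,
    ENNReal.ofReal_mul (by positivity)]
  refine mul_le_mul_left ?_ _
  rw [ENNReal.ofReal]
  exact ENNReal.coe_le_coe.2 (Real.toNNReal_le_iff_le_coe.2 le_rfl)

theorem GoodWeight.unique {v v' F : ℝ → ℝ} (h : GoodWeight ε) (hv : MemX ε v) (hv' : MemX ε v')
    (hs : SolvesLinear ε F v) (hs' : SolvesLinear ε F v') : v' =ᵐ[volume] v := by
  have d1 := hv'.2.1.1.isWeakDeriv.sub hv.2.1.1.isWeakDeriv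
  have d3 := hv'.2.2.1.1.isWeakDeriv.sub hv.2.2.1.1.isWeakDeriv
  obtain ⟨v₀, v₁, v₂, hr⟩ := exists_regularRep d1 d3
  have mk := hv'.2.2.1.2.sub hv.2.2.1.2
  have m0 : MemL2w ε v₀ := by
    have : MemL2w ε fun x => v' x - v x := by
      refine (MemLp.sub hv'.1 hv.1).ae_eq (ae_of_all _ fun x => ?_)
      simp only [Pi.sub_apply]; ring
    exact this.congr hr.ae_eq
  have mw : MemL2w ε fun x => x * v₁ x := by
    have : MemL2w ε fun x => x * (weakDeriv 1 v' x - weakDeriv 1 v x) := by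
      refine (MemLp.sub hv'.2.2.2 hv.2.2.2).ae_eq (ae_of_all _ fun x => ?_)
      simp only [Pi.sub_apply]; ring
    refine this.congr ?_
    filter_upwards [hr.ae_eq_deriv] with x hx
    rw [← hx]
  have m1 : MemLp v₁ 2 volume :=
    (memLp_congr_ae hr.ae_eq_deriv).1 (hv'.2.1.2.sub hv.2.1.2)
  have hz := h.eq_zero_of_homogeneous hr m0.integrable m1 mw.integrable mk (by
    have e : mk.toLp (fun x => weakDeriv 3 v' x - weakDeriv 3 v x) =
        hv'.2.2.1.2.toLp _ - hv.2.2.1.2.toLp _ := MemLp.toLp_sub _ _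
    rw [e, map_sub]
    filter_upwards [Lp.coeFn_sub (iHilbert (hv'.2.2.1.2.toLp (weakDeriv 3 v')))
      (iHilbert (hv.2.2.1.2.toLp (weakDeriv 3 v))), I_mul_hilbert_ae hv'.2.2.1.2,
      I_mul_hilbert_ae hv.2.2.1.2, hs, hs', hr.ae_eq_deriv] with x a1 a2 a3 a4 a5 a6
    rw [a1, Pi.sub_apply, ← a2, ← a3, ← a6]
    push_cast at a4 a5 ⊢
    linear_combination a5 - a4)
  filter_upwards [hr.ae_eq, hz] with x a b
  rw [b] at a
  simpa using sub_eq_zero.1 a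

theorem GoodWeight.exists_solution_memX {F : ℝ → ℝ} (h : GoodWeight ε) (hF : MemLp F 2 volume)
    (hFw : MemLp (fun x => weight ε x ^ (-(1 / 2) : ℝ) * F x) 2 volume) :
    ∃ v, MemX ε v ∧ SolvesLinear ε F v ∧ normX ε v ≤ (400000 : ℝ≥0) * normData ε F := by
  obtain ⟨v, u, k, w1, w3, mv, mxu, mu, mk, heq, b1, b2, b3, b4⟩ := h.exists_solution hF hFw
  have a1 := w1.weakDeriv_ae
  have a3 := w3.weakDeriv_ae
  have m3 : MemLp (weakDeriv 3 v) 2 volume := (memLp_congr_ae a3).2 mk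
  have axu : (fun x => x * u x) =ᵐ[volume] fun x => x * weakDeriv 1 v x := by
    filter_upwards [a1] with x hx
    rw [hx]
  have hX : MemX ε v := ⟨mv, ⟨⟨u, w1⟩, (memLp_congr_ae a1).2 mu⟩, ⟨⟨k, w3⟩, m3⟩, mxu.congr axu⟩
  refine ⟨v, hX, ?_, ?_⟩
  · have e : m3.toLp _ = mk.toLp _ := MemLp.toLp_congr m3 mk a3
    have h1 := I_mul_hilbert_ae m3
    rw [e] at h1
    filter_upwards [h1, I_mul_hilbert_ae mk, heq, a1] with x c1 c2 c3 c4
    rw [c1, ← c2, c4]; exact c3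
  · have eF : eLpNorm (fun x => weight ε x ^ (-(1 / 2) : ℝ) * F x) 2 volume =
        ENNReal.ofReal (Real.sqrt (∫ x, F x ^ 2 / weight ε x)) := by
      rw [eLpNorm_two_eq hFw]
      congr 3; ext x
      have hw := weight_pos ε x
      rw [mul_pow, ← Real.rpow_natCast (weight ε x ^ (-(1 / 2) : ℝ)), ← Real.rpow_mul hw.le]
      norm_num
      rw [Real.rpow_neg_one]
      field_simp
    have e1 : ∫ x, weakDeriv 1 v x ^ 2 = ∫ x, u x ^ 2 := integral_congr_ae (by
      filter_upwards [a1] with x hx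
      rw [hx])
    have e2 : ∫ x, weight ε x * (x * weakDeriv 1 v x) ^ 2 = ∫ x, weight ε x * (x * u x) ^ 2 :=
      integral_congr_ae (by
        filter_upwards [a1] with x hx
        rw [hx])
    have e3 : ∫ x, weakDeriv 3 v x ^ 2 = ∫ x, k x ^ 2 := integral_congr_ae (by
      filter_upwards [a3] with x hx
      rw [hx])
    simp only [sq_weight_half_mul] at b1 b2
    rw [normX_eq hX, normData, eF, eLpNorm_two_eq hF, e1, e2, e3,
      ← ENNReal.ofReal_add (by positivity) (by positivity)]
    set S := Real.sqrt (∫ x, F x ^ 2) + Real.sqrt (∫ x, F x ^ 2 / weight ε x) with hS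
    have n1 : 0 ≤ ∫ x, F x ^ 2 := integral_nonneg fun x => sq_nonneg _
    have n2 : 0 ≤ ∫ x, F x ^ 2 / weight ε x :=
      integral_nonneg fun x => div_nonneg (sq_nonneg _) (weight_pos ε x).le
    -- The root of `10¹⁰` appears once for each of the four parts of the norm, whence `400000`.
    have hsq : ∀ y, y ≤ 10 ^ 10 * ((∫ x, F x ^ 2) + ∫ x, F x ^ 2 / weight ε x) →
        Real.sqrt y ≤ 100000 * S := fun y hy => by
      have h1 := sqrt_four_le n1 n2 le_rfl le_rfl (by norm_num : (0 : ℝ) ≤ 10 ^ 10)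
        (by simpa using hy)
      have h2 : Real.sqrt (10 ^ 10) = 100000 := by
        rw [show (10 : ℝ) ^ 10 = 100000 ^ 2 by norm_num, Real.sqrt_sq (by norm_num)]
      rw [h2] at h1
      simpa using h1
    have e : ((400000 : ℝ≥0) : ℝ≥0∞) = ENNReal.ofReal 400000 := by
      rw [ENNReal.ofReal]; simp
    rw [e, ← ENNReal.ofReal_mul (by norm_num)]
    refine ENNReal.ofReal_le_ofReal ?_
    linarith [hsq _ b1, hsq _ b2, hsq _ b3, hsq _ b4]

end

end SelfSimilar

theorem theorem4p5 :
    ∃ ε₀ : ℝ, 0 < ε₀ ∧ ∃ C : ℝ≥0, ∀ ε : ℝ, |ε| ≤ ε₀ →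
      ∀ F : ℝ → ℝ, MemLp F 2 volume →
        MemLp (fun x => weight ε x ^ (-(1 / 2) : ℝ) * F x) 2 volume →
        ∃ v : ℝ → ℝ,
          MemX ε v ∧ SolvesLinear ε F v ∧
          (∀ v' : ℝ → ℝ, MemX ε v' → SolvesLinear ε F v' → v' =ᵐ[volume] v) ∧
          normX ε v ≤ C * normData ε F ∧
          HasWeakDeriv 2 v ∧
          eLpNorm (fun x => (1 + x ^ 2) ^ (1 / 8 : ℝ) * weakDeriv 2 v x) 2 volume
            + eLpNorm (fun x => (1 + x ^ 2) ^ (1 / 8 : ℝ) * v x) ∞ volume ≤ C * normX ε v := by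
  obtain ⟨C, hC⟩ := exists_regularity_bound
  -- The threshold is that of `goodWeight`; adding the two constants serves both inequalities.
  refine ⟨1 / 10 ^ 10, by positivity, C + 400000, fun ε hε F hF hFw => ?_⟩
  have h := goodWeight hε
  obtain ⟨v, hX, hs, hb⟩ := h.exists_solution_memX hF hFw
  obtain ⟨h2, hr⟩ := hC h hX
  have h₁ : ((400000 : ℝ≥0) : ℝ≥0∞) ≤ (C + 400000 : ℝ≥0) :=
    ENNReal.coe_le_coe.2 le_add_self
  have h₂ : (C : ℝ≥0∞) ≤ (C + 400000 : ℝ≥0) := ENNReal.coe_le_coe.2 le_self_add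
  exact ⟨v, hX, hs, fun v' hv' hs' => h.unique hX hv' hs hs', hb.trans (by gcongr), h2,
    hr.trans (by gcongr)⟩
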